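/- **Setting.** Let $d,m\ge 1$ and let $(\Omega,\mu)$ be a $\sigma$-finite measure space. A *quasi-Banach function space* over $(\Omega,\mu)$ is an order ideal $X\subseteq L^0(\Omega)$ with a quasi-norm such that $|\xi|\le|\eta|$ implies $\|\xi\|_X\le\|\eta\|_X$, such that some $\xi\in X$ satisfies $\xi>0$ a.e., and such that $0\le\xi_n\uparrow\xi$ with $\xi_n\in X$ and $\sup_n\|\xi_n\|_X<\infty$ implies $\xi\in X$ and $\|\xi\|_X=\sup_n\|\xi_n\|_X$; it is a *Banach function space* if $\|\cdot\|_X$ is a norm. It is *order-continuous* if $0\le\xi_n\uparrow\xi\in X$ implies $\|\xi-\xi_n\|_X\to0$, and *$p$-convex* if $\|(\sum_{k}|\xi_k|^p)^{1/p}\|_X\le(\sum_k\|\xi_k\|_X^p)^{1/p}$ for all finite families in $X$. For $p\in(0,\infty)$ let $X^p=\{\xi\in L^0(\Omega):|\xi|^{1/p}\in X\}$ with $\|\xi\|_{X^p}=\||\xi|^{1/p}\|_X^p$. The product $\prod_{j}X_j$ consists of all $\xi \in L^0(\Omega)$ with $|\xi|\le\prod_j\xi_j$ for some $0\le\xi_j\in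 X_j$, and $\|\xi\|_{\prod_j X_j}$ is the infimum of $\prod_j\|\xi_j\|_{X_j}$ over all such $\xi_j$. An *$m$-tuple of quasi-Banach function spaces* is a tuple $\vec X=(X_1,\dots,X_m)$ of quasi-Banach function spaces over the same $(\Omega,\mu)$ whose product $X:=\prod_jX_j$ is again a quasi-Banach function space. The dual $X^*$ of an order-continuous Banach function space $X$ is regarded as a function space over $\Omega$, with $\|\eta\|_{X^*}=\sup\{\int_\Omega|\xi\eta|\,d\mu:\|\xi\|_X\le1\}$. Put $\vec X^q=(X_1^q,\dots,X_m^q)$ and, for exponents $\vec r$, $\frac1r=\sum_j\frac1{r_j}$. A *cube* is a half-open cube in $\mathbb R^d$ with sides parallel to the axes, and $\langle f\rangle_{r,Q}=\big(\frac1{|Q|}\int_Q|f|^r\,dx\big)^{1/r}$. For scalar functions let $M_{\vec r}(\vec f\,)(x)=\sup_Q\prod_j\langle f_j\rangle_{r_j,Q}\mathbf 1_Q(x)$, with the supremum over all cubes $Q\subseteq\mathbb R^d$. For a finite collection of cubes $\mathcal D$ and functions $f_j:\mathbb R^d\to X_j$ let $\widetilde M^{\mathcal D}_{\vec r}(\vec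 f\,)(x)=\sup_{Q\in\mathcal D}\prod_j\langle f_j\rangle_{r_j,Q}\mathbf 1_Q(x)$, with averages and supremum taken pointwise on $\Omega$. A tuple $\vec X$ is said to have the property $\mathrm{HL}_{\vec r}$ if each $X_j$ is $r_j$-convex and for some exponents $p_j\in(r_j,\infty]$ and $\frac1p=\sum_j\frac1{p_j}$ the operators $\widetilde M^{\mathcal D}_{\vec r}$ are bounded from $\prod_jL^{p_j}(\mathbb R^d;X_j)$ (Bochner spaces) to $L^p(\mathbb R^d;X)$, uniformly over all finite collections $\mathcal D$ of cubes. For $s\in(r,\infty]$, $s>1$, with $\frac1s+\frac1{s'}=1$, we write $\vec X\in\mathrm{UMD}_{\vec r,s}$ if $X$ is an order-continuous Banach function space and $(X_1,\dots,X_m,X^*)$ has the property $\mathrm{HL}_{(r_1,\dots,r_m,s')}$. **Theorem.** Let $\vec r\in(0,\infty)^m$, $q\in(0,\infty)$ and $s\in(q,\infty]$, and let $\vec X$ be an $m$-tuple of quasi-Banach function spaces over $(\Omega,\mu)$ with $\vec X^q\in\mathrm{UMD}_{\frac{\vec r}{q},\frac sq}$. There is a constant $K$, depending only on $\vec X,q,\vec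 r,s,d,m$, such that the following holds. Let $T$ be an operator mapping $m$-tuples of functions on $\mathbb R^d$ to functions on $\mathbb R^d$, and let $C_T\ge0$ be such that for all $f_1,\dots,f_m,g\in L^\infty_c(\mathbb R^d)$ $$\|T(\vec f\,)\cdot g\|_{L^q(\mathbb R^d)}\le C_T\,\Big\|M_{\big(\vec r,\frac1{\frac1q-\frac1s}\big)}(\vec f,g)\Big\|_{L^q(\mathbb R^d)}.$$ Suppose that for all simple functions $f_j\in L^\infty_c(\mathbb R^d;X_j)$, $1\le j\le m$, the function $\widetilde T(\vec f\,):\mathbb R^d\to X$ given by $\widetilde T(\vec f\,)(x,\omega)=T(\vec f(\cdot,\omega))(x)$ is well defined and strongly measurable (that is, there is a jointly measurable function $\widetilde T(\vec f\,)$ on $\mathbb R^d\times\Omega$ that satisfies this identity for a.e. $x$, for a.e. $\omega$, and that is strongly measurable as an $X$-valued function on $\mathbb R^d$). Then for all simple functions $f_j\in L^\infty_c(\mathbb R^d;X_j)$ and all $g\in L^\infty_c(\mathbb R^d)$ $$\Big\|\,\|\widetilde T(\vec f\,)\|_X\cdot g\Big\|_{L^q(\mathbb R^d)}\le K\,C_T\,\Big\|M_{\big(\vec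 r,\frac1{\frac1q-\frac1s}\big)}\big(\|f_1\|_{X_1},\dots,\|f_m\|_{X_m},g\big)\Big\|_{L^q(\mathbb R^d)}.$$ -/

import Mathlib

open MeasureTheory Filter Topology
open scoped ENNReal NNReal

noncomputable section

namespace SparseDomination

/-! ### Quasi-Banach function spaces

A quasi-Banach function space `X` over `(Ω, μ)` is an order ideal of `L⁰(Ω)` whose quasi-norm
satisfies `‖ξ‖_X = ‖|ξ|‖_X`. It is encoded by its extended function quasi-norm `ρ`, defined on
`[0, ∞]`-valued functions: `X` consists of the measurable `ξ : Ω → ℂ` with `ρ |ξ| < ∞`, and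
`‖ξ‖_X = ρ |ξ|`. -/

/-- Extended function quasi-norms (no axioms yet). -/
abbrev FunctionNorm (Ω : Type*) := (Ω → ℝ≥0∞) → ℝ≥0∞

section FunctionSpaces

variable {Ω : Type*} [MeasurableSpace Ω]

/-- Membership of `ξ` in the space `X` with function quasi-norm `ρ`. -/
def MemSpace (μ : Measure Ω) (ρ : FunctionNorm Ω) (ξ : Ω → ℂ) : Prop :=
  AEMeasurable ξ μ ∧ ρ (fun ω => ‖ξ ω‖ₑ) < ∞

/-- `ρ` is the function quasi-norm of a quasi-Banach function space over `(Ω, μ)`: it is a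
quasi-norm, it is compatible with the order, there is a weak order unit, and it has the Fatou
property. (If `⨆ n, ρ (u n) = ∞`, the last property follows from `mono`. Functions with
`ρ u < ∞` are automatically finite almost everywhere, and completeness is automatic.) -/
structure IsQuasiBanachFunctionSpace (μ : Measure Ω) (ρ : FunctionNorm Ω) : Prop where
  eq_zero_iff : ∀ u : Ω → ℝ≥0∞, AEMeasurable u μ → (ρ u = 0 ↔ u =ᵐ[μ] 0)
  smul : ∀ (c : ℝ≥0) (u : Ω → ℝ≥0∞), AEMeasurable u μ →
    ρ (fun ω => (c : ℝ≥0∞) * u ω) = (c : ℝ≥0∞) * ρ u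
  quasi_triangle : ∃ K : ℝ≥0, ∀ u v : Ω → ℝ≥0∞, AEMeasurable u μ → AEMeasurable v μ →
    ρ (fun ω => u ω + v ω) ≤ (K : ℝ≥0∞) * (ρ u + ρ v)
  mono : ∀ u v : Ω → ℝ≥0∞, AEMeasurable u μ → AEMeasurable v μ →
    (∀ᵐ ω ∂μ, u ω ≤ v ω) → ρ u ≤ ρ v
  weak_order_unit : ∃ u : Ω → ℝ≥0∞, AEMeasurable u μ ∧ (∀ᵐ ω ∂μ, 0 < u ω) ∧ ρ u < ∞
  fatou : ∀ u : ℕ → Ω → ℝ≥0∞, (∀ n, AEMeasurable (u n) μ) →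
    (∀ᵐ ω ∂μ, Monotone fun n => u n ω) → ρ (fun ω => ⨆ n, u n ω) = ⨆ n, ρ (u n)

/-- A Banach function space: the quasi-norm is a norm. -/
def IsBanachFunctionSpace (μ : Measure Ω) (ρ : FunctionNorm Ω) : Prop :=
  IsQuasiBanachFunctionSpace μ ρ ∧
    ∀ u v : Ω → ℝ≥0∞, AEMeasurable u μ → AEMeasurable v μ →
      ρ (fun ω => u ω + v ω) ≤ ρ u + ρ v

/-- Order-continuity: `0 ≤ ξₙ ↑ ξ ∈ X` implies `‖ξ - ξₙ‖_X → 0`. -/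
def IsOrderContinuous (μ : Measure Ω) (ρ : FunctionNorm Ω) : Prop :=
  ∀ (u : ℕ → Ω → ℝ≥0∞) (v : Ω → ℝ≥0∞), (∀ n, AEMeasurable (u n) μ) → AEMeasurable v μ →
    (∀ᵐ ω ∂μ, Monotone fun n => u n ω) → (∀ᵐ ω ∂μ, ⨆ n, u n ω = v ω) → ρ v < ∞ →
      Tendsto (fun n => ρ (fun ω => v ω - u n ω)) atTop (𝓝 0)

/-- `p`-convexity (with constant `1`). -/
def IsConvexSpace (μ : Measure Ω) (ρ : FunctionNorm Ω) (p : ℝ) : Prop :=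
  ∀ (n : ℕ) (u : Fin n → Ω → ℝ≥0∞), (∀ k, AEMeasurable (u k) μ) →
    ρ (fun ω => (∑ k, u k ω ^ p) ^ (1 / p)) ≤ (∑ k, ρ (u k) ^ p) ^ (1 / p)

/-- The `p`-concavification `X ^ p`, with `‖ξ‖_{X ^ p} = ‖|ξ| ^ (1 / p)‖_X ^ p`. -/
def concavification (ρ : FunctionNorm Ω) (p : ℝ) : FunctionNorm Ω :=
  fun u => ρ (fun ω => u ω ^ (1 / p)) ^ p

/-- The product space: the infimum of `∏ j, ‖ξ_j‖_{X_j}` over all `0 ≤ ξ_j ∈ X_j` with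
`|ξ| ≤ ∏ j, ξ_j` almost everywhere (it is `∞` if there are none). -/
def productNorm {n : ℕ} (μ : Measure Ω) (ρ : Fin n → FunctionNorm Ω) : FunctionNorm Ω :=
  fun u => ⨅ (v : Fin n → Ω → ℝ≥0∞) (_ : ∀ j, AEMeasurable (v j) μ ∧ ρ j (v j) < ∞)
    (_ : ∀ᵐ ω ∂μ, u ω ≤ ∏ j, v j ω), ∏ j, ρ j (v j)

/-- The dual `X*` as a function space: `‖η‖_{X*} = sup {∫ |ξ η| dμ : ‖ξ‖_X ≤ 1}`. For an
order-continuous Banach function space this is the Banach dual, through integration. -/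
def dualNorm (μ : Measure Ω) (ρ : FunctionNorm Ω) : FunctionNorm Ω :=
  fun u => ⨆ (v : Ω → ℝ≥0∞) (_ : AEMeasurable v μ ∧ ρ v ≤ 1), ∫⁻ ω, u ω * v ω ∂μ

/-- An `n`-tuple of quasi-Banach function spaces over `(Ω, μ)`: the product is required to be a
quasi-Banach function space as well. -/
def IsTuple {n : ℕ} (μ : Measure Ω) (ρ : Fin n → FunctionNorm Ω) : Prop :=
  (∀ j, IsQuasiBanachFunctionSpace μ (ρ j)) ∧ IsQuasiBanachFunctionSpace μ (productNorm μ ρ)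

end FunctionSpaces

/-! ### Cubes and maximal operators -/

/-- A half-open cube in `ℝ^d` with sides parallel to the axes. -/
structure Cube (d : ℕ) where
  corner : Fin d → ℝ
  side : ℝ
  side_pos : 0 < side

/-- The set of points of a cube. -/
def Cube.toSet {d : ℕ} (Q : Cube d) : Set (Fin d → ℝ) :=
  Set.pi Set.univ fun i => Set.Ico (Q.corner i) (Q.corner i + Q.side)

/-- The average `⟨u⟩_{r,Q}` of `u ≥ 0`. -/
def cubeAverage {d : ℕ} (r : ℝ) (u : (Fin d → ℝ) → ℝ≥0∞) (Q : Cube d) : ℝ≥0∞ :=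
  ((volume Q.toSet)⁻¹ * ∫⁻ x in Q.toSet, u x ^ r) ^ (1 / r)

/-- The multisublinear maximal operator `M_r` over the collection `𝒟` of cubes, as a function of
the moduli `u j = |f_j|`. -/
def maximalOperator {d n : ℕ} (𝒟 : Set (Cube d)) (r : Fin n → ℝ)
    (u : Fin n → (Fin d → ℝ) → ℝ≥0∞) (x : Fin d → ℝ) : ℝ≥0∞ :=
  ⨆ Q ∈ 𝒟, Q.toSet.indicator (fun _ => ∏ j, cubeAverage (r j) (u j) Q) x

/-- The multisublinear lattice maximal operator: suprema in the lattice sense over a finite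
collection of cubes are pointwise in `ω`. -/
def latticeMaximalOperator {Ω : Type*} {d n : ℕ} (𝒟 : Finset (Cube d)) (r : Fin n → ℝ)
    (f : Fin n → (Fin d → ℝ) → Ω → ℂ) (x : Fin d → ℝ) (ω : Ω) : ℝ≥0∞ :=
  maximalOperator (𝒟 : Set (Cube d)) r (fun j y => ‖f j y ω‖ₑ) x

/-- `g ∈ L^∞_c(ℝ^d)`. -/
def IsLInftyC {d : ℕ} (g : (Fin d → ℝ) → ℂ) : Prop :=
  MemLp g ∞ volume ∧ HasCompactSupport g

section VectorValued

variable {Ω : Type*} [MeasurableSpace Ω] {d : ℕ}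

/-- A simple function `ℝ^d → X`: finitely many values, each in `X`, on measurable sets. -/
def IsSimpleInto (μ : Measure Ω) (ρ : FunctionNorm Ω) (f : SimpleFunc (Fin d → ℝ) (Ω → ℂ)) :
    Prop :=
  ∀ x, MemSpace μ ρ (f x)

/-- `x ↦ ‖F(x, ·)‖_X`. -/
def pointwiseNorm (ρ : FunctionNorm Ω) (F : (Fin d → ℝ) → Ω → ℂ) (x : Fin d → ℝ) : ℝ≥0∞ :=
  ρ fun ω => ‖F x ω‖ₑ

/-- `F ∈ L⁰(ℝ^d; X)`: `F` is (a jointly measurable version of) a strongly measurable function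
`ℝ^d → X`, that is, an almost everywhere limit in `X` of simple functions `ℝ^d → X`. -/
def IsStronglyMeasurableInto (μ : Measure Ω) (ρ : FunctionNorm Ω)
    (F : (Fin d → ℝ) → Ω → ℂ) : Prop :=
  AEMeasurable (Function.uncurry F) ((volume : Measure (Fin d → ℝ)).prod μ) ∧
    ∃ s : ℕ → SimpleFunc (Fin d → ℝ) (Ω → ℂ), (∀ n, IsSimpleInto μ ρ (s n)) ∧
      ∀ᵐ x : Fin d → ℝ, Tendsto (fun n => ρ fun ω => ‖F x ω - s n x ω‖ₑ) atTop (𝓝 0)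

/-- `F ∈ L^p(ℝ^d; X)`, the Bochner space. -/
def MemBochner (μ : Measure Ω) (ρ : FunctionNorm Ω) (p : ℝ≥0∞) (F : (Fin d → ℝ) → Ω → ℂ) :
    Prop :=
  IsStronglyMeasurableInto μ ρ F ∧ eLpNorm (pointwiseNorm ρ F) p volume < ∞

variable (d) in
/-- The `r`-Hardy–Littlewood property of a tuple of spaces: it is `r`-convex and, for some
`r < p ≤ ∞`, the lattice maximal operators over finite collections of cubes are uniformly bounded
from `∏ j, L^{p_j}(ℝ^d; X_j)` to `L^p(ℝ^d; X)`, where `X = ∏ j, X_j` and `1 / p = ∑ j, 1 / p_j`. -/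
def HardyLittlewood {n : ℕ} (μ : Measure Ω) (ρ : Fin n → FunctionNorm Ω) (r : Fin n → ℝ) :
    Prop :=
  (∀ j, IsConvexSpace μ (ρ j) (r j)) ∧
    ∃ p : Fin n → ℝ≥0∞, (∀ j, ENNReal.ofReal (r j) < p j) ∧
      ∃ C : ℝ≥0, ∀ (𝒟 : Finset (Cube d)) (f : Fin n → (Fin d → ℝ) → Ω → ℂ),
        (∀ j, MemBochner μ (ρ j) (p j) (f j)) →
          eLpNorm (fun x => productNorm μ ρ (latticeMaximalOperator 𝒟 r f x))
              (∑ j, (p j)⁻¹)⁻¹ volume ≤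
            C * ∏ j, eLpNorm (pointwiseNorm (ρ j) (f j)) (p j) volume

/-- The conjugate exponent `s'`, with `1 / s + 1 / s' = 1`, for `s ∈ (1, ∞]`. -/
def conjExponent (s : ℝ≥0∞) : ℝ := (1 - (s⁻¹).toReal)⁻¹

variable (d) in
/-- The `(r, s)`-UMD property, for `s ∈ (r, ∞]` where `1 / r = ∑ j, 1 / r_j`: the product
`X = ∏ j, X_j` is an order-continuous Banach function space and the tuple `(X_1, …, X_n, X*)` has
the `(r, s')`-Hardy–Littlewood property. -/
def UMDProperty {n : ℕ} (μ : Measure Ω) (ρ : Fin n → FunctionNorm Ω) (r : Fin n → ℝ)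
    (s : ℝ≥0∞) : Prop :=
  ENNReal.ofReal (∑ j, (r j)⁻¹)⁻¹ < s ∧
    IsBanachFunctionSpace μ (productNorm μ ρ) ∧ IsOrderContinuous μ (productNorm μ ρ) ∧
      HardyLittlewood d μ
        (Fin.snoc (α := fun _ => FunctionNorm Ω) ρ (dualNorm μ (productNorm μ ρ)))
        (Fin.snoc (α := fun _ => ℝ) r (conjExponent s))

/-- A tuple of simple functions `f_j ∈ L^∞_c(ℝ^d; X_j)`. -/
def IsSimpleTuple {m : ℕ} (μ : Measure Ω) (ρ : Fin m → FunctionNorm Ω)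
    (f : Fin m → SimpleFunc (Fin d → ℝ) (Ω → ℂ)) : Prop :=
  ∀ j, IsSimpleInto μ (ρ j) (f j) ∧ HasCompactSupport (f j)

/-- `F = T̃(f)`, that is, `F(x, ω) = T(f(·, ω))(x)`, and `F` is strongly measurable as a function
`ℝ^d → X`. As the functions `T(f(·, ω))` are only given up to null sets, the identity is required
almost everywhere in `x`, for almost every `ω`. -/
def IsPointwiseExtension {m : ℕ} (μ : Measure Ω) (ρ : Fin m → FunctionNorm Ω)
    (T : (Fin m → (Fin d → ℝ) → ℂ) → (Fin d → ℝ) → ℂ)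
    (f : Fin m → SimpleFunc (Fin d → ℝ) (Ω → ℂ)) (F : (Fin d → ℝ) → Ω → ℂ) : Prop :=
  (∀ᵐ ω ∂μ, (fun x => F x ω) =ᵐ[volume] T (fun j y => f j y ω)) ∧
    IsStronglyMeasurableInto μ (productNorm μ ρ) F

end VectorValued

/-- The right-hand side of sparse domination: `‖M_{(r, 1 / (1 / q - 1 / s))}(u, v)‖_{L^q}`. -/
def sparseBound {d m : ℕ} (r : Fin m → ℝ) (q : ℝ) (s : ℝ≥0∞)
    (u : Fin m → (Fin d → ℝ) → ℝ≥0∞) (v : (Fin d → ℝ) → ℝ≥0∞) : ℝ≥0∞ :=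
  eLpNorm
    (maximalOperator Set.univ
      (Fin.snoc (α := fun _ => ℝ) r (1 / (1 / q - (s⁻¹).toReal)))
      (Fin.snoc (α := fun _ => (Fin d → ℝ) → ℝ≥0∞) u v))
    (ENNReal.ofReal q) volume

end SparseDomination

end

open SparseDomination

/-!
By duality the `X`-valued inequality is a scalar inequality on `Ω`, integrated, followed by a bound
in `L¹(Ω)` for a lattice maximal operator.

Put `Y = ∏ j, X_j ^ q`, so that `‖|ξ| ^ q‖_Y = ‖ξ‖_X ^ q`. As `Y` is an order-continuous Banach
function space, each of its elements is normed by a function in the unit ball of `Y*`: Hahn–Banach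
for `ξ ↦ ‖ξ⁺‖` gives a positive norming functional, and order-continuity makes it countably
additive, hence an integral (`exists_norming`). Approximating `F = T̃(f)` by simple functions, one
computes `‖F(x)‖_X ^ q |g(x)| ^ q` up to a constant by pairing `|F| ^ q` with simple functions `k`
such that `‖k(x)‖_{Y*} ≤ |g(x)| ^ q` (`exists_norming_simpleFunc`). The scalar hypothesis for
`f(·, ω)` and `k(·, ω) ^ (1 / q)`, raised to the power `q` and integrated over `Ω`, bounds this
pairing by the integral over `ℝ^d × Ω` of the lattice maximal operator of the tuple
`(|f_1| ^ q, …, |f_m| ^ q, k)` (`lintegral_test_le`).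

It remains to dominate that integral by the integral over `ℝ^d` of the scalar maximal operator of
the norms (`exists_lintegral_maximalOperator_le`); this is where the Hardy–Littlewood property of
`(X_1 ^ q, …, X_m ^ q, Y*)` enters. By Hölder's inequality the product of that tuple embeds
contractively into `L¹(Ω)` (`lintegral_le_productNorm_snoc`), so one works with `L¹(Ω)`-norms.

* Inside a dyadic cube `Q`, replace the functions by their lattice averages over the maximal
  subcubes on which an average of the norms is much larger than over `Q`. By convexity the new
  functions have norms bounded by multiples of the averages over `Q`, and off a small part of `Q`
  the lattice averages are unchanged (`exists_truncation`). The Hardy–Littlewood property for bounded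
  functions, in weak form, therefore bounds the `L¹(Ω)`-norm of the lattice supremum by the product
  of the scalar averages over `Q` on at least half of `Q` (`exists_volume_gridMax_gt_le`). Only the
  boundedness for one choice of exponents `p_j` is needed.
* Stop at the first level at which this bound fails. The part of `Q` that is left over has at least
  half of its measure and pays for the product of the averages over `Q`; on the stopping cubes the
  argument is repeated (`exists_setLIntegral_gridMax_le`). Lattice suprema are truncated to finitely
  many levels, so the induction ends.
* The one-third trick passes from dyadic grids to finite collections of cubes
  (`exists_lintegral_finset_le`), and monotone convergence along a countable family of cubes to all
  cubes.
-/

noncomputable section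

namespace SparseDomination

/-! ### Duality for order-continuous Banach function spaces -/

section Duality

variable {Ω : Type*} [MeasurableSpace Ω] {μ : Measure Ω} {N : FunctionNorm Ω}

theorem IsQuasiBanachFunctionSpace.zero (hN : IsQuasiBanachFunctionSpace μ N) :
    N (fun _ => 0) = 0 :=
  (hN.eq_zero_iff _ aemeasurable_const).2 (Filter.EventuallyEq.refl _ _)

theorem IsQuasiBanachFunctionSpace.congr (hN : IsQuasiBanachFunctionSpace μ N)
    {u v : Ω → ℝ≥0∞} (hu : AEMeasurable u μ) (h : u =ᵐ[μ] v) : N u = N v :=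
  le_antisymm (hN.mono _ _ hu (hu.congr h) (h.mono fun _ h => h.le))
    (hN.mono _ _ (hu.congr h) hu (h.mono fun _ h => h.ge))

theorem IsQuasiBanachFunctionSpace.ae_lt_top (hN : IsQuasiBanachFunctionSpace μ N)
    {u : Ω → ℝ≥0∞} (hu : AEMeasurable u μ) (h : N u < ∞) : ∀ᵐ ω ∂μ, u ω < ∞ := by
  classical
  set g : Ω → ℝ≥0∞ := fun ω => if u ω = ∞ then 1 else 0 with hg
  have hφ : Measurable fun x : ℝ≥0∞ => if x = ∞ then (1 : ℝ≥0∞) else 0 :=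
    Measurable.ite (measurableSet_singleton _) measurable_const measurable_const
  have hgm : AEMeasurable g μ := hφ.comp_aemeasurable hu
  have hle : ∀ c : ℝ≥0, (c : ℝ≥0∞) * N g ≤ N u := by
    intro c
    rw [← hN.smul c g hgm]
    refine hN.mono _ _ (hgm.const_mul _) hu (Eventually.of_forall fun ω => ?_)
    by_cases h : u ω = ∞ <;> simp [hg, h]
  have h0 : N g = 0 := by
    by_contra hne
    obtain ⟨n, hn⟩ := ENNReal.exists_nat_mul_gt hne h.ne
    exact absurd (hle n) (not_le.2 (by simpa using hn))
  filter_upwards [(hN.eq_zero_iff g hgm).1 h0] with ω hω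
  by_contra hcon
  have : u ω = ∞ := by simpa using hcon
  simp [hg, this] at hω

/-- Hölder's inequality for a function space and its dual. -/
theorem lintegral_mul_le_mul_dualNorm (hN : IsQuasiBanachFunctionSpace μ N) {a b : Ω → ℝ≥0∞}
    (ha : AEMeasurable a μ) (hfin : N a < ∞) :
    ∫⁻ ω, a ω * b ω ∂μ ≤ N a * dualNorm μ N b := by
  rcases eq_or_ne (N a) 0 with h0 | h0
  · have : (fun ω => a ω * b ω) =ᵐ[μ] 0 := by
      filter_upwards [(hN.eq_zero_iff a ha).1 h0] with ω hω
      simp [hω]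
    rw [lintegral_congr_ae this]
    simp
  · set c : ℝ≥0 := (N a).toNNReal with hc
    have hcN : (c : ℝ≥0∞) = N a := ENNReal.coe_toNNReal hfin.ne
    have hc0 : c ≠ 0 := by
      intro h
      rw [h] at hcN
      exact h0 hcN.symm
    set v : Ω → ℝ≥0∞ := fun ω => ((c⁻¹ : ℝ≥0) : ℝ≥0∞) * a ω with hv
    have hcc : (c : ℝ≥0∞) * ((c⁻¹ : ℝ≥0) : ℝ≥0∞) = 1 := by
      rw [← ENNReal.coe_mul, mul_inv_cancel₀ hc0, ENNReal.coe_one]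
    have hv1 : N v ≤ 1 := by
      rw [hv, hN.smul _ _ ha, ← hcN, mul_comm, hcc]
    have key : ∫⁻ ω, b ω * v ω ∂μ ≤ dualNorm μ N b :=
      le_iSup₂_of_le (f := fun (v : Ω → ℝ≥0∞) (_ : AEMeasurable v μ ∧ N v ≤ 1) =>
        ∫⁻ ω, b ω * v ω ∂μ) v ⟨ha.const_mul _, hv1⟩ le_rfl
    calc ∫⁻ ω, a ω * b ω ∂μ = ∫⁻ ω, (c : ℝ≥0∞) * (b ω * v ω) ∂μ := by
          refine lintegral_congr fun ω => ?_
          rw [hv]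
          calc a ω * b ω = ((c : ℝ≥0∞) * ((c⁻¹ : ℝ≥0) : ℝ≥0∞)) * (a ω * b ω) := by
                rw [hcc, one_mul]
            _ = _ := by ring
      _ = (c : ℝ≥0∞) * ∫⁻ ω, b ω * v ω ∂μ := lintegral_const_mul' _ _ ENNReal.coe_ne_top
      _ ≤ N a * dualNorm μ N b := by
          rw [hcN]
          gcongr

/-- The real vector space of measurable real functions with finite norm. Its elements are functions,
not classes modulo null sets. -/
def realSpace (hN : IsBanachFunctionSpace μ N) : Submodule ℝ (Ω → ℝ) where
  carrier := {ξ | Measurable ξ ∧ N (fun ω => ‖ξ ω‖ₑ) < ∞}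
  add_mem' := by
    rintro a b ⟨ha, ha'⟩ ⟨hb, hb'⟩
    refine ⟨ha.add hb, lt_of_le_of_lt ?_ (ENNReal.add_lt_top.2 ⟨ha', hb'⟩)⟩
    refine le_trans (hN.1.mono _ _ (ha.add hb).enorm.aemeasurable
      (ha.enorm.add hb.enorm).aemeasurable ?_)
      (hN.2 _ _ ha.enorm.aemeasurable hb.enorm.aemeasurable)
    exact Eventually.of_forall fun ω => enorm_add_le _ _
  zero_mem' := ⟨measurable_zero, by simp [hN.1.zero]⟩
  smul_mem' := by
    rintro c a ⟨ha, ha'⟩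
    refine ⟨ha.const_smul c, ?_⟩
    have : (fun ω => ‖(c • a) ω‖ₑ) = fun ω => ((‖c‖₊ : ℝ≥0) : ℝ≥0∞) * ‖a ω‖ₑ := by
      funext ω
      simp [enorm_mul]
      rfl
    rw [this, hN.1.smul _ _ ha.enorm.aemeasurable]
    exact ENNReal.mul_lt_top ENNReal.coe_lt_top ha'

/-- The sublinear functional `ξ ↦ ‖ξ⁺‖`. -/
def posNorm (hN : IsBanachFunctionSpace μ N) (ξ : realSpace hN) : ℝ :=
  (N fun ω => ENNReal.ofReal ((ξ : Ω → ℝ) ω)).toReal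

theorem norm_ofReal_lt_top (hN : IsBanachFunctionSpace μ N) (ξ : realSpace hN) :
    N (fun ω => ENNReal.ofReal ((ξ : Ω → ℝ) ω)) < ∞ :=
  lt_of_le_of_lt (hN.1.mono _ _ ξ.2.1.ennreal_ofReal.aemeasurable ξ.2.1.enorm.aemeasurable
    (Eventually.of_forall fun _ => Real.ofReal_le_enorm _)) ξ.2.2

/-- Hahn–Banach for the sublinear functional `ξ ↦ ‖ξ⁺‖`: it yields a positive functional of norm
at most one which norms a given nonnegative element. -/
theorem exists_positive_functional (hN : IsBanachFunctionSpace μ N) (u : realSpace hN)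
    (hu : ∀ ω, 0 ≤ (u : Ω → ℝ) ω) :
    ∃ g : realSpace hN →ₗ[ℝ] ℝ, (∀ ξ, g ξ ≤ posNorm hN ξ) ∧ g u = posNorm hN u := by
  have hsmul : ∀ c : ℝ, 0 ≤ c → ∀ x, posNorm hN (c • x) = c * posNorm hN x := by
    intro c hc x
    have : (fun ω => ENNReal.ofReal (((c • x : realSpace hN) : Ω → ℝ) ω)) =
        fun ω => ((c.toNNReal : ℝ≥0) : ℝ≥0∞) * ENNReal.ofReal ((x : Ω → ℝ) ω) := by
      funext ω
      simp [ENNReal.ofReal_mul hc]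
      rfl
    rw [posNorm, this, hN.1.smul _ _ x.2.1.ennreal_ofReal.aemeasurable, ENNReal.toReal_mul]
    simp [posNorm, hc]
  have hadd : ∀ x y, posNorm hN (x + y) ≤ posNorm hN x + posNorm hN y := by
    intro x y
    rw [posNorm, posNorm, posNorm,
      ← ENNReal.toReal_add (norm_ofReal_lt_top hN x).ne (norm_ofReal_lt_top hN y).ne]
    refine ENNReal.toReal_mono
      (ENNReal.add_lt_top.2 ⟨norm_ofReal_lt_top hN x, norm_ofReal_lt_top hN y⟩).ne ?_
    refine le_trans (hN.1.mono _ _ (x + y).2.1.ennreal_ofReal.aemeasurable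
      (x.2.1.ennreal_ofReal.add y.2.1.ennreal_ofReal).aemeasurable ?_)
      (hN.2 _ _ x.2.1.ennreal_ofReal.aemeasurable y.2.1.ennreal_ofReal.aemeasurable)
    exact Eventually.of_forall fun ω => ENNReal.ofReal_add_le
  by_cases hu0 : u = 0
  · refine ⟨0, fun ξ => ENNReal.toReal_nonneg, ?_⟩
    subst hu0
    simp [posNorm, hN.1.zero]
  · let f : realSpace hN →ₗ.[ℝ] ℝ := LinearPMap.mkSpanSingleton u (posNorm hN u) hu0
    have hf : ∀ x : f.domain, f x ≤ posNorm hN x := by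
      rintro ⟨x, hx⟩
      obtain ⟨c, rfl⟩ := Submodule.mem_span_singleton.1 hx
      have h1 : f ⟨c • u, hx⟩ = c * posNorm hN u :=
        LinearPMap.mkSpanSingleton'_apply _ _ _ _ _
      rw [h1]
      rcases le_total 0 c with hc | hc
      · exact (hsmul c hc u).ge
      · exact (mul_nonpos_of_nonpos_of_nonneg hc ENNReal.toReal_nonneg).trans
          ENNReal.toReal_nonneg
    obtain ⟨g, hg1, hg2⟩ := exists_extension_of_le_sublinear f (posNorm hN)
      (fun c hc x => hsmul c hc.le x) hadd hf
    exact ⟨g, hg2, (hg1 ⟨u, Submodule.mem_span_singleton_self u⟩).trans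
      (LinearPMap.mkSpanSingleton'_apply_self _ _ _ _)⟩

section Representation

variable (hN : IsBanachFunctionSpace μ N) (w : realSpace hN)

/-- The product of a nonnegative simple function with a fixed element of the space. -/
def simpleMul (s : SimpleFunc Ω ℝ≥0) : realSpace hN :=
  ⟨fun ω => (s ω : ℝ) * (w : Ω → ℝ) ω, by
    refine ⟨s.measurable.coe_nnreal_real.mul w.2.1, ?_⟩
    obtain ⟨c, hc⟩ : ∃ c : ℝ≥0, ∀ ω, s ω ≤ c := by
      obtain ⟨c, hc⟩ := s.range.bddAbove
      exact ⟨c, fun ω => hc (by simp)⟩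
    have h := hN.1.mono (fun ω => ‖(s ω : ℝ) * (w : Ω → ℝ) ω‖ₑ)
      (fun ω => (c : ℝ≥0∞) * ‖(w : Ω → ℝ) ω‖ₑ)
      (s.measurable.coe_nnreal_real.mul w.2.1).enorm.aemeasurable
      (w.2.1.enorm.const_mul _).aemeasurable (Eventually.of_forall fun ω => by
        rw [enorm_mul]
        gcongr
        simpa using hc ω)
    rw [hN.1.smul _ _ w.2.1.enorm.aemeasurable] at h
    exact h.trans_lt (ENNReal.mul_lt_top ENNReal.coe_lt_top w.2.2)⟩

theorem simpleMul_add (s t : SimpleFunc Ω ℝ≥0) :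
    simpleMul hN w (s + t) = simpleMul hN w s + simpleMul hN w t := by
  apply Subtype.ext
  funext ω
  simp [simpleMul, add_mul]

variable {hN w}

theorem functional_nonneg (g : realSpace hN →ₗ[ℝ] ℝ) (hg : ∀ ξ, g ξ ≤ posNorm hN ξ)
    (ξ : realSpace hN) (hξ : ∀ ω, 0 ≤ (ξ : Ω → ℝ) ω) : 0 ≤ g ξ := by
  have h := hg (-ξ)
  have : posNorm hN (-ξ) = 0 := by
    have : (fun ω => ENNReal.ofReal ((((-ξ : realSpace hN) : Ω → ℝ)) ω)) = fun _ => 0 := by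
      funext ω
      simpa using hξ ω
    rw [posNorm, this, hN.1.zero]
    simp
  rw [map_neg, this] at h
  linarith

/-- On an order-continuous space, a positive functional of norm at most one is continuous along
increasing sequences of nonnegative elements. -/
theorem tendsto_functional (g : realSpace hN →ₗ[ℝ] ℝ) (hg : ∀ ξ, g ξ ≤ posNorm hN ξ)
    (hO : IsOrderContinuous μ N) (ξ : realSpace hN) (η : ℕ → realSpace hN)
    (hmono : ∀ ω, Monotone fun n => (η n : Ω → ℝ) ω) (h0 : ∀ n ω, 0 ≤ (η n : Ω → ℝ) ω)
    (hlim : ∀ ω, Tendsto (fun n => (η n : Ω → ℝ) ω) atTop (𝓝 ((ξ : Ω → ℝ) ω))) :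
    Tendsto (fun n => g (η n)) atTop (𝓝 (g ξ)) := by
  have hle : ∀ n ω, (η n : Ω → ℝ) ω ≤ (ξ : Ω → ℝ) ω := fun n ω =>
    (hmono ω).ge_of_tendsto (hlim ω) n
  have h := hO (fun n ω => ENNReal.ofReal ((η n : Ω → ℝ) ω))
    (fun ω => ENNReal.ofReal ((ξ : Ω → ℝ) ω))
    (fun n => (η n).2.1.ennreal_ofReal.aemeasurable) ξ.2.1.ennreal_ofReal.aemeasurable
    (Eventually.of_forall fun ω => fun m n hmn => ENNReal.ofReal_le_ofReal (hmono ω hmn))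
    (Eventually.of_forall fun ω => ?_) (norm_ofReal_lt_top hN ξ)
  · have h1 : Tendsto (fun n => posNorm hN (ξ - η n)) atTop (𝓝 0) := by
      have h2 := (ENNReal.tendsto_toReal ENNReal.zero_ne_top).comp h
      simp only [ENNReal.toReal_zero] at h2
      refine h2.congr fun n => ?_
      simp only [Function.comp, posNorm]
      congr 2
      funext ω
      rw [← ENNReal.ofReal_sub _ (h0 n ω)]
      rfl
    have h3 : Tendsto (fun n => g (ξ - η n)) atTop (𝓝 0) :=
      squeeze_zero (fun n => functional_nonneg g hg _ fun ω => by
        simpa using hle n ω) (fun n => hg _) h1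
    have h4 : (fun n => g (η n)) = fun n => g ξ - g (ξ - η n) := by
      funext n
      rw [map_sub]
      ring
    rw [h4]
    simpa only [sub_zero] using (tendsto_const_nhds (x := g ξ)).sub h3
  · refine tendsto_nhds_unique (tendsto_atTop_iSup fun m n hmn =>
      ENNReal.ofReal_le_ofReal (hmono ω hmn)) ?_
    exact (ENNReal.continuous_ofReal.tendsto _).comp (hlim ω)

/-- Radon–Nikodym representation of a positive functional on multiples of `w` by simple functions:
countable additivity comes from order-continuity. -/
theorem exists_density [SigmaFinite μ] (g : realSpace hN →ₗ[ℝ] ℝ)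
    (hg : ∀ ξ, g ξ ≤ posNorm hN ξ) (hO : IsOrderContinuous μ N)
    (hw : ∀ ω, 0 < (w : Ω → ℝ) ω) :
    ∃ k : Ω → ℝ≥0∞, Measurable k ∧ (∀ᵐ ω ∂μ, k ω < ∞) ∧ ∀ s : SimpleFunc Ω ℝ≥0,
      ENNReal.ofReal (g (simpleMul hN w s)) = ∫⁻ ω, k ω * s ω ∂μ := by
  classical
  have hpos : ∀ s, 0 ≤ g (simpleMul hN w s) := fun s =>
    functional_nonneg g hg _ fun ω => mul_nonneg (s ω).2 (hw ω).le
  let ind : (A : Set Ω) → MeasurableSet A → SimpleFunc Ω ℝ≥0 := fun A hA =>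
    SimpleFunc.piecewise A hA (SimpleFunc.const Ω 1) (SimpleFunc.const Ω 0)
  have hind : ∀ A hA ω, ((ind A hA) ω : ℝ) = A.indicator (fun _ => 1) ω := by
    intro A hA ω
    by_cases h : ω ∈ A <;> simp [ind, h]
  have hempty : simpleMul hN w (ind ∅ MeasurableSet.empty) = 0 := by
    apply Subtype.ext
    funext ω
    simp [simpleMul, ind]
  have hfin : ∀ (A : ℕ → Set Ω) (hA : ∀ i, MeasurableSet (A i)),
      Pairwise (Function.onFun Disjoint A) → ∀ n ω,
      (((∑ i ∈ Finset.range n, simpleMul hN w (ind (A i) (hA i)) : realSpace hN)) : Ω → ℝ) ω =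
        (⋃ i ∈ Finset.range n, A i).indicator (fun _ => 1) ω * (w : Ω → ℝ) ω := by
    intro A hA hd n ω
    have : ((⋃ i ∈ Finset.range n, A i).indicator (fun _ => (1 : ℝ)) ω) =
        ∑ i ∈ Finset.range n, (A i).indicator (fun _ => (1 : ℝ)) ω := by
      rw [Finset.indicator_biUnion _ _ fun i _ j _ hij => hd hij]
    rw [this, Finset.sum_mul, Submodule.coe_sum, Finset.sum_apply]
    refine Finset.sum_congr rfl fun i _ => ?_
    rw [← hind (A i) (hA i)]
    rfl
  -- the measure `A ↦ g (1_A w)`, whose density is the one to be found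
  let ν : Measure Ω := Measure.ofMeasurable
    (fun A hA => ENNReal.ofReal (g (simpleMul hN w (ind A hA))))
    (by simp [hempty]) (by
      intro A hA hd
      have hU : MeasurableSet (⋃ i, A i) := MeasurableSet.iUnion hA
      have hlim := tendsto_functional g hg hO (simpleMul hN w (ind _ hU))
        (fun n => ∑ i ∈ Finset.range n, simpleMul hN w (ind (A i) (hA i))) ?_ ?_ ?_
      · have hsum : HasSum (fun i => g (simpleMul hN w (ind (A i) (hA i))))
            (g (simpleMul hN w (ind _ hU))) := by
          rw [hasSum_iff_tendsto_nat_of_nonneg fun i => hpos _]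
          simpa only [map_sum] using hlim
        rw [← ENNReal.ofReal_tsum_of_nonneg (fun i => hpos _) hsum.summable, hsum.tsum_eq]
      · intro ω m n hmn
        simp only [hfin A hA hd]
        refine mul_le_mul_of_nonneg_right ?_ (hw ω).le
        refine Set.indicator_le_indicator_of_subset ?_ (fun _ => zero_le_one) ω
        exact Set.biUnion_subset_biUnion_left fun i hi =>
          Finset.mem_coe.2 (Finset.range_mono hmn hi)
      · intro n ω
        rw [hfin A hA hd]
        exact mul_nonneg (Set.indicator_nonneg (fun _ _ => zero_le_one) _) (hw ω).le
      · intro ω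
        simp only [hfin A hA hd]
        have : ((simpleMul hN w (ind _ hU) : realSpace hN) : Ω → ℝ) ω =
            (⋃ i, A i).indicator (fun _ => 1) ω * (w : Ω → ℝ) ω := by
          rw [← hind _ hU]
          rfl
        rw [this]
        exact Tendsto.mul_const _ (((tendsto_indicator_biUnion_finset A _ ω).mono_right
          (pure_le_nhds _)).comp tendsto_finset_range))
  have hνapp : ∀ A (hA : MeasurableSet A),
      ν A = ENNReal.ofReal (g (simpleMul hN w (ind A hA))) := fun A hA =>
    Measure.ofMeasurable_apply A hA
  have hac : ν ≪ μ := by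
    refine Measure.AbsolutelyContinuous.mk fun A hA hA0 => ?_
    rw [hνapp A hA, ENNReal.ofReal_eq_zero]
    refine (hg _).trans (le_of_eq ?_)
    rw [posNorm, (hN.1.eq_zero_iff _ (simpleMul hN w
      (ind A hA)).2.1.ennreal_ofReal.aemeasurable).2 ?_]
    · simp
    · have : ∀ᵐ ω ∂μ, ω ∉ A := measure_eq_zero_iff_ae_notMem.1 hA0
      filter_upwards [this] with ω hω
      have : ((simpleMul hN w (ind A hA) : realSpace hN) : Ω → ℝ) ω = 0 := by
        simp [simpleMul, ind, hω]
      simp [this]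
  have : IsFiniteMeasure ν := ⟨by rw [hνapp _ MeasurableSet.univ]; exact ENNReal.ofReal_lt_top⟩
  refine ⟨ν.rnDeriv μ, Measure.measurable_rnDeriv _ _, Measure.rnDeriv_lt_top _ _, fun s => ?_⟩
  rw [lintegral_rnDeriv_mul hac s.measurable.coe_nnreal_ennreal.aemeasurable]
  induction s using SimpleFunc.induction with
  | const c hA =>
    rename_i A
    have h1 : simpleMul hN w (SimpleFunc.piecewise A hA (SimpleFunc.const Ω c)
        (SimpleFunc.const Ω 0)) = (c : ℝ) • simpleMul hN w (ind A hA) := by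
      apply Subtype.ext
      funext ω
      by_cases h : ω ∈ A <;> simp [simpleMul, ind, h]
    have h2 : ∀ ω, (((SimpleFunc.piecewise A hA (SimpleFunc.const Ω c)
        (SimpleFunc.const Ω 0)) ω : ℝ≥0) : ℝ≥0∞) = A.indicator (fun _ => (c : ℝ≥0∞)) ω := by
      intro ω
      by_cases h : ω ∈ A <;> simp [h]
    simp only [h2]
    rw [h1, map_smul, smul_eq_mul, ENNReal.ofReal_mul c.coe_nonneg, ← hνapp A hA,
      lintegral_indicator_const hA]
    simp
  | add _ h1 h2 =>
    rename_i f₁ f₂ _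
    rw [simpleMul_add, map_add, ENNReal.ofReal_add (hpos _) (hpos _), h1, h2,
      ← lintegral_add_left f₁.measurable.coe_nnreal_ennreal]
    simp

end Representation

/-- Every element of an order-continuous Banach function space is normed by a function in the unit
ball of its dual: if `k` is the density on multiples of a weak order unit `w` of a functional that
norms `u`, then `k / w` norms `u`. -/
theorem exists_norming [SigmaFinite μ] (hN : IsBanachFunctionSpace μ N)
    (hO : IsOrderContinuous μ N) {u : Ω → ℝ≥0∞} (hu : AEMeasurable u μ) (hfin : N u < ∞) :
    ∃ v : Ω → ℝ≥0, Measurable v ∧ dualNorm μ N (fun ω => v ω) ≤ 1 ∧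
      N u ≤ ∫⁻ ω, u ω * v ω ∂μ := by
  classical
  -- finite representatives of `u` and of the weak order unit
  have hu' : (fun ω => ‖(hu.mk u ω).toReal‖ₑ) =ᵐ[μ] u := by
    filter_upwards [hN.1.ae_lt_top hu hfin, hu.ae_eq_mk] with ω h1 h2
    rw [← h2, Real.enorm_of_nonneg ENNReal.toReal_nonneg, ENNReal.ofReal_toReal h1.ne]
  let ξ : realSpace hN := ⟨fun ω => (hu.mk u ω).toReal, hu.measurable_mk.ennreal_toReal, by
    rwa [← hN.1.congr hu hu'.symm]⟩
  have hξ0 : ∀ ω, 0 ≤ (ξ : Ω → ℝ) ω := fun ω => ENNReal.toReal_nonneg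
  have hξu : (fun ω => ENNReal.ofReal ((ξ : Ω → ℝ) ω)) =ᵐ[μ] u := by
    filter_upwards [hu'] with ω hω
    rw [← hω, Real.enorm_of_nonneg ENNReal.toReal_nonneg]
  obtain ⟨w₀, hw₀, hw₀pos, hw₀fin⟩ := hN.1.weak_order_unit
  let wr : Ω → ℝ := fun ω => if 0 < (hw₀.mk w₀ ω).toReal then (hw₀.mk w₀ ω).toReal else 1
  have hwr : Measurable wr :=
    Measurable.ite (measurableSet_lt measurable_const hw₀.measurable_mk.ennreal_toReal)
      hw₀.measurable_mk.ennreal_toReal measurable_const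
  have hwr0 : ∀ ω, 0 < wr ω := by
    intro ω
    by_cases h : 0 < (hw₀.mk w₀ ω).toReal <;> simp [wr, h]
  have hwr_eq : (fun ω => ‖wr ω‖ₑ) =ᵐ[μ] w₀ := by
    filter_upwards [hN.1.ae_lt_top hw₀ hw₀fin, hw₀.ae_eq_mk, hw₀pos] with ω h1 h2 h3
    have h4 : 0 < (hw₀.mk w₀ ω).toReal := by
      rw [← h2]
      exact ENNReal.toReal_pos h3.ne' h1.ne
    simp only [wr, if_pos h4]
    rw [← h2, Real.enorm_of_nonneg ENNReal.toReal_nonneg, ENNReal.ofReal_toReal h1.ne]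
  let w : realSpace hN := ⟨wr, hwr, by rwa [← hN.1.congr hw₀ hwr_eq.symm]⟩
  obtain ⟨g, hg, hgξ⟩ := exists_positive_functional hN ξ hξ0
  obtain ⟨k, hk, hkfin, hkg⟩ := exists_density (w := w) g hg hO hwr0
  set W : Ω → ℝ≥0∞ := fun ω => ENNReal.ofReal (wr ω) with hW
  have hWm : Measurable W := hwr.ennreal_ofReal
  have hW0 : ∀ ω, W ω ≠ 0 := fun ω => by simpa [hW] using hwr0 ω
  have hWt : ∀ ω, W ω ≠ ∞ := fun ω => ENNReal.ofReal_ne_top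
  -- simple approximations of `a / w`
  let sn : (Ω → ℝ≥0∞) → ℕ → SimpleFunc Ω ℝ≥0 := fun a n =>
    (SimpleFunc.eapprox (fun ω => a ω / W ω) n).map ENNReal.toNNReal
  have hsn : ∀ a n ω, ((sn a n ω : ℝ≥0) : ℝ≥0∞) =
      SimpleFunc.eapprox (fun ω => a ω / W ω) n ω := fun a n ω =>
    ENNReal.coe_toNNReal (SimpleFunc.eapprox_lt_top _ _ _).ne
  have hmono : ∀ a ω, Monotone fun n => ((sn a n ω : ℝ≥0) : ℝ≥0∞) := by
    intro a ω m n hmn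
    simp only [hsn]
    exact SimpleFunc.monotone_eapprox _ hmn ω
  have hsup : ∀ a, Measurable a → ∀ ω, ⨆ n, ((sn a n ω : ℝ≥0) : ℝ≥0∞) = a ω / W ω := by
    intro a ha ω
    simp only [hsn]
    exact SimpleFunc.iSup_eapprox_apply (ha.div hWm) ω
  let v : Ω → ℝ≥0 := fun ω => (k ω / W ω).toNNReal
  have hv : ∀ a, Measurable a → ∫⁻ ω, a ω * v ω ∂μ =
      ⨆ n, ENNReal.ofReal (g (simpleMul hN w (sn a n))) := by
    intro a ha
    have h1 : ∫⁻ ω, a ω * v ω ∂μ = ∫⁻ ω, ⨆ n, k ω * sn a n ω ∂μ := by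
      refine lintegral_congr_ae ?_
      filter_upwards [hkfin] with ω hω
      have : ((v ω : ℝ≥0) : ℝ≥0∞) = k ω / W ω :=
        ENNReal.coe_toNNReal (ENNReal.div_lt_top hω.ne (hW0 ω)).ne
      rw [← ENNReal.mul_iSup, hsup a ha, this, div_eq_mul_inv, div_eq_mul_inv]
      ring
    rw [h1, lintegral_iSup (f := fun n ω => k ω * (sn a n ω : ℝ≥0∞))
      (fun n => hk.mul (sn a n).measurable.coe_nnreal_ennreal)
      fun m n hmn ω => mul_le_mul_right (hmono a ω hmn) _]
    simp only [hkg]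
  have hcoe : ∀ a n ω, ENNReal.ofReal ((simpleMul hN w (sn a n) : Ω → ℝ) ω) =
      (sn a n ω : ℝ≥0∞) * W ω := by
    intro a n ω
    change ENNReal.ofReal ((sn a n ω : ℝ) * wr ω) = _
    rw [ENNReal.ofReal_mul (sn a n ω).coe_nonneg, ENNReal.ofReal_coe_nnreal]
  refine ⟨v, (hk.div hWm).ennreal_toNNReal, iSup₂_le fun a ha => ?_, ?_⟩
  · have h1 : ∫⁻ ω, (v ω : ℝ≥0∞) * a ω ∂μ = ∫⁻ ω, ha.1.mk a ω * v ω ∂μ := by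
      refine lintegral_congr_ae ?_
      filter_upwards [ha.1.ae_eq_mk] with ω hω
      rw [hω, mul_comm]
    rw [h1, hv _ ha.1.measurable_mk]
    refine iSup_le fun n => ?_
    have h2 : N (fun ω => ENNReal.ofReal ((simpleMul hN w (sn (ha.1.mk a) n) : Ω → ℝ) ω)) ≤ 1 := by
      refine (hN.1.mono _ _ (simpleMul hN w _).2.1.ennreal_ofReal.aemeasurable ha.1 ?_).trans ha.2
      filter_upwards [ha.1.ae_eq_mk] with ω hω
      rw [hcoe, hω]
      calc (sn (ha.1.mk a) n ω : ℝ≥0∞) * W ω ≤ (ha.1.mk a ω / W ω) * W ω := by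
            gcongr
            rw [← hsup _ ha.1.measurable_mk ω]
            exact le_iSup (fun n => ((sn (ha.1.mk a) n ω : ℝ≥0) : ℝ≥0∞)) n
        _ = ha.1.mk a ω := ENNReal.div_mul_cancel (hW0 ω) (hWt ω)
    have h3 := hg (simpleMul hN w (sn (ha.1.mk a) n))
    rw [posNorm] at h3
    calc ENNReal.ofReal (g _) ≤ ENNReal.ofReal 1 :=
          ENNReal.ofReal_le_ofReal (h3.trans (ENNReal.toReal_mono ENNReal.one_ne_top h2))
      _ = 1 := ENNReal.ofReal_one
  · set a : Ω → ℝ≥0∞ := fun ω => ENNReal.ofReal ((ξ : Ω → ℝ) ω) with ha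
    have ham : Measurable a := ξ.2.1.ennreal_ofReal
    have hNu : N u = ENNReal.ofReal (g ξ) := by
      rw [hgξ, posNorm, ENNReal.ofReal_toReal (norm_ofReal_lt_top hN ξ).ne]
      exact hN.1.congr hu hξu.symm
    have h1 : ∫⁻ ω, u ω * v ω ∂μ = ∫⁻ ω, a ω * v ω ∂μ := by
      refine lintegral_congr_ae ?_
      filter_upwards [hξu] with ω hω
      rw [← hω]
    have hreal : ∀ n ω, (simpleMul hN w (sn a n) : Ω → ℝ) ω =
        ((sn a n ω : ℝ≥0∞) * W ω).toReal := by
      intro n ω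
      rw [← hcoe]
      exact (ENNReal.toReal_ofReal (mul_nonneg (sn a n ω).coe_nonneg (hwr0 ω).le)).symm
    have hlim := tendsto_functional g hg hO ξ (fun n => simpleMul hN w (sn a n)) ?_
      (fun n ω => mul_nonneg (sn a n ω).coe_nonneg (hwr0 ω).le) ?_
    · rw [hNu, h1, hv a ham]
      exact le_of_tendsto' ((ENNReal.continuous_ofReal.tendsto _).comp hlim) fun n =>
        le_iSup (fun n => ENNReal.ofReal (g (simpleMul hN w (sn a n)))) n
    · intro ω m n hmn
      exact mul_le_mul_of_nonneg_right
        (NNReal.coe_le_coe.2 (ENNReal.coe_le_coe.1 (hmono a ω hmn))) (hwr0 ω).le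
    · intro ω
      simp only [hreal]
      have h2 : Tendsto (fun n => (sn a n ω : ℝ≥0∞) * W ω) atTop (𝓝 (a ω)) := by
        have := ENNReal.Tendsto.mul_const (b := W ω) (tendsto_atTop_iSup (hmono a ω))
          (Or.inr (hWt ω))
        rwa [hsup a ham ω, ENNReal.div_mul_cancel (hW0 ω) (hWt ω)] at this
      have h3 := (ENNReal.tendsto_toReal ENNReal.ofReal_ne_top).comp h2
      rwa [ENNReal.toReal_ofReal (hξ0 ω)] at h3

end Duality

/-! ### Cubes and dyadic grids -/

section Cubes

variable {d : ℕ}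

theorem Cube.volume_toSet (Q : Cube d) : volume Q.toSet = ENNReal.ofReal Q.side ^ d := by
  rw [Cube.toSet, Real.volume_pi_Ico]
  simp

theorem Cube.volume_ne_zero (Q : Cube d) : volume Q.toSet ≠ 0 := by
  rw [Q.volume_toSet]
  exact pow_ne_zero _ (by simpa using Q.side_pos)

theorem Cube.volume_ne_top (Q : Cube d) : volume Q.toSet ≠ ∞ := by
  rw [Q.volume_toSet]
  exact ENNReal.pow_ne_top ENNReal.ofReal_ne_top

theorem Cube.measurableSet (Q : Cube d) : MeasurableSet Q.toSet :=
  MeasurableSet.univ_pi fun _ => measurableSet_Ico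

/-- The linear average of `u ≥ 0` over a cube. -/
def mean (u : (Fin d → ℝ) → ℝ≥0∞) (Q : Cube d) : ℝ≥0∞ :=
  (volume Q.toSet)⁻¹ * ∫⁻ x in Q.toSet, u x

theorem cubeAverage_eq_mean (r : ℝ) (u : (Fin d → ℝ) → ℝ≥0∞) (Q : Cube d) :
    cubeAverage r u Q = mean (fun x => u x ^ r) Q ^ (1 / r) := rfl

theorem volume_mul_mean (u : (Fin d → ℝ) → ℝ≥0∞) (Q : Cube d) :
    volume Q.toSet * mean u Q = ∫⁻ x in Q.toSet, u x := by
  rw [mean, ← mul_assoc, ENNReal.mul_inv_cancel Q.volume_ne_zero Q.volume_ne_top, one_mul]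

theorem setLIntegral_const_mean (u : (Fin d → ℝ) → ℝ≥0∞) (Q : Cube d) :
    ∫⁻ _ in Q.toSet, mean u Q = ∫⁻ x in Q.toSet, u x := by
  rw [setLIntegral_const, mul_comm, volume_mul_mean]

theorem mean_le_of_subset (u : (Fin d → ℝ) → ℝ≥0∞) {Q Q' : Cube d} (h : Q.toSet ⊆ Q'.toSet)
    {c : ℝ≥0∞} (hc : volume Q'.toSet ≤ c * volume Q.toSet) : mean u Q ≤ c * mean u Q' := by
  have h1 : (volume Q.toSet)⁻¹ ≤ c * (volume Q'.toSet)⁻¹ := by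
    rw [← div_eq_mul_inv, ENNReal.le_div_iff_mul_le (Or.inl Q'.volume_ne_zero)
      (Or.inl Q'.volume_ne_top), mul_comm, ← div_eq_mul_inv]
    exact ENNReal.div_le_of_le_mul hc
  calc mean u Q ≤ (c * (volume Q'.toSet)⁻¹) * ∫⁻ x in Q'.toSet, u x :=
        mul_le_mul' h1 (lintegral_mono_set h)
    _ = c * mean u Q' := by rw [mean, mul_assoc]

theorem cubeAverage_le_of_subset {r : ℝ} (hr : 0 < r) (u : (Fin d → ℝ) → ℝ≥0∞) {Q Q' : Cube d}
    (h : Q.toSet ⊆ Q'.toSet) {c : ℝ≥0∞} (hc : volume Q'.toSet ≤ c * volume Q.toSet) :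
    cubeAverage r u Q ≤ c ^ (1 / r) * cubeAverage r u Q' := by
  rw [cubeAverage_eq_mean, cubeAverage_eq_mean, ← ENNReal.mul_rpow_of_nonneg _ _ (by positivity)]
  exact ENNReal.rpow_le_rpow (mean_le_of_subset _ h hc) (by positivity)

end Cubes

/-- A translated dyadic grid with a coarsest scale: the cubes of level `k` have side
`side / 2 ^ k`. -/
structure DyadicGrid (d : ℕ) where
  origin : Fin d → ℝ
  side : ℝ
  side_pos : 0 < side

namespace DyadicGrid

variable {d : ℕ} (G : DyadicGrid d)

/-- The side length at level `k`. -/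
def scale (k : ℕ) : ℝ := G.side / 2 ^ k

theorem scale_pos (k : ℕ) : 0 < G.scale k := div_pos G.side_pos (by positivity)

/-- The index of the level `k` cube containing `x`. -/
def index (k : ℕ) (x : Fin d → ℝ) : Fin d → ℤ := fun i => ⌊(x i - G.origin i) / G.scale k⌋

/-- The level `k` cube with index `a`. -/
def cube (k : ℕ) (a : Fin d → ℤ) : Cube d where
  corner i := G.origin i + G.scale k * a i
  side := G.scale k
  side_pos := G.scale_pos k

/-- The level `k` cube containing `x`. -/
def cubeAt (k : ℕ) (x : Fin d → ℝ) : Cube d := G.cube k (G.index k x)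

theorem mem_cube {k : ℕ} {a : Fin d → ℤ} {x : Fin d → ℝ} :
    x ∈ (G.cube k a).toSet ↔ G.index k x = a := by
  have hs := G.scale_pos k
  simp only [Cube.toSet, Set.mem_univ_pi, cube, Set.mem_Ico, funext_iff, index, Int.floor_eq_iff]
  refine forall_congr' fun i => ?_
  rw [le_div_iff₀ hs, div_lt_iff₀ hs]
  constructor <;> rintro ⟨h1, h2⟩ <;> constructor <;> linarith

theorem mem_cubeAt {k : ℕ} {x y : Fin d → ℝ} :
    y ∈ (G.cubeAt k x).toSet ↔ G.index k y = G.index k x := G.mem_cube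

theorem self_mem_cubeAt (k : ℕ) (x : Fin d → ℝ) : x ∈ (G.cubeAt k x).toSet :=
  G.mem_cubeAt.2 rfl

theorem index_eq_of_le {j k : ℕ} (hjk : j ≤ k) {x y : Fin d → ℝ}
    (h : G.index k x = G.index k y) : G.index j x = G.index j y := by
  have key : ∀ z i, G.index j z i = G.index k z i / ((2 ^ (k - j) : ℕ) : ℤ) := by
    intro z i
    rw [index, index, ← Int.floor_div_natCast]
    congr 1
    have h2 : (2 : ℝ) ^ k = 2 ^ j * 2 ^ (k - j) := by rw [← pow_add, Nat.add_sub_cancel' hjk]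
    rw [scale, scale, h2]
    push_cast
    field_simp
  funext i
  rw [key, key, h]

theorem measurable_index (k : ℕ) : Measurable (G.index k) :=
  measurable_pi_lambda _ fun i =>
    Int.measurable_floor.comp (((measurable_pi_apply i).sub_const _).div_const _)

theorem cubeAt_eq {k : ℕ} {x y : Fin d → ℝ} (h : G.index k x = G.index k y) :
    G.cubeAt k x = G.cubeAt k y := by rw [cubeAt, cubeAt, h]

theorem cubeAt_subset {j k : ℕ} (hjk : j ≤ k) (x : Fin d → ℝ) :
    (G.cubeAt k x).toSet ⊆ (G.cubeAt j x).toSet := fun _ hy =>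
  G.mem_cubeAt.2 (G.index_eq_of_le hjk (G.mem_cubeAt.1 hy))

theorem volume_cubeAt_le (k : ℕ) (x : Fin d → ℝ) :
    volume (G.cubeAt k x).toSet ≤ 2 ^ d * volume (G.cubeAt (k + 1) x).toSet := by
  rw [Cube.volume_toSet, Cube.volume_toSet, ← mul_pow]
  refine pow_le_pow_left' (le_of_eq ?_) _
  change ENNReal.ofReal (G.scale k) = 2 * ENNReal.ofReal (G.scale (k + 1))
  rw [show (2 : ℝ≥0∞) = ENNReal.ofReal 2 by simp, ← ENNReal.ofReal_mul (by norm_num)]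
  congr 1
  rw [scale, scale, pow_succ]
  field_simp

/-- A set is saturated at level `k` if it is a union of level `k` cubes. -/
def Saturated (k : ℕ) (S : Set (Fin d → ℝ)) : Prop :=
  ∀ x y, G.index k x = G.index k y → x ∈ S → y ∈ S

variable {G}

theorem Saturated.mono {j k : ℕ} (hjk : j ≤ k) {S : Set (Fin d → ℝ)} (hS : G.Saturated j S) :
    G.Saturated k S := fun x y h hx => hS x y (G.index_eq_of_le hjk h) hx

variable (G) in
/-- Functions that are constant on the cubes of one level are measurable. -/
theorem measurable_of_index {β : Type*} [MeasurableSpace β] {k : ℕ} {f : (Fin d → ℝ) → β}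
    (hf : ∀ x y, G.index k x = G.index k y → f x = f y) : Measurable f := by
  intro s _
  have : f ⁻¹' s = G.index k ⁻¹' (G.index k '' (f ⁻¹' s)) := by
    refine Set.Subset.antisymm (Set.subset_preimage_image _ _) ?_
    rintro x ⟨y, hy, hxy⟩
    rw [Set.mem_preimage, ← hf y x hxy]
    exact hy
  rw [this]
  exact G.measurable_index k (Set.to_countable _).measurableSet

theorem Saturated.measurableSet {k : ℕ} {S : Set (Fin d → ℝ)} (hS : G.Saturated k S) :
    MeasurableSet S := by
  have : Measurable fun x => x ∈ S := G.measurable_of_index (k := k) fun x y h =>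
    propext ⟨hS x y h, hS y x h.symm⟩
  exact measurableSet_setOfPred.2 this

theorem saturated_cubeAt (k : ℕ) (x : Fin d → ℝ) : G.Saturated k (G.cubeAt k x).toSet :=
  fun _ _ h hy => G.mem_cubeAt.2 (h.symm.trans (G.mem_cubeAt.1 hy))

/-- An inequality between integrals over all cubes of one level extends to saturated sets. -/
theorem Saturated.setLIntegral_mono {k : ℕ} {S : Set (Fin d → ℝ)} (hS : G.Saturated k S)
    {f g : (Fin d → ℝ) → ℝ≥0∞}
    (h : ∀ x ∈ S, ∫⁻ y in (G.cubeAt k x).toSet, f y ≤ ∫⁻ y in (G.cubeAt k x).toSet, g y) :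
    ∫⁻ y in S, f y ≤ ∫⁻ y in S, g y := by
  have hdec : S = ⋃ a : Fin d → ℤ, S ∩ G.index k ⁻¹' {a} := by
    ext x
    simp
  have hmeas : ∀ a : Fin d → ℤ, MeasurableSet (S ∩ G.index k ⁻¹' {a}) := fun a =>
    hS.measurableSet.inter (G.measurable_index k (measurableSet_singleton a))
  have hdisj : Pairwise (Function.onFun Disjoint fun a : Fin d → ℤ => S ∩ G.index k ⁻¹' {a}) := by
    intro a b hab
    refine Set.disjoint_left.2 ?_
    rintro x ⟨_, h1⟩ ⟨_, h2⟩
    exact hab (h1.symm.trans h2)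
  rw [hdec, lintegral_iUnion hmeas hdisj, lintegral_iUnion hmeas hdisj]
  refine ENNReal.tsum_le_tsum fun a => ?_
  by_cases hne : (S ∩ G.index k ⁻¹' {a}).Nonempty
  · obtain ⟨x, hxS, hxa⟩ := hne
    have : S ∩ G.index k ⁻¹' {a} = (G.cubeAt k x).toSet := by
      ext y
      rw [G.mem_cubeAt, Set.mem_inter_iff, Set.mem_preimage, Set.mem_singleton_iff,
        show G.index k x = a from hxa]
      exact ⟨fun h => h.2, fun h => ⟨hS x y (hxa.trans h.symm) hxS, h⟩⟩
    rw [this]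
    exact h x hxS
  · rw [Set.not_nonempty_iff_eq_empty.1 hne]
    simp

theorem setLIntegral_cubeAt_mean (k : ℕ) (u : (Fin d → ℝ) → ℝ≥0∞) (x : Fin d → ℝ) :
    ∫⁻ y in (G.cubeAt k x).toSet, mean u (G.cubeAt k y) =
      ∫⁻ y in (G.cubeAt k x).toSet, u y := by
  refine Eq.trans ?_ (setLIntegral_const_mean u (G.cubeAt k x))
  refine setLIntegral_congr_fun (G.cubeAt k x).measurableSet fun y hy => ?_
  simp only [G.cubeAt_eq (G.mem_cubeAt.1 hy)]

/-- Averaging over the cubes of one level preserves integrals over saturated sets. -/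
theorem Saturated.setLIntegral_mean {k : ℕ} {S : Set (Fin d → ℝ)} (hS : G.Saturated k S)
    (u : (Fin d → ℝ) → ℝ≥0∞) :
    ∫⁻ y in S, mean u (G.cubeAt k y) = ∫⁻ y in S, u y :=
  le_antisymm (hS.setLIntegral_mono fun x _ => (setLIntegral_cubeAt_mean k u x).le)
    (hS.setLIntegral_mono fun x _ => (setLIntegral_cubeAt_mean k u x).ge)

/-! ### Stopping levels -/

/-- Points of `S` at which the level-dependent condition `c` holds for the first time at
level `k`. -/
def firstAt (c : ℕ → (Fin d → ℝ) → Prop) (S : Set (Fin d → ℝ)) (k : ℕ) : Set (Fin d → ℝ) :=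
  {y | y ∈ S ∧ c k y ∧ ∀ i < k, ¬ c i y}

variable (G) in
/-- A level-dependent condition is adapted if at level `k` it only depends on the cube of
level `k`. -/
def Adapted (c : ℕ → (Fin d → ℝ) → Prop) : Prop :=
  ∀ k x y, G.index k x = G.index k y → c k x → c k y

theorem Adapted.saturated_firstAt {c : ℕ → (Fin d → ℝ) → Prop} (hc : G.Adapted c) {ℓ k : ℕ}
    (hℓ : ℓ ≤ k) {S : Set (Fin d → ℝ)} (hS : G.Saturated ℓ S) : G.Saturated k (firstAt c S k) := by
  rintro x y h ⟨h1, h2, h3⟩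
  exact ⟨hS.mono hℓ x y h h1, hc k x y h h2, fun i hi h4 =>
    h3 i hi (hc i y x (G.index_eq_of_le hi.le h).symm h4)⟩

theorem firstAt_disjoint (c : ℕ → (Fin d → ℝ) → Prop) (S : Set (Fin d → ℝ)) :
    Pairwise (Function.onFun Disjoint (firstAt c S)) := by
  intro i j hij
  refine Set.disjoint_left.2 ?_
  rintro x ⟨_, h1, h2⟩ ⟨_, h3, h4⟩
  rcases lt_or_gt_of_ne hij with h | h
  · exact h4 i h h1
  · exact h2 j h h3

theorem exists_firstAt {c : ℕ → (Fin d → ℝ) → Prop} {S : Set (Fin d → ℝ)} {y : Fin d → ℝ}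
    (hy : y ∈ S) {k : ℕ} (hk : c k y) : ∃ i ≤ k, y ∈ firstAt c S i := by
  classical
  have hex : ∃ k, c k y := ⟨k, hk⟩
  exact ⟨Nat.find hex, Nat.find_min' hex hk, hy, Nat.find_spec hex, fun i hi =>
    Nat.find_min hex hi⟩

/-- Replacing a function by its averages over the cubes of a variable level `σ` preserves its
integral over `S`, if the part of `S` on which `σ = k` is a union of cubes of level `k`. -/
theorem setLIntegral_mean_stop {σ : (Fin d → ℝ) → ℕ} {S : Set (Fin d → ℝ)}
    (hS : ∀ k, G.Saturated k (S ∩ {y | σ y = k})) (u : (Fin d → ℝ) → ℝ≥0∞) :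
    ∫⁻ y in S, mean u (G.cubeAt (σ y) y) = ∫⁻ y in S, u y := by
  have hdec : S = ⋃ k : ℕ, S ∩ {y | σ y = k} := by
    ext x
    simp
  have hdisj : Pairwise (Function.onFun Disjoint fun k : ℕ => S ∩ {y | σ y = k}) := by
    intro a b hab
    refine Set.disjoint_left.2 ?_
    rintro x ⟨_, h1⟩ ⟨_, h2⟩
    exact hab (h1.symm.trans h2)
  rw [hdec, lintegral_iUnion (fun k => (hS k).measurableSet) hdisj,
    lintegral_iUnion (fun k => (hS k).measurableSet) hdisj]
  refine tsum_congr fun k => ?_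
  rw [← (hS k).setLIntegral_mean u]
  refine setLIntegral_congr_fun (hS k).measurableSet fun y hy => ?_
  have : σ y = k := hy.2
  simp only [this]

/-- The weak `(1, 1)` inequality for the dyadic maximal operator inside one cube, at a multiple `Λ`
of the average over that cube. -/
theorem volume_mean_gt_le (u : (Fin d → ℝ) → ℝ≥0∞) (ℓ N : ℕ) (x : Fin d → ℝ) {Λ : ℝ≥0∞}
    (hΛ : Λ ≠ 0) (hΛ' : Λ ≠ ∞) (hfin : mean u (G.cubeAt ℓ x) ≠ ∞) :
    volume {y | y ∈ (G.cubeAt ℓ x).toSet ∧ ∃ k, ℓ ≤ k ∧ k ≤ N ∧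
      Λ * mean u (G.cubeAt ℓ x) < mean u (G.cubeAt k y)} ≤
      Λ⁻¹ * volume (G.cubeAt ℓ x).toSet := by
  set E := (G.cubeAt ℓ x).toSet with hE
  set b := mean u (G.cubeAt ℓ x) with hb
  set c : ℕ → (Fin d → ℝ) → Prop := fun k y => ℓ ≤ k ∧ k ≤ N ∧ Λ * b < mean u (G.cubeAt k y)
    with hc
  have hcad : G.Adapted c := by
    rintro k y z h ⟨h1, h2, h3⟩
    exact ⟨h1, h2, by rwa [← G.cubeAt_eq h]⟩
  have hsat : ∀ k, G.Saturated k (firstAt c E k) := by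
    intro k
    by_cases hk : ℓ ≤ k
    · exact hcad.saturated_firstAt hk (saturated_cubeAt ℓ x)
    · rintro y z _ ⟨_, h, _⟩
      exact absurd h.1 hk
  have hset : {y | y ∈ E ∧ ∃ k, c k y} = ⋃ k, firstAt c E k := by
    ext y
    simp only [Set.mem_ofPred_eq, Set.mem_iUnion]
    constructor
    · rintro ⟨h1, k, h2⟩
      obtain ⟨i, _, hi⟩ := exists_firstAt h1 h2
      exact ⟨i, hi⟩
    · rintro ⟨k, h1, h2, _⟩
      exact ⟨h1, k, h2⟩
  change volume {y | y ∈ E ∧ ∃ k, c k y} ≤ _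
  rw [hset]
  have hmain : Λ * b * volume (⋃ k, firstAt c E k) ≤ b * volume E := by
    have h1 : ∫⁻ y in ⋃ k, firstAt c E k, u y ≤ b * volume E := by
      rw [mul_comm, volume_mul_mean]
      refine lintegral_mono_set ?_
      rw [← hset]
      exact fun y hy => hy.1
    refine le_trans ?_ h1
    rw [measure_iUnion (firstAt_disjoint c E) fun k => (hsat k).measurableSet,
      lintegral_iUnion (fun k => (hsat k).measurableSet) (firstAt_disjoint c E),
      ← ENNReal.tsum_mul_left]
    refine ENNReal.tsum_le_tsum fun k => ?_
    rw [← (hsat k).setLIntegral_mean u, ← setLIntegral_const]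
    exact setLIntegral_mono' (hsat k).measurableSet fun y hy => hy.2.1.2.2.le
  rcases eq_or_ne b 0 with hb0 | hb0
  · have hu0 : ∫⁻ y in E, u y = 0 := by rw [hE, ← volume_mul_mean, ← hb, hb0, mul_zero]
    have hemp : ⋃ k, firstAt c E k = ∅ := by
      rw [← hset]
      refine Set.eq_empty_iff_forall_notMem.2 ?_
      rintro y ⟨hy, k, h1, _, h3⟩
      have h4 : ∫⁻ z in (G.cubeAt k y).toSet, u z = 0 := by
        refine le_antisymm ((lintegral_mono_set ?_).trans hu0.le) zero_le
        rw [hE, ← G.cubeAt_eq (G.mem_cubeAt.1 hy)]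
        exact G.cubeAt_subset h1 y
      rw [mean, h4, mul_zero] at h3
      exact absurd h3 not_lt_zero
    rw [hemp]
    simp
  · rw [mul_comm Λ b, mul_assoc, ENNReal.mul_le_mul_iff_right hb0 hfin] at hmain
    rw [mul_comm, ← div_eq_mul_inv, ENNReal.le_div_iff_mul_le (Or.inl hΛ) (Or.inl hΛ'), mul_comm]
    exact hmain

end DyadicGrid

/-! ### Averages of lattice-valued simple functions -/

section Averages

variable {Ω : Type*} {d n : ℕ}

/-- `y ↦ ‖w(y, ·)‖` for a nonnegative lattice-valued simple function `w`. -/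
def normFun (ρ : FunctionNorm Ω) (w : SimpleFunc (Fin d → ℝ) (Ω → ℝ≥0)) (y : Fin d → ℝ) : ℝ≥0∞ :=
  ρ fun ω => (w y ω : ℝ≥0∞)

/-- The average over a cube, taken pointwise on `Ω`. -/
def latticeAverage (r : ℝ) (w : SimpleFunc (Fin d → ℝ) (Ω → ℝ≥0)) (Q : Cube d) (ω : Ω) : ℝ≥0∞ :=
  cubeAverage r (fun y => (w y ω : ℝ≥0∞)) Q

/-- The averages of a simple function are finite linear combinations of its values, with
coefficients that only depend on the level sets. -/
theorem exists_mean_eq_sum {β : Type*} (w : SimpleFunc (Fin d → ℝ) β) (Q : Cube d) :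
    ∃ κ : β → ℝ≥0, ∀ φ : β → ℝ≥0∞,
      mean (fun y => φ (w y)) Q = ∑ v ∈ w.range, (κ v : ℝ≥0∞) * φ v := by
  refine ⟨fun v => ((volume Q.toSet)⁻¹ * (volume.restrict Q.toSet) (w ⁻¹' {v})).toNNReal,
    fun φ => ?_⟩
  have h1 : ∫⁻ y in Q.toSet, φ (w y) =
      ∑ v ∈ w.range, φ v * (volume.restrict Q.toSet) (w ⁻¹' {v}) := by
    rw [← SimpleFunc.map_lintegral, ← SimpleFunc.lintegral_eq_lintegral]
    rfl
  rw [mean, h1, Finset.mul_sum]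
  refine Finset.sum_congr rfl fun v _ => ?_
  rw [ENNReal.coe_toNNReal]
  · ring
  · refine ENNReal.mul_ne_top (ENNReal.inv_ne_top.2 Q.volume_ne_zero) ?_
    refine ne_top_of_le_ne_top Q.volume_ne_top ?_
    calc (volume.restrict Q.toSet) (w ⁻¹' {v}) ≤ (volume.restrict Q.toSet) Set.univ :=
          measure_mono (Set.subset_univ _)
      _ = volume Q.toSet := Measure.restrict_apply_univ _

theorem mean_lt_top {β : Type*} (w : SimpleFunc (Fin d → ℝ) β) (Q : Cube d) {φ : β → ℝ≥0∞}
    (hφ : ∀ y, φ (w y) < ∞) : mean (fun y => φ (w y)) Q < ∞ := by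
  obtain ⟨κ, hκ⟩ := exists_mean_eq_sum w Q
  rw [hκ]
  refine ENNReal.sum_lt_top.2 fun v hv => ?_
  obtain ⟨y, rfl⟩ := SimpleFunc.mem_range.1 hv
  exact ENNReal.mul_lt_top ENNReal.coe_lt_top (hφ y)

theorem latticeAverage_lt_top {r : ℝ} (hr : 0 < r) (w : SimpleFunc (Fin d → ℝ) (Ω → ℝ≥0))
    (Q : Cube d) (ω : Ω) : latticeAverage r w Q ω < ∞ :=
  ENNReal.rpow_lt_top_of_nonneg (by positivity)
    (mean_lt_top w Q (φ := fun v => (v ω : ℝ≥0∞) ^ r) fun _ =>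
      ENNReal.rpow_lt_top_of_nonneg hr.le ENNReal.coe_ne_top).ne

theorem cubeAverage_normFun_lt_top {r : ℝ} (hr : 0 < r) {ρ : FunctionNorm Ω}
    {w : SimpleFunc (Fin d → ℝ) (Ω → ℝ≥0)} (hw : ∀ y, normFun ρ w y < ∞) (Q : Cube d) :
    cubeAverage r (normFun ρ w) Q < ∞ :=
  ENNReal.rpow_lt_top_of_nonneg (by positivity)
    (mean_lt_top w Q (φ := fun v => (ρ fun ω => (v ω : ℝ≥0∞)) ^ r) fun y =>
      ENNReal.rpow_lt_top_of_nonneg hr.le (hw y).ne).ne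

variable [MeasurableSpace Ω] {μ : Measure Ω}

theorem aemeasurable_latticeAverage (r : ℝ) {w : SimpleFunc (Fin d → ℝ) (Ω → ℝ≥0)}
    (hw : ∀ y, AEMeasurable (w y) μ) (Q : Cube d) : AEMeasurable (latticeAverage r w Q) μ := by
  obtain ⟨κ, hκ⟩ := exists_mean_eq_sum w Q
  have : latticeAverage r w Q =
      fun ω => (∑ v ∈ w.range, (κ v : ℝ≥0∞) * (v ω : ℝ≥0∞) ^ r) ^ (1 / r) := by
    funext ω
    rw [latticeAverage, cubeAverage_eq_mean, hκ fun v => (v ω : ℝ≥0∞) ^ r]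
  rw [this]
  refine AEMeasurable.pow_const (Finset.aemeasurable_fun_sum _ fun v hv => ?_) _
  obtain ⟨y, rfl⟩ := SimpleFunc.mem_range.1 hv
  exact ((hw y).coe_nnreal_ennreal.pow_const _).const_mul _

/-- Minkowski's inequality: by `r`-convexity, the norm of an average of order `r` is at most the
average of the norms. -/
theorem norm_latticeAverage_le {r : ℝ} (hr : 0 < r) {ρ : FunctionNorm Ω}
    (hconv : IsConvexSpace μ ρ r)
    (hsmul : ∀ (c : ℝ≥0) (u : Ω → ℝ≥0∞), AEMeasurable u μ →
      ρ (fun ω => (c : ℝ≥0∞) * u ω) = (c : ℝ≥0∞) * ρ u)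
    {w : SimpleFunc (Fin d → ℝ) (Ω → ℝ≥0)} (hw : ∀ y, AEMeasurable (w y) μ) (Q : Cube d) :
    ρ (latticeAverage r w Q) ≤ cubeAverage r (normFun ρ w) Q := by
  obtain ⟨κ, hκ⟩ := exists_mean_eq_sum w Q
  set e := w.range.equivFin with he
  have hval : ∀ k, AEMeasurable (fun ω => (((e.symm k : Ω → ℝ≥0) ω : ℝ≥0) : ℝ≥0∞)) μ := by
    intro k
    obtain ⟨y, hy⟩ := SimpleFunc.mem_range.1 (e.symm k).2
    rw [← hy]
    exact (hw y).coe_nnreal_ennreal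
  have hsum : ∀ f : (Ω → ℝ≥0) → ℝ≥0∞, ∑ v ∈ w.range, f v = ∑ k, f (e.symm k) := by
    intro f
    rw [← Finset.sum_coe_sort, ← Equiv.sum_comp e.symm]
  have hpow : ∀ (c : ℝ≥0) (a : ℝ≥0∞), (((c ^ (1 / r) : ℝ≥0) : ℝ≥0∞) * a) ^ r = c * a ^ r := by
    intro c a
    rw [ENNReal.mul_rpow_of_nonneg _ _ hr.le, ← ENNReal.coe_rpow_of_nonneg _ hr.le,
      ← NNReal.rpow_mul, one_div_mul_cancel hr.ne', NNReal.rpow_one]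
  have h := hconv _ (fun k ω => ((κ (e.symm k) ^ (1 / r) : ℝ≥0) : ℝ≥0∞) *
    ((e.symm k : Ω → ℝ≥0) ω : ℝ≥0∞)) fun k => (hval k).const_mul _
  simp only [hpow, hsmul _ _ (hval _)] at h
  have h1 : latticeAverage r w Q = fun ω =>
      (∑ k, (κ (e.symm k) : ℝ≥0∞) * ((e.symm k : Ω → ℝ≥0) ω : ℝ≥0∞) ^ r) ^ (1 / r) := by
    funext ω
    rw [latticeAverage, cubeAverage_eq_mean, hκ fun v => (v ω : ℝ≥0∞) ^ r, hsum]
  have h2 : cubeAverage r (normFun ρ w) Q =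
      (∑ k, (κ (e.symm k) : ℝ≥0∞) *
        (ρ fun ω => ((e.symm k : Ω → ℝ≥0) ω : ℝ≥0∞)) ^ r) ^ (1 / r) := by
    rw [cubeAverage_eq_mean, ← hsum fun v => (κ v : ℝ≥0∞) * (ρ fun ω => (v ω : ℝ≥0∞)) ^ r,
      ← hκ fun v => (ρ fun ω => (v ω : ℝ≥0∞)) ^ r]
    rfl
  rw [h1, h2]
  exact h

/-- Joint measurability of lattice-valued functions that factor through a countable partition. -/
theorem aemeasurable_uncurry_of_countable {α ι β : Type*} [MeasurableSpace α] [MeasurableSpace β]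
    [Countable ι] [MeasurableSpace ι] [MeasurableSingletonClass ι] (ν : Measure α) [SFinite ν]
    [SFinite μ] {φ : α → ι} (hφ : Measurable φ) {b : ι → Ω → β} (hb : ∀ i, AEMeasurable (b i) μ) :
    AEMeasurable (fun z : α × Ω => b (φ z.1) z.2) (ν.prod μ) := by
  refine ⟨fun z => (hb (φ z.1)).mk _ z.2, ?_, ?_⟩
  · have h1 : Measurable fun z : ι × Ω => (hb z.1).mk _ z.2 :=
      measurable_from_prod_countable_right fun i => (hb i).measurable_mk
    exact h1.comp ((hφ.comp measurable_fst).prodMk measurable_snd)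
  · have h2 : ∀ i, ∀ᵐ z ∂(ν.prod μ), b i z.2 = (hb i).mk _ z.2 := fun i =>
      Measure.quasiMeasurePreserving_snd.ae (hb i).ae_eq_mk
    filter_upwards [ae_all_iff.2 h2] with z hz
    exact hz _

theorem aemeasurable_uncurry_simpleFunc {α β : Type*} [MeasurableSpace α] [MeasurableSpace β]
    (ν : Measure α) [SFinite ν] [SFinite μ] (w : SimpleFunc α (Ω → β))
    (hw : ∀ x, AEMeasurable (w x) μ) :
    AEMeasurable (fun z : α × Ω => w z.1 z.2) (ν.prod μ) := by
  let _ : MeasurableSpace w.range := ⊤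
  have hφ : Measurable fun x => (⟨w x, w.mem_range_self x⟩ : w.range) := by
    intro s _
    have : (fun x => (⟨w x, w.mem_range_self x⟩ : w.range)) ⁻¹' s = w ⁻¹' (Subtype.val '' s) := by
      ext x
      simp
    rw [this]
    exact w.measurableSet_preimage _
  exact aemeasurable_uncurry_of_countable ν hφ (b := fun v => (v : Ω → β)) fun v => by
    obtain ⟨y, hy⟩ := SimpleFunc.mem_range.1 v.2
    rw [← hy]
    exact hw y

theorem aemeasurable_maximalOperator [SFinite μ] (𝒟 : Finset (Cube d)) (r : Fin n → ℝ)
    {w : Fin n → SimpleFunc (Fin d → ℝ) (Ω → ℝ≥0)} (hw : ∀ j y, AEMeasurable (w j y) μ) :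
    AEMeasurable (fun z : (Fin d → ℝ) × Ω =>
      maximalOperator (𝒟 : Set (Cube d)) r (fun j y => (w j y z.2 : ℝ≥0∞)) z.1)
      ((volume : Measure (Fin d → ℝ)).prod μ) := by
  refine AEMeasurable.biSup _ 𝒟.countable_toSet fun Q _ => ?_
  have h1 : (fun z : (Fin d → ℝ) × Ω => Q.toSet.indicator
      (fun _ => ∏ j, cubeAverage (r j) (fun y => (w j y z.2 : ℝ≥0∞)) Q) z.1) =
      fun z => Q.toSet.indicator (fun _ => 1) z.1 * ∏ j, latticeAverage (r j) (w j) Q z.2 := by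
    funext z
    by_cases hz : z.1 ∈ Q.toSet <;> simp [hz, latticeAverage]
  rw [h1]
  refine AEMeasurable.mul ?_ ?_
  · exact ((measurable_const.indicator Q.measurableSet).comp measurable_fst).aemeasurable
  · exact Finset.aemeasurable_fun_prod _ fun j _ =>
      (aemeasurable_latticeAverage (r j) (hw j) Q).comp_quasiMeasurePreserving
        Measure.quasiMeasurePreserving_snd

end Averages

theorem prod_rpow_eq_rpow_sum {ι : Type*} {s : Finset ι} {f : ι → ℝ} (x : ℝ≥0∞)
    (hf : ∀ i ∈ s, 0 ≤ f i) : ∏ i ∈ s, x ^ f i = x ^ ∑ i ∈ s, f i := by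
  classical
  induction s using Finset.induction_on with
  | empty => simp
  | insert a s ha ih =>
    rw [Finset.prod_insert ha, Finset.sum_insert ha,
      ih fun i hi => hf i (Finset.mem_insert_of_mem hi),
      ENNReal.rpow_add_of_nonneg _ _ (hf a (Finset.mem_insert_self a s))
        (Finset.sum_nonneg fun i hi => hf i (Finset.mem_insert_of_mem hi))]

/-- An embedding of nonnegative functions into complex functions. -/
def toComplex {Ω : Type*} (v : Ω → ℝ≥0) (ω : Ω) : ℂ := ((v ω : ℝ) : ℂ)

theorem enorm_toComplex {Ω : Type*} (v : Ω → ℝ≥0) (ω : Ω) : ‖toComplex v ω‖ₑ = v ω := by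
  rw [toComplex, ← ofReal_norm, Complex.norm_real, Real.norm_of_nonneg (v ω).coe_nonneg,
    ENNReal.ofReal_coe_nnreal]

/-! ### Consequences of the Hardy–Littlewood property -/

section MaximalTuple

variable {Ω : Type*} [MeasurableSpace Ω] {d n : ℕ}

variable (d) in
/-- A tuple with the Hardy–Littlewood property whose product embeds contractively into
`L¹(Ω)`. -/
structure IsMaximalTuple (μ : Measure Ω) (ρ : Fin n → FunctionNorm Ω) (r : Fin n → ℝ) : Prop where
  pos : ∀ j, 0 < r j
  zero : ∀ j, ρ j (fun _ => 0) = 0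
  smul : ∀ j (c : ℝ≥0) (u : Ω → ℝ≥0∞), AEMeasurable u μ →
    ρ j (fun ω => (c : ℝ≥0∞) * u ω) = (c : ℝ≥0∞) * ρ j u
  lintegral_le : ∀ u : Ω → ℝ≥0∞, ∫⁻ ω, u ω ∂μ ≤ productNorm μ ρ u
  hardyLittlewood : HardyLittlewood d μ ρ r

variable {μ : Measure Ω} {ρ : Fin n → FunctionNorm Ω} {r : Fin n → ℝ}

theorem IsMaximalTuple.norm_latticeAverage_le (h : IsMaximalTuple d μ ρ r) (j : Fin n)
    {w : SimpleFunc (Fin d → ℝ) (Ω → ℝ≥0)} (hw : ∀ y, AEMeasurable (w y) μ) (Q : Cube d) :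
    ρ j (latticeAverage (r j) w Q) ≤ cubeAverage (r j) (normFun (ρ j) w) Q :=
  SparseDomination.norm_latticeAverage_le (h.pos j) (h.hardyLittlewood.1 j) (h.smul j) hw Q

/-- The Hardy–Littlewood property gives a weak type bound for bounded functions supported in a set
of finite measure. -/
theorem IsMaximalTuple.exists_weak_bound [SigmaFinite μ] (h : IsMaximalTuple d μ ρ r) :
    ∃ A : ℝ≥0, ∀ (w : Fin n → SimpleFunc (Fin d → ℝ) (Ω → ℝ≥0)),
      (∀ j y, AEMeasurable (w j y) μ) → ∀ (E : Set (Fin d → ℝ)), volume E ≠ ∞ →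
      ∀ B : Fin n → ℝ≥0, (∀ j y, normFun (ρ j) (w j) y ≤ B j) →
      (∀ j, ∀ y ∉ E, w j y = 0) → ∀ 𝒟 : Finset (Cube d),
        volume {x | (A : ℝ≥0∞) * ∏ j, (B j : ℝ≥0∞) < ∫⁻ ω,
          maximalOperator (𝒟 : Set (Cube d)) r (fun j y => (w j y ω : ℝ≥0∞)) x ∂μ} ≤
            4⁻¹ * volume E := by
  obtain ⟨hconv, p, hp, C, hC⟩ := h.hardyLittlewood
  set P : ℝ≥0∞ := (∑ j, (p j)⁻¹)⁻¹ with hP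
  have hp0 : ∀ j, p j ≠ 0 := fun j => (zero_le.trans_lt (hp j)).ne'
  have hP0 : P ≠ 0 := by
    rw [hP, ENNReal.inv_ne_zero]
    exact (ENNReal.sum_lt_top.2 fun j _ => (ENNReal.inv_ne_top.2 (hp0 j)).lt_top).ne
  have key : ∀ (w : Fin n → SimpleFunc (Fin d → ℝ) (Ω → ℝ≥0)),
      (∀ j y, AEMeasurable (w j y) μ) → ∀ (E : Set (Fin d → ℝ)), volume E ≠ ∞ →
      ∀ B : Fin n → ℝ≥0, (∀ j y, normFun (ρ j) (w j) y ≤ B j) →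
      (∀ j, ∀ y ∉ E, w j y = 0) → ∀ 𝒟 : Finset (Cube d),
      eLpNorm (fun x => ∫⁻ ω, maximalOperator (𝒟 : Set (Cube d)) r
        (fun j y => (w j y ω : ℝ≥0∞)) x ∂μ) P volume ≤
        C * ((∏ j, (B j : ℝ≥0∞)) * ∏ j, volume E ^ (1 / (p j).toReal)) := by
    intro w hw E hE B hB hsupp 𝒟
    have hnorm : ∀ j, eLpNorm (normFun (ρ j) (w j)) (p j) volume ≤
        B j * volume E ^ (1 / (p j).toReal) := by
      intro j
      refine le_trans ?_ (eLpNorm_indicator_const_le (B j : ℝ≥0∞) (s := E) (p j))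
      refine eLpNorm_mono_enorm fun y => ?_
      by_cases hy : y ∈ E
      · simpa [hy] using hB j y
      · simp [hy, normFun, hsupp j y hy, h.zero j]
    have hpt : ∀ j, pointwiseNorm (ρ j) (fun y => toComplex (w j y)) = normFun (ρ j) (w j) := by
      intro j
      funext y
      simp only [pointwiseNorm, enorm_toComplex, normFun]
    have hF := hC 𝒟 (fun j y => toComplex (w j y)) fun j => ?_
    · refine le_trans (eLpNorm_mono_enorm fun x => ?_) (hF.trans ?_)
      · simp only [enorm_eq_self]
        refine (h.lintegral_le _).trans (le_of_eq ?_)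
        congr 1
        funext ω
        simp only [latticeMaximalOperator, enorm_toComplex]
      · rw [← Finset.prod_mul_distrib]
        gcongr with j
        rw [hpt]
        exact hnorm j
    · refine ⟨⟨?_, fun _ => (w j).map toComplex, fun _ x => ⟨?_, ?_⟩, ?_⟩, ?_⟩
      · exact Complex.measurable_ofReal.comp_aemeasurable
          (aemeasurable_uncurry_simpleFunc volume (w j) (hw j)).coe_nnreal_real
      · exact Complex.measurable_ofReal.comp_aemeasurable (hw j x).coe_nnreal_real
      · simp only [SimpleFunc.map_apply, enorm_toComplex]
        exact (hB j x).trans_lt ENNReal.coe_lt_top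
      · refine Eventually.of_forall fun x => ?_
        simp [h.zero j]
      · rw [hpt]
        exact (hnorm j).trans_lt (ENNReal.mul_lt_top ENNReal.coe_lt_top
          (ENNReal.rpow_lt_top_of_nonneg (by positivity) hE))
  refine ⟨(C + 1) * 4 ^ (1 / P.toReal), fun w hw E hE B hB hsupp 𝒟 => ?_⟩
  have hFP := key w hw E hE B hB hsupp 𝒟
  set F : (Fin d → ℝ) → ℝ≥0∞ := fun x => ∫⁻ ω, maximalOperator (𝒟 : Set (Cube d)) r
    (fun j y => (w j y ω : ℝ≥0∞)) x ∂μ with hF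
  have hFm : AEMeasurable F volume :=
    (aemeasurable_maximalOperator (μ := μ) 𝒟 r hw).lintegral_prod_right'
  set b : ℝ≥0∞ := ∏ j, (B j : ℝ≥0∞) with hb
  have hbt : b ≠ ∞ := ENNReal.prod_ne_top fun j _ => ENNReal.coe_ne_top
  change volume {x | _ * b < F x} ≤ _
  rcases eq_or_ne P ∞ with hPt | hPt
  · -- all exponents are infinite, and the bound holds almost everywhere
    have hpt : ∀ j, p j = ∞ := by
      rw [hP, ENNReal.inv_eq_top, Finset.sum_eq_zero_iff] at hPt
      exact fun j => ENNReal.inv_eq_zero.1 (hPt j (Finset.mem_univ j))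
    simp only [hpt, ENNReal.toReal_top, div_zero, ENNReal.rpow_zero, Finset.prod_const_one,
      mul_one, hPt, eLpNorm_exponent_top] at hFP
    refine le_of_eq_of_le ?_ zero_le
    have hae : ∀ᵐ x, F x ≤ C * b := by
      filter_upwards [ae_le_eLpNormEssSup (f := F) (μ := volume)] with x hx
      exact hx.trans hFP
    have h0 : volume {x | ¬ F x ≤ C * b} = 0 := hae
    refine measure_mono_null (fun x hx => ?_) h0
    rw [Set.mem_ofPred_eq, not_le]
    refine lt_of_le_of_lt ?_ hx
    rw [hPt]
    simp only [ENNReal.toReal_top, div_zero, NNReal.rpow_zero, mul_one, ENNReal.coe_add,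
      ENNReal.coe_one]
    gcongr
    exact le_self_add
  · have hPr : 0 < P.toReal := ENNReal.toReal_pos hP0 hPt
    have hvol : ∏ j, volume E ^ (1 / (p j).toReal) = volume E ^ (1 / P.toReal) := by
      rw [prod_rpow_eq_rpow_sum _ fun j _ => by positivity]
      congr 1
      have : P⁻¹.toReal = ∑ j, (p j)⁻¹.toReal := by
        rw [hP, inv_inv, ENNReal.toReal_sum fun j _ => ENNReal.inv_ne_top.2 (hp0 j)]
      simp only [one_div, ← ENNReal.toReal_inv]
      exact this.symm
    rw [hvol] at hFP
    rcases eq_or_ne b 0 with hb0 | hb0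
    · rw [hb0] at hFP ⊢
      simp only [zero_mul, mul_zero, nonpos_iff_eq_zero] at hFP ⊢
      rw [eLpNorm_eq_zero_iff hFm.aestronglyMeasurable hP0] at hFP
      refine le_of_eq_of_le ?_ zero_le
      have h0 : volume {x | ¬ F x = 0} = 0 := hFP
      exact measure_mono_null (fun x hx => (ne_of_gt hx : F x ≠ 0)) h0
    · have hcheb := mul_meas_ge_le_pow_eLpNorm (volume : Measure (Fin d → ℝ)) hP0 hPt
        hFm.aestronglyMeasurable (((C + 1 : ℝ≥0∞) * 4 ^ (1 / P.toReal) * b) ^ P.toReal)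
      set c : ℝ≥0∞ := ((C + 1 : ℝ≥0∞) * b) ^ P.toReal with hc
      have hc0 : c ≠ 0 := by
        rw [hc]
        refine (ENNReal.rpow_pos (pos_iff_ne_zero.2 (mul_ne_zero ?_ hb0)) ?_).ne'
        · exact (zero_lt_one.trans_le le_add_self).ne'
        · exact ENNReal.mul_ne_top (by finiteness) hbt
      have hct : c ≠ ∞ :=
        (ENNReal.rpow_lt_top_of_nonneg hPr.le (ENNReal.mul_ne_top (by finiteness) hbt)).ne
      have h1 : ((C + 1 : ℝ≥0∞) * 4 ^ (1 / P.toReal) * b) ^ P.toReal = c * 4 := by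
        rw [hc, show (C + 1 : ℝ≥0∞) * 4 ^ (1 / P.toReal) * b =
          ((C + 1 : ℝ≥0∞) * b) * 4 ^ (1 / P.toReal) by ring,
          ENNReal.mul_rpow_of_nonneg _ _ hPr.le, ← ENNReal.rpow_mul,
          one_div_mul_cancel hPr.ne', ENNReal.rpow_one]
      have h2 : eLpNorm F P volume ^ P.toReal ≤ c * volume E := by
        calc eLpNorm F P volume ^ P.toReal
            ≤ (((C + 1 : ℝ≥0∞) * b) * volume E ^ (1 / P.toReal)) ^ P.toReal := by
              refine ENNReal.rpow_le_rpow (hFP.trans ?_) hPr.le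
              rw [← mul_assoc]
              gcongr
              exact le_self_add
          _ = c * volume E := by
              rw [ENNReal.mul_rpow_of_nonneg _ _ hPr.le, ← ENNReal.rpow_mul,
                one_div_mul_cancel hPr.ne', ENNReal.rpow_one]
      rw [h1] at hcheb
      have h3 := hcheb.trans h2
      rw [mul_assoc, ENNReal.mul_le_mul_iff_right hc0 hct] at h3
      rw [mul_comm (4⁻¹ : ℝ≥0∞), ← div_eq_mul_inv, ENNReal.le_div_iff_mul_le
        (Or.inl (by norm_num)) (Or.inl (by norm_num)), mul_comm (volume _)]
      refine le_trans ?_ h3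
      gcongr 4 * volume ?_
      intro x hx
      rw [Set.mem_ofPred_eq, ← h1]
      refine ENNReal.rpow_le_rpow ?_ hPr.le
      have hx' := le_of_lt (show _ * b < F x from hx)
      rw [ENNReal.coe_mul, ENNReal.coe_add, ENNReal.coe_one,
        ENNReal.coe_rpow_of_nonneg _ (by positivity)] at hx'
      simpa using hx'

end MaximalTuple

/-! ### The lattice maximal operator over one dyadic grid -/

namespace DyadicGrid

variable {d : ℕ} {G : DyadicGrid d}

theorem finite_image_index (ℓ N : ℕ) (x : Fin d → ℝ) :
    (G.index N '' (G.cubeAt ℓ x).toSet).Finite := by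
  refine (Set.finite_Icc (fun i => ⌊((G.cubeAt ℓ x).corner i - G.origin i) / G.scale N⌋)
    (fun i => ⌊((G.cubeAt ℓ x).corner i + (G.cubeAt ℓ x).side - G.origin i) /
      G.scale N⌋)).subset ?_
  rintro _ ⟨y, hy, rfl⟩
  have hs := (G.scale_pos N).le
  have hy' : ∀ i, y i ∈ Set.Ico ((G.cubeAt ℓ x).corner i)
      ((G.cubeAt ℓ x).corner i + (G.cubeAt ℓ x).side) := fun i => hy i (Set.mem_univ i)
  refine Set.mem_Icc.2 ⟨fun i => ?_, fun i => ?_⟩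
  · refine Int.floor_le_floor (div_le_div_of_nonneg_right ?_ hs)
    linarith [(hy' i).1]
  · refine Int.floor_le_floor (div_le_div_of_nonneg_right ?_ hs)
    linarith [(hy' i).2]

/-- A function that is constant on the cubes of one level, and constant outside some cube, is a
simple function. -/
theorem exists_simpleFunc {β : Type*} {f : (Fin d → ℝ) → β} {ℓ N : ℕ} {x : Fin d → ℝ} {b : β}
    (hf : ∀ x y, G.index N x = G.index N y → f x = f y)
    (hb : ∀ y ∉ (G.cubeAt ℓ x).toSet, f y = b) : ∃ s : SimpleFunc (Fin d → ℝ) β, ⇑s = f := by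
  refine ⟨⟨f, fun v => ?_, ?_⟩, rfl⟩
  · have : G.Saturated N (f ⁻¹' {v}) := fun y z h hy => (hf y z h).symm.trans hy
    exact this.measurableSet
  · have hfac : Function.FactorsThrough f (G.index N) := fun y z h => hf y z h
    refine (((finite_image_index (G := G) ℓ N x).image
      (Function.extend (G.index N) f fun _ => b)).insert b).subset ?_
    rintro _ ⟨y, rfl⟩
    by_cases hy : y ∈ (G.cubeAt ℓ x).toSet
    · refine Or.inr ⟨G.index N y, ⟨y, hy, rfl⟩, ?_⟩
      rw [hfac.extend_apply]
    · exact Or.inl (hb y hy)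

end DyadicGrid

section OneGrid

variable {Ω : Type*} {d n : ℕ} {ρ : Fin n → FunctionNorm Ω} {r : Fin n → ℝ}

/-- The product of the scalar averages of the norms over a cube. -/
def normProd (ρ : Fin n → FunctionNorm Ω) (r : Fin n → ℝ)
    (w : Fin n → SimpleFunc (Fin d → ℝ) (Ω → ℝ≥0)) (Q : Cube d) : ℝ≥0∞ :=
  ∏ j, cubeAverage (r j) (normFun (ρ j) (w j)) Q

/-- The product of the lattice averages over a cube. -/
def latticeProd (r : Fin n → ℝ) (w : Fin n → SimpleFunc (Fin d → ℝ) (Ω → ℝ≥0)) (Q : Cube d)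
    (ω : Ω) : ℝ≥0∞ :=
  ∏ j, latticeAverage (r j) (w j) Q ω

theorem normProd_le_maximalOperator (w : Fin n → SimpleFunc (Fin d → ℝ) (Ω → ℝ≥0)) {Q : Cube d}
    {y : Fin d → ℝ} (hy : y ∈ Q.toSet) :
    normProd ρ r w Q ≤ maximalOperator Set.univ r (fun j => normFun (ρ j) (w j)) y := by
  refine le_iSup₂_of_le (f := fun (Q : Cube d) (_ : Q ∈ Set.univ) => Q.toSet.indicator
    (fun _ => ∏ j, cubeAverage (r j) (normFun (ρ j) (w j)) Q) y) Q (Set.mem_univ Q) ?_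
  rw [Set.indicator_of_mem hy]
  rfl

variable [MeasurableSpace Ω] {μ : Measure Ω}

/-- The `L¹(Ω)`-norm of the supremum of the lattice products over the cubes of levels between `ℓ`
and `k` that contain `y`. -/
def gridMax (μ : Measure Ω) (G : DyadicGrid d) (r : Fin n → ℝ)
    (w : Fin n → SimpleFunc (Fin d → ℝ) (Ω → ℝ≥0)) (ℓ k : ℕ) (y : Fin d → ℝ) : ℝ≥0∞ :=
  ∫⁻ ω, ⨆ i ∈ Finset.Icc ℓ k, latticeProd r w (G.cubeAt i y) ω ∂μ

/-- Measurable representatives and finite norms for every value of a tuple of lattice-valued simple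
functions. -/
def IsAdmissible (μ : Measure Ω) (ρ : Fin n → FunctionNorm Ω)
    (w : Fin n → SimpleFunc (Fin d → ℝ) (Ω → ℝ≥0)) : Prop :=
  ∀ j y, AEMeasurable (w j y) μ ∧ normFun (ρ j) (w j) y < ∞

theorem lintegral_latticeProd_le (h : IsMaximalTuple d μ ρ r)
    {w : Fin n → SimpleFunc (Fin d → ℝ) (Ω → ℝ≥0)} (hw : IsAdmissible μ ρ w) (Q : Cube d) :
    ∫⁻ ω, latticeProd r w Q ω ∂μ ≤ normProd ρ r w Q := by
  have hle : ∀ j, ρ j (latticeAverage (r j) (w j) Q) ≤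
      cubeAverage (r j) (normFun (ρ j) (w j)) Q := fun j =>
    h.norm_latticeAverage_le j (fun y => (hw j y).1) Q
  refine (h.lintegral_le _).trans ((iInf₂_le_of_le (fun j => latticeAverage (r j) (w j) Q)
    (fun j => ⟨aemeasurable_latticeAverage (r j) (fun y => (hw j y).1) Q, (hle j).trans_lt
      (cubeAverage_normFun_lt_top (h.pos j) (fun y => (hw j y).2) Q)⟩)
    (iInf_le_of_le (Eventually.of_forall fun ω => le_rfl) le_rfl)).trans ?_)
  exact Finset.prod_le_prod' fun j _ => hle j

variable {G : DyadicGrid d}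

/-- Stopping-time truncation: inside a cube of level `ℓ`, replace the functions by their lattice
averages over the maximal subcubes on which an average of the norms is large, and over the cubes of
level `N` elsewhere. The norms become bounded, and off the union of those subcubes, which is small,
the lattice averages over the cubes of levels between `ℓ` and `N` do not change. -/
theorem exists_truncation (h : IsMaximalTuple d μ ρ r)
    {w : Fin n → SimpleFunc (Fin d → ℝ) (Ω → ℝ≥0)} (hw : IsAdmissible μ ρ w) {ℓ N : ℕ}
    (hℓN : ℓ ≤ N) (x : Fin d → ℝ) :
    ∃ w' : Fin n → SimpleFunc (Fin d → ℝ) (Ω → ℝ≥0), (∀ j y, AEMeasurable (w' j y) μ) ∧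
      (∀ j y, normFun (ρ j) (w' j) y ≤ (2 ^ d * (4 * (n + 1) : ℝ≥0∞)) ^ (1 / r j) *
        cubeAverage (r j) (normFun (ρ j) (w j)) (G.cubeAt ℓ x)) ∧
      (∀ j, ∀ y ∉ (G.cubeAt ℓ x).toSet, w' j y = 0) ∧
      ∃ bad : Set (Fin d → ℝ), volume bad ≤ 4⁻¹ * volume (G.cubeAt ℓ x).toSet ∧
        ∀ y ∈ (G.cubeAt ℓ x).toSet, y ∉ bad → ∀ k, ℓ ≤ k → k ≤ N → ∀ ω,
          latticeProd r w' (G.cubeAt k y) ω = latticeProd r w (G.cubeAt k y) ω := by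
  classical
  set E := (G.cubeAt ℓ x).toSet with hE
  set Λ : ℝ≥0∞ := 4 * (n + 1) with hΛ
  have hΛ0 : Λ ≠ 0 := by positivity
  have hΛt : Λ ≠ ∞ := by finiteness
  have hΛ1 : 1 ≤ 2 ^ d * Λ := by
    refine one_le_mul (one_le_pow₀ (by norm_num)) ?_
    rw [hΛ]
    exact one_le_mul (by norm_num) le_add_self
  -- by the weak `(1, 1)` inequality, the set on which one of the `n` averages exceeds the threshold
  -- `Λ` has at most the fraction `n / Λ < 1 / 4` of the cube
  let φ : Fin n → (Fin d → ℝ) → ℝ≥0∞ := fun j y => normFun (ρ j) (w j) y ^ r j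
  let c : ℕ → (Fin d → ℝ) → Prop := fun k y => ℓ ≤ k ∧ k ≤ N ∧
    ∃ j, Λ * mean (φ j) (G.cubeAt ℓ x) < mean (φ j) (G.cubeAt k y)
  have hcad : G.Adapted c := by
    rintro k y z hyz ⟨h1, h2, j, h3⟩
    exact ⟨h1, h2, j, by rwa [← G.cubeAt_eq hyz]⟩
  have hex : ∀ y, ∃ k, k = N ∨ c k y := fun y => ⟨N, Or.inl rfl⟩
  -- the stopping level, taken to be `N` if the condition never holds
  let σ : (Fin d → ℝ) → ℕ := fun y => Nat.find (hex y)
  have hσN : ∀ y, σ y ≤ N := fun y => Nat.find_min' _ (Or.inl rfl)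
  have hσℓ : ∀ y, ℓ ≤ σ y := fun y => by
    rcases Nat.find_spec (hex y) with h1 | h1
    · exact hℓN.trans_eq h1.symm
    · exact h1.1
  have hσeq : ∀ {k y z}, k ≤ N → G.index k y = G.index k z → σ y = k → σ z = k := by
    intro k y z hk hyz hy
    rw [Nat.find_eq_iff] at hy ⊢
    refine ⟨hy.1.imp id (hcad k y z hyz), fun i hi => ?_⟩
    rintro (h1 | h1)
    · omega
    · exact hy.2 i hi (Or.inr (hcad i z y (G.index_eq_of_le hi.le hyz).symm h1))
  have hcube : ∀ y z, G.index N y = G.index N z → G.cubeAt (σ y) y = G.cubeAt (σ z) z := by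
    intro y z hyz
    have h1 := G.index_eq_of_le (hσN y) hyz
    rw [hσeq (hσN y) h1 rfl]
    exact G.cubeAt_eq h1
  have hEN : ∀ y z, G.index N y = G.index N z → (y ∈ E ↔ z ∈ E) := fun y z hyz =>
    ⟨(DyadicGrid.saturated_cubeAt ℓ x).mono hℓN y z hyz,
      (DyadicGrid.saturated_cubeAt ℓ x).mono hℓN z y hyz.symm⟩
  let f : Fin n → (Fin d → ℝ) → Ω → ℝ≥0 := fun j y => if y ∈ E then
    fun ω => (latticeAverage (r j) (w j) (G.cubeAt (σ y) y) ω).toNNReal else 0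
  have hsimple : ∀ j, ∃ s : SimpleFunc (Fin d → ℝ) (Ω → ℝ≥0), ⇑s = f j := by
    intro j
    refine DyadicGrid.exists_simpleFunc (G := G) (ℓ := ℓ) (N := N) (x := x) (b := 0) ?_ ?_
    · intro y z hyz
      by_cases hy : y ∈ E
      · simp only [f, if_pos hy, if_pos ((hEN y z hyz).1 hy), hcube y z hyz]
      · simp only [f, if_neg hy, if_neg (mt (hEN y z hyz).2 hy)]
    · intro y hy
      simp only [f]
      rw [if_neg hy]
  choose w' hw' using hsimple
  have hval : ∀ j, ∀ y ∈ E, ∀ ω, ((w' j y ω : ℝ≥0) : ℝ≥0∞) =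
      latticeAverage (r j) (w j) (G.cubeAt (σ y) y) ω := by
    intro j y hy ω
    rw [hw']
    simp only [f, if_pos hy]
    exact ENNReal.coe_toNNReal (latticeAverage_lt_top (h.pos j) _ _ _).ne
  have hval0 : ∀ j, ∀ y ∉ E, w' j y = 0 := by
    intro j y hy
    rw [hw']
    simp only [f, if_neg hy]
  refine ⟨w', fun j y => ?_, fun j y => ?_, hval0, {y | y ∈ E ∧ ∃ k, c k y}, ?_, ?_⟩
  · by_cases hy : y ∈ E
    · rw [hw']
      simp only [f, if_pos hy]
      exact (aemeasurable_latticeAverage (r j) (fun y => (hw j y).1) _).ennreal_toNNReal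
    · rw [hval0 j y hy]
      exact aemeasurable_const
  · by_cases hy : y ∈ E
    · have h1 : normFun (ρ j) (w' j) y = ρ j (latticeAverage (r j) (w j) (G.cubeAt (σ y) y)) := by
        rw [normFun]
        congr 1
        funext ω
        exact hval j y hy ω
      rw [h1]
      refine (h.norm_latticeAverage_le j (fun y => (hw j y).1) _).trans ?_
      have hr := h.pos j
      rw [cubeAverage_eq_mean, cubeAverage_eq_mean,
        ← ENNReal.mul_rpow_of_nonneg _ _ (by positivity)]
      refine ENNReal.rpow_le_rpow ?_ (by positivity)
      change mean (φ j) _ ≤ _ * mean (φ j) _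
      rcases (hσℓ y).eq_or_lt with h2 | h2
      · rw [← h2, G.cubeAt_eq (G.mem_cubeAt.1 hy)]
        exact le_mul_of_one_le_left zero_le hΛ1
      -- the parent of the stopping cube does not satisfy the condition; this costs a factor `2 ^ d`
      · obtain ⟨k, hk⟩ : ∃ k, σ y = k + 1 := ⟨σ y - 1, by omega⟩
        have h3 : ¬ c k y := fun h4 =>
          Nat.find_min (hex y) (show k < σ y by omega) (Or.inr h4)
        have h5 : mean (φ j) (G.cubeAt k y) ≤ Λ * mean (φ j) (G.cubeAt ℓ x) := by
          by_contra hcon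
          exact h3 ⟨by omega, by have := hσN y; omega, j, not_le.1 hcon⟩
        rw [hk, mul_assoc]
        exact (mean_le_of_subset (φ j) (G.cubeAt_subset (Nat.le_succ k) y)
          (G.volume_cubeAt_le k y)).trans (mul_le_mul_right h5 _)
    · simp [normFun, hval0 j y hy, h.zero j]
  · have hsub : {y | y ∈ E ∧ ∃ k, c k y} ⊆ ⋃ j : Fin n, {y | y ∈ E ∧ ∃ k, ℓ ≤ k ∧ k ≤ N ∧
        Λ * mean (φ j) (G.cubeAt ℓ x) < mean (φ j) (G.cubeAt k y)} := by
      rintro y ⟨hy, k, h1, h2, j, h3⟩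
      exact Set.mem_iUnion.2 ⟨j, hy, k, h1, h2, h3⟩
    calc volume {y | y ∈ E ∧ ∃ k, c k y}
        ≤ ∑ j : Fin n, Λ⁻¹ * volume E := by
          refine (measure_mono hsub).trans ((measure_iUnion_fintype_le _ _).trans
            (Finset.sum_le_sum fun j _ => ?_))
          exact DyadicGrid.volume_mean_gt_le (φ j) ℓ N x hΛ0 hΛt
            (mean_lt_top (w j) _ (φ := fun v => (ρ j fun ω => (v ω : ℝ≥0∞)) ^ r j) fun y =>
              ENNReal.rpow_lt_top_of_nonneg (h.pos j).le (hw j y).2.ne).ne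
      _ = ((n : ℝ≥0∞) * Λ⁻¹) * volume E := by
          simp [mul_assoc]
      _ ≤ 4⁻¹ * volume E := by
          gcongr
          rw [hΛ, ENNReal.mul_inv (Or.inl (by norm_num)) (Or.inl (by norm_num)), mul_left_comm]
          refine mul_le_of_le_one_right zero_le ?_
          rw [← div_eq_mul_inv]
          exact ENNReal.div_le_of_le_mul (by rw [one_mul]; exact le_self_add)
  · intro y hy hbad k hk hkN ω
    have hgood : ∀ i, ¬ c i y := fun i hi => hbad ⟨hy, i, hi⟩
    have hsub : (G.cubeAt k y).toSet ⊆ E := by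
      rw [hE, ← G.cubeAt_eq (G.mem_cubeAt.1 hy)]
      exact G.cubeAt_subset hk y
    refine Finset.prod_congr rfl fun j _ => ?_
    rw [latticeAverage, latticeAverage, cubeAverage_eq_mean, cubeAverage_eq_mean]
    congr 1
    rw [mean, mean]
    congr 1
    refine Eq.trans ?_ (DyadicGrid.setLIntegral_mean_stop (G := G) (σ := σ)
      (S := (G.cubeAt k y).toSet) ?_ fun z => (w j z ω : ℝ≥0∞) ^ r j)
    · refine setLIntegral_congr_fun (G.cubeAt k y).measurableSet fun z hz => ?_
      have hr := h.pos j
      simp only [hval j z (hsub hz) ω]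
      rw [latticeAverage, cubeAverage_eq_mean, ← ENNReal.rpow_mul, one_div_mul_cancel hr.ne',
        ENNReal.rpow_one]
    · intro i
      by_cases hik : k ≤ i
      · rintro z z' hzz ⟨h1, h2⟩
        have h2' : σ z = i := h2
        exact ⟨(DyadicGrid.saturated_cubeAt k y).mono hik z z' hzz h1,
          hσeq (h2' ▸ hσN z) hzz h2⟩
      · rintro z z' hzz ⟨h1, h2⟩
        exfalso
        have h2' : σ z = i := h2
        have h3 : i = N ∨ c i z := h2' ▸ Nat.find_spec (hex z)
        rcases h3 with h3 | h3
        · omega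
        · exact hgood i (hcad i z y
            (G.index_eq_of_le (not_le.1 hik).le (G.mem_cubeAt.1 h1)) h3)

theorem gridMax_mono_right {w : Fin n → SimpleFunc (Fin d → ℝ) (Ω → ℝ≥0)} (ℓ : ℕ) {j k : ℕ}
    (hjk : j ≤ k) (y : Fin d → ℝ) : gridMax μ G r w ℓ j y ≤ gridMax μ G r w ℓ k y :=
  lintegral_mono fun _ => biSup_mono fun _ hi => Finset.Icc_subset_Icc_right hjk hi

/-- The Hardy–Littlewood property, applied to the truncated functions, bounds the lattice supremum
by the product of the scalar averages on at least half of every cube. -/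
theorem exists_volume_gridMax_gt_le [SigmaFinite μ] (h : IsMaximalTuple d μ ρ r) :
    ∃ A : ℝ≥0, 1 ≤ A ∧ ∀ (G : DyadicGrid d) (w : Fin n → SimpleFunc (Fin d → ℝ) (Ω → ℝ≥0)),
      IsAdmissible μ ρ w → ∀ ℓ N : ℕ, ℓ ≤ N → ∀ x,
        volume {y | y ∈ (G.cubeAt ℓ x).toSet ∧
          (A : ℝ≥0∞) * normProd ρ r w (G.cubeAt ℓ x) < gridMax μ G r w ℓ N y} ≤
            2⁻¹ * volume (G.cubeAt ℓ x).toSet := by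
  classical
  obtain ⟨A, hA⟩ := h.exists_weak_bound
  let a : Fin n → ℝ≥0∞ := fun j => (2 ^ d * (4 * (n + 1) : ℝ≥0∞)) ^ (1 / r j)
  have hat : ∀ j, a j ≠ ∞ := fun j =>
    (ENNReal.rpow_lt_top_of_nonneg (by have := h.pos j; positivity) (by finiteness)).ne
  refine ⟨max 1 (A * ∏ j, (a j).toNNReal), le_max_left _ _, fun G w hw ℓ N hℓN x => ?_⟩
  obtain ⟨w', hw'm, hw'n, hw'0, bad, hbad, hgood⟩ := exists_truncation (G := G) h hw hℓN x
  set E := (G.cubeAt ℓ x).toSet with hE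
  let B : Fin n → ℝ≥0 := fun j =>
    (a j * cubeAverage (r j) (normFun (ρ j) (w j)) (G.cubeAt ℓ x)).toNNReal
  have hB : ∀ j, (B j : ℝ≥0∞) = a j * cubeAverage (r j) (normFun (ρ j) (w j)) (G.cubeAt ℓ x) :=
    fun j => ENNReal.coe_toNNReal (ENNReal.mul_ne_top (hat j)
      (cubeAverage_normFun_lt_top (h.pos j) (fun y => (hw j y).2) _).ne)
  have hfinite : (⋃ k ∈ Finset.Icc ℓ N, G.cube k '' (G.index k '' E)).Finite :=
    Set.Finite.biUnion (Finset.finite_toSet _) fun k _ =>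
      (DyadicGrid.finite_image_index ℓ k x).image _
  have hweak := hA w' hw'm E (G.cubeAt ℓ x).volume_ne_top B (fun j y => by
    rw [hB]
    exact hw'n j y) hw'0 hfinite.toFinset
  have hsub : {y | y ∈ E ∧ ((max 1 (A * ∏ j, (a j).toNNReal) : ℝ≥0) : ℝ≥0∞) *
      normProd ρ r w (G.cubeAt ℓ x) < gridMax μ G r w ℓ N y} ⊆
      bad ∪ {x | (A : ℝ≥0∞) * ∏ j, (B j : ℝ≥0∞) < ∫⁻ ω, maximalOperator
        (hfinite.toFinset : Set (Cube d)) r (fun j y => (w' j y ω : ℝ≥0∞)) x ∂μ} := by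
    rintro y ⟨hy, hlt⟩
    by_cases hyb : y ∈ bad
    · exact Or.inl hyb
    · refine Or.inr ?_
      refine lt_of_le_of_lt ?_ (hlt.trans_le (lintegral_mono fun ω => iSup₂_le fun i hi => ?_))
      · calc (A : ℝ≥0∞) * ∏ j, (B j : ℝ≥0∞)
            = ((A * ∏ j, (a j).toNNReal : ℝ≥0) : ℝ≥0∞) * normProd ρ r w (G.cubeAt ℓ x) := by
              simp only [hB, Finset.prod_mul_distrib, normProd, ENNReal.coe_mul,
                ENNReal.ofNNReal_finsetProd, ENNReal.coe_toNNReal (hat _), mul_assoc]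
          _ ≤ _ := by
              gcongr
              exact le_max_right _ _
      · rw [Finset.mem_Icc] at hi
        rw [← hgood y hy hyb i hi.1 hi.2 ω]
        refine le_iSup₂_of_le (f := fun (Q : Cube d) (_ : Q ∈ (hfinite.toFinset : Set (Cube d))) =>
          Q.toSet.indicator (fun _ => ∏ j, cubeAverage (r j) (fun y => (w' j y ω : ℝ≥0∞)) Q) y)
          (G.cubeAt i y) ?_ ?_
        · rw [Set.Finite.coe_toFinset]
          exact Set.mem_biUnion (Finset.mem_Icc.2 hi) ⟨_, ⟨y, hy, rfl⟩, rfl⟩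
        · rw [Set.indicator_of_mem (G.self_mem_cubeAt i y)]
          rfl
  calc volume _ ≤ volume bad + _ := (measure_mono hsub).trans (measure_union_le _ _)
    _ ≤ 4⁻¹ * volume E + 4⁻¹ * volume E := add_le_add hbad hweak
    _ = 2⁻¹ * volume E := by
        rw [← add_mul]
        congr 1
        rw [← ENNReal.toReal_eq_toReal_iff' (by finiteness) (by finiteness),
          ENNReal.toReal_add (by finiteness) (by finiteness)]
        norm_num

theorem gridMax_congr {w : Fin n → SimpleFunc (Fin d → ℝ) (Ω → ℝ≥0)} (ℓ : ℕ) {k : ℕ}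
    {y z : Fin d → ℝ} (hyz : G.index k y = G.index k z) :
    gridMax μ G r w ℓ k y = gridMax μ G r w ℓ k z := by
  refine lintegral_congr fun ω => iSup_congr fun i => iSup_congr fun hi => ?_
  rw [G.cubeAt_eq (G.index_eq_of_le (Finset.mem_Icc.1 hi).2 hyz)]

/-- The dyadic estimate: stopping at the first level at which the lattice supremum becomes large
compared with the scalar averages leaves half of every cube, and the estimate is iterated on the
stopping cubes. -/
theorem exists_setLIntegral_gridMax_le [SigmaFinite μ] (h : IsMaximalTuple d μ ρ r) :
    ∃ A : ℝ≥0, ∀ (G : DyadicGrid d) (w : Fin n → SimpleFunc (Fin d → ℝ) (Ω → ℝ≥0)),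
      IsAdmissible μ ρ w → ∀ (N ℓ : ℕ), ℓ ≤ N → ∀ S, G.Saturated ℓ S →
        ∫⁻ y in S, gridMax μ G r w ℓ N y ≤
          A * ∫⁻ y in S, maximalOperator Set.univ r (fun j => normFun (ρ j) (w j)) y := by
  obtain ⟨A, hA1, hA⟩ := exists_volume_gridMax_gt_le h
  refine ⟨2 * A, fun G w hw N => ?_⟩
  set M : (Fin d → ℝ) → ℝ≥0∞ := maximalOperator Set.univ r (fun j => normFun (ρ j) (w j)) with hM
  suffices key : ∀ m ℓ : ℕ, ℓ + m = N → ∀ S, G.Saturated ℓ S →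
      ∫⁻ y in S, gridMax μ G r w ℓ N y ≤ ((2 * A : ℝ≥0) : ℝ≥0∞) * ∫⁻ y in S, M y by
    exact fun ℓ hℓ S hS => key (N - ℓ) ℓ (by omega) S hS
  intro m
  induction m using Nat.strong_induction_on with
  | _ m ih =>
  intro ℓ hℓm S hS
  have hℓN : ℓ ≤ N := by omega
  let b : (Fin d → ℝ) → ℝ≥0∞ := fun y => A * normProd ρ r w (G.cubeAt ℓ y)
  have hb : Measurable b := G.measurable_of_index (k := ℓ) fun y z hyz => by
    simp only [b, G.cubeAt_eq hyz]
  let c : ℕ → (Fin d → ℝ) → Prop := fun k y => ℓ ≤ k ∧ k ≤ N ∧ b y < gridMax μ G r w ℓ k y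
  have hcad : G.Adapted c := by
    rintro k y z hyz ⟨h1, h2, h3⟩
    refine ⟨h1, h2, ?_⟩
    simp only [b] at h3 ⊢
    rwa [← G.cubeAt_eq (G.index_eq_of_le h1 hyz), ← gridMax_congr ℓ hyz]
  have hfirst : ∀ y, gridMax μ G r w ℓ ℓ y ≤ b y := by
    intro y
    have h1 : gridMax μ G r w ℓ ℓ y = ∫⁻ ω, latticeProd r w (G.cubeAt ℓ y) ω ∂μ := by
      simp [gridMax]
    rw [h1]
    refine (lintegral_latticeProd_le h hw _).trans (le_mul_of_one_le_left zero_le ?_)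
    exact_mod_cast hA1
  have hT : ∀ k, DyadicGrid.firstAt c S k ≠ ∅ → ℓ < k ∧ k ≤ N := by
    intro k hne
    obtain ⟨y, _, ⟨h1, h2, h3⟩, _⟩ := Set.nonempty_iff_ne_empty.2 hne
    refine ⟨lt_of_le_of_ne h1 ?_, h2⟩
    rintro rfl
    exact absurd h3 (not_lt.2 (hfirst y))
  have hsat : ∀ k, G.Saturated k (DyadicGrid.firstAt c S k) := by
    intro k
    by_cases hk : ℓ ≤ k
    · exact hcad.saturated_firstAt hk hS
    · rintro y z _ ⟨_, h1, _⟩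
      exact absurd h1.1 hk
  set U := ⋃ k, DyadicGrid.firstAt c S k with hU
  have hUm : MeasurableSet U := MeasurableSet.iUnion fun k => (hsat k).measurableSet
  have hUS : U ⊆ S := Set.iUnion_subset fun k y hy => hy.1
  have hnotU : ∀ y ∈ S, y ∉ U → gridMax μ G r w ℓ N y ≤ b y := by
    intro y hy hyU
    by_contra hcon
    obtain ⟨i, _, hi⟩ := DyadicGrid.exists_firstAt hy (c := c) (k := N) ⟨hℓN, le_rfl, not_le.1 hcon⟩
    exact hyU (Set.mem_iUnion.2 ⟨i, hi⟩)
  -- on a stopping cube only the levels from the stopping level on remain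
  have hpiece : ∀ k, ∀ y ∈ DyadicGrid.firstAt c S k,
      gridMax μ G r w ℓ N y ≤ b y + gridMax μ G r w k N y := by
    intro k y hy
    obtain ⟨hk, hkN⟩ := hT k (Set.nonempty_iff_ne_empty.1 ⟨y, hy⟩)
    have h1 : gridMax μ G r w ℓ (k - 1) y ≤ b y := by
      by_contra hcon
      exact hy.2.2 (k - 1) (by omega) ⟨by omega, by omega, not_le.1 hcon⟩
    have hmeas : AEMeasurable (fun ω => ⨆ i ∈ Finset.Icc ℓ (k - 1),
        latticeProd r w (G.cubeAt i y) ω) μ :=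
      AEMeasurable.biSup _ (Finset.countable_toSet _) fun i _ =>
        Finset.aemeasurable_fun_prod _ fun j _ =>
          aemeasurable_latticeAverage (r j) (fun y => (hw j y).1) _
    refine le_trans ?_ (add_le_add_left h1 _)
    rw [gridMax, gridMax, gridMax, ← lintegral_add_left' hmeas]
    refine lintegral_mono fun ω => iSup₂_le fun i hi => ?_
    rw [Finset.mem_Icc] at hi
    by_cases hik : i < k
    · refine le_trans ?_ le_self_add
      exact le_iSup₂_of_le (f := fun i (_ : i ∈ Finset.Icc ℓ (k - 1)) =>
        latticeProd r w (G.cubeAt i y) ω) i (Finset.mem_Icc.2 ⟨hi.1, by omega⟩) le_rfl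
    · refine le_trans ?_ le_add_self
      exact le_iSup₂_of_le (f := fun i (_ : i ∈ Finset.Icc k N) =>
        latticeProd r w (G.cubeAt i y) ω) i (Finset.mem_Icc.2 ⟨by omega, hi.2⟩) le_rfl
  have hdis := DyadicGrid.firstAt_disjoint c S
  have hU_le : ∫⁻ y in U, gridMax μ G r w ℓ N y ≤
      (∫⁻ y in U, b y) + ((2 * A : ℝ≥0) : ℝ≥0∞) * ∫⁻ y in U, M y := by
    rw [hU, lintegral_iUnion (fun k => (hsat k).measurableSet) hdis,
      lintegral_iUnion (fun k => (hsat k).measurableSet) hdis,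
      lintegral_iUnion (fun k => (hsat k).measurableSet) hdis, ← ENNReal.tsum_mul_left,
      ← ENNReal.tsum_add]
    refine ENNReal.tsum_le_tsum fun k => ?_
    by_cases hne : DyadicGrid.firstAt c S k = ∅
    · simp [hne]
    · obtain ⟨hk, hkN⟩ := hT k hne
      refine (setLIntegral_mono' (hsat k).measurableSet (hpiece k)).trans ?_
      rw [lintegral_add_left hb]
      gcongr
      exact ih (N - k) (by omega) k (by omega) _ (hsat k)
  have hbM : ∀ y, b y ≤ A * M y := fun y =>
    mul_le_mul_right (normProd_le_maximalOperator w (G.self_mem_cubeAt ℓ y)) _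
  -- `b` is constant on cubes of level `ℓ`, at most half of each of which is covered by `U`
  have hhalf : ∫⁻ y in S, b y ≤ 2 * ∫⁻ y in S \ U, b y := by
    have h1 : 2 * ∫⁻ y in S \ U, b y = ∫⁻ y in S, 2 * Uᶜ.indicator b y := by
      rw [lintegral_const_mul _ (hb.indicator hUm.compl), Set.sdiff_eq, Set.inter_comm,
        ← setLIntegral_indicator hUm.compl]
    rw [h1]
    refine hS.setLIntegral_mono fun x hx => ?_
    set E := (G.cubeAt ℓ x).toSet with hE
    have hEm : MeasurableSet E := (G.cubeAt ℓ x).measurableSet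
    have hbc : ∀ y ∈ E, b y = b x := fun y hy => by
      simp only [b, G.cubeAt_eq (G.mem_cubeAt.1 hy)]
    have h2 : ∫⁻ y in E, b y = b x * volume E := by
      rw [setLIntegral_congr_fun hEm hbc, setLIntegral_const]
    have h3 : ∫⁻ y in E, 2 * Uᶜ.indicator b y = 2 * (b x * volume (E \ U)) := by
      rw [lintegral_const_mul _ (hb.indicator hUm.compl), setLIntegral_indicator hUm.compl,
        Set.inter_comm, ← Set.sdiff_eq, setLIntegral_congr_fun (hEm.diff hUm)
          (fun y hy => hbc y hy.1), setLIntegral_const]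
    rw [h2, h3, mul_left_comm]
    gcongr
    have h4 : volume (E ∩ U) ≤ 2⁻¹ * volume E := by
      refine (measure_mono ?_).trans (hA G w hw ℓ N hℓN x)
      rintro y ⟨hyE, hyU⟩
      obtain ⟨k, hk⟩ := Set.mem_iUnion.1 hyU
      refine ⟨hyE, ?_⟩
      have h5 : b y < gridMax μ G r w ℓ N y :=
        hk.2.1.2.2.trans_le (gridMax_mono_right ℓ hk.2.1.2.1 y)
      rwa [hbc y hyE] at h5
    have h5 : volume E = volume (E ∩ U) + volume (E \ U) :=
      (measure_inter_add_sdiff E hUm).symm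
    have hEt : volume E ≠ ∞ := (G.cubeAt ℓ x).volume_ne_top
    have h6 : 2⁻¹ * volume E ≤ volume (E \ U) := by
      have h7 : 2⁻¹ * volume E + 2⁻¹ * volume E ≤ 2⁻¹ * volume E + volume (E \ U) := by
        rw [← add_mul, ENNReal.inv_two_add_inv_two, one_mul]
        nth_rewrite 1 [h5]
        gcongr
      exact (ENNReal.add_le_add_iff_left (ENNReal.mul_ne_top (by norm_num) hEt)).1 h7
    calc volume E = 2 * (2⁻¹ * volume E) := by
          rw [← mul_assoc, ENNReal.mul_inv_cancel (by norm_num) (by norm_num), one_mul]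
      _ ≤ 2 * volume (E \ U) := by gcongr
  have hSm := hS.measurableSet
  have hsplit : ∀ f : (Fin d → ℝ) → ℝ≥0∞,
      ∫⁻ y in S, f y = (∫⁻ y in U, f y) + ∫⁻ y in S \ U, f y := by
    intro f
    rw [← lintegral_inter_add_sdiff f S hUm, Set.inter_eq_self_of_subset_right hUS]
  calc ∫⁻ y in S, gridMax μ G r w ℓ N y
      ≤ ((∫⁻ y in U, b y) + ((2 * A : ℝ≥0) : ℝ≥0∞) * ∫⁻ y in U, M y) + ∫⁻ y in S \ U, b y := by
        rw [hsplit]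
        exact add_le_add hU_le (setLIntegral_mono' (hSm.diff hUm) fun y hy =>
          hnotU y hy.1 hy.2)
    _ = (∫⁻ y in S, b y) + ((2 * A : ℝ≥0) : ℝ≥0∞) * ∫⁻ y in U, M y := by
        rw [hsplit b]
        ring
    _ ≤ ((2 * A : ℝ≥0) : ℝ≥0∞) * (∫⁻ y in S \ U, M y) +
          ((2 * A : ℝ≥0) : ℝ≥0∞) * ∫⁻ y in U, M y := by
        gcongr
        refine hhalf.trans ?_
        rw [ENNReal.coe_mul, mul_assoc, ← lintegral_const_mul' _ _ ENNReal.coe_ne_top]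
        exact mul_le_mul_right (lintegral_mono fun y => hbM y) _
    _ = ((2 * A : ℝ≥0) : ℝ≥0∞) * ∫⁻ y in S, M y := by
        rw [hsplit M]
        ring

end OneGrid

/-! ### From dyadic grids to all cubes -/

section AllCubes

variable {d n : ℕ}

/-- The one-third trick in one dimension: endpoints of the two translated grids of side
`S / 2 ^ k` are at distance at least `S / 2 ^ k / 3`, so a half-open interval of at most that length
does not meet endpoints of both. -/
theorem exists_shift_floor_eq {S c s : ℝ} (hS : 0 < S) (k : ℕ) (hs : s ≤ S / 2 ^ k / 3) :
    ∃ b : Bool, ∀ x ∈ Set.Ico c (c + s), ∀ y ∈ Set.Ico c (c + s),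
      ⌊(x - if b then S / 3 else 0) / (S / 2 ^ k)⌋ =
        ⌊(y - if b then S / 3 else 0) / (S / 2 ^ k)⌋ := by
  set L := S / 2 ^ k with hL
  have hL0 : 0 < L := by positivity
  have key : ∀ t : ℝ, (¬ ∀ x ∈ Set.Ico c (c + s), ∀ y ∈ Set.Ico c (c + s),
      ⌊(x - t) / L⌋ = ⌊(y - t) / L⌋) → ∃ a : ℤ, c < t + a * L ∧ t + a * L < c + s := by
    intro t h
    push Not at h
    obtain ⟨x, hx, y, hy, hne⟩ := h
    wlog hlt : ⌊(x - t) / L⌋ < ⌊(y - t) / L⌋ generalizing x y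
    · exact this y hy x hx hne.symm (lt_of_le_of_ne (not_lt.1 hlt) hne.symm)
    refine ⟨⌊(y - t) / L⌋, ?_, ?_⟩
    · have h1 := Int.floor_lt.1 hlt
      rw [div_lt_iff₀ hL0] at h1
      linarith [hx.1]
    · have h1 := Int.floor_le ((y - t) / L)
      rw [le_div_iff₀ hL0] at h1
      linarith [hy.2]
  by_contra hcon
  push Not at hcon
  obtain ⟨a, ha1, ha2⟩ := key 0 (by
    have := hcon false
    push Not
    simpa using this)
  obtain ⟨b, hb1, hb2⟩ := key (S / 3) (by
    have := hcon true
    push Not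
    simpa using this)
  have hSL : S = 2 ^ k * L := by rw [hL]; field_simp
  have h1 : |((2 ^ k + 3 * (b - a) : ℤ) : ℝ)| < 1 := by
    rw [abs_lt]
    push_cast
    constructor <;> · rw [hSL] at hb1 hb2; nlinarith
  have h2 : (2 ^ k + 3 * (b - a) : ℤ) = 0 := by
    rw [← Int.abs_lt_one_iff]
    exact_mod_cast h1
  have h3 : (3 : ℤ) ∣ 2 ^ k := ⟨a - b, by linarith⟩
  have h4 := Int.prime_three.dvd_of_dvd_pow h3
  norm_num at h4

/-- The translated grids with coarsest scale `S` used in the one-third trick. -/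
def shiftedGrid {S : ℝ} (hS : 0 < S) (α : Fin d → Bool) : DyadicGrid d where
  origin i := if α i then S / 3 else 0
  side := S
  side_pos := hS

/-- The one-third trick: a cube is contained in a cube of comparable size of one of the `2 ^ d`
translated grids. -/
theorem exists_subset_cubeAt {S : ℝ} (hS : 0 < S) (Q : Cube d) (hQ : Q.side ≤ S / 3) :
    ∃ k, ∃ α : Fin d → Bool, ∀ x ∈ Q.toSet, Q.toSet ⊆ ((shiftedGrid hS α).cubeAt k x).toSet ∧
      volume ((shiftedGrid hS α).cubeAt k x).toSet ≤ 6 ^ d * volume Q.toSet := by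
  have hs := Q.side_pos
  obtain ⟨k, hk1, hk2⟩ := exists_nat_pow_near (x := S / (3 * Q.side)) (y := 2)
    (by rw [le_div_iff₀ (by positivity)]; linarith) one_lt_two
  rw [le_div_iff₀ (by positivity)] at hk1
  rw [div_lt_iff₀ (by positivity), pow_succ] at hk2
  have h1 : Q.side ≤ S / 2 ^ k / 3 := by
    rw [le_div_iff₀ (by norm_num), le_div_iff₀ (by positivity)]
    linarith
  have h2 : S / 2 ^ k ≤ 6 * Q.side := by
    rw [div_le_iff₀ (by positivity)]
    linarith
  choose α hα using fun i => exists_shift_floor_eq (c := Q.corner i) hS k h1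
  refine ⟨k, α, fun x hx => ⟨fun y hy => ?_, ?_⟩⟩
  · refine (DyadicGrid.mem_cubeAt _).2 (funext fun i => ?_)
    exact hα i (y i) (hy i (Set.mem_univ i)) (x i) (hx i (Set.mem_univ i))
  · rw [Cube.volume_toSet, Cube.volume_toSet, ← mul_pow]
    refine pow_le_pow_left' ?_ _
    rw [show (6 : ℝ≥0∞) = ENNReal.ofReal 6 by simp, ← ENNReal.ofReal_mul (by norm_num)]
    exact ENNReal.ofReal_le_ofReal h2

/-- Countably many cubes suffice to control averages over all cubes. -/
theorem exists_countable_cubes (d : ℕ) : ∃ R : ℕ → Cube d, ∀ Q : Cube d, ∃ i,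
    Q.toSet ⊆ (R i).toSet ∧ volume (R i).toSet ≤ 2 ^ d * volume Q.toSet := by
  have : Nonempty ((Fin d → ℚ) × {q : ℚ // 0 < q}) := ⟨⟨fun _ => 0, ⟨1, one_pos⟩⟩⟩
  obtain ⟨e, he⟩ := exists_surjective_nat ((Fin d → ℚ) × {q : ℚ // 0 < q})
  refine ⟨fun i => ⟨fun l => (e i).1 l, (e i).2, by exact_mod_cast (e i).2.2⟩, fun Q => ?_⟩
  have hs := Q.side_pos
  choose a ha1 ha2 using fun l => exists_rat_btwn
    (show Q.corner l - Q.side / 4 < Q.corner l by linarith)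
  obtain ⟨b, hb1, hb2⟩ := exists_rat_btwn (show 3 / 2 * Q.side < 2 * Q.side by linarith)
  have hb0 : 0 < b := by
    have : (0 : ℝ) < b := by linarith
    exact_mod_cast this
  obtain ⟨i, hi⟩ := he ⟨a, ⟨b, hb0⟩⟩
  refine ⟨i, fun y hy l hl => ?_, ?_⟩
  · have h1 := hy l hl
    simp only [hi, Set.mem_Ico] at h1 ⊢
    constructor <;> linarith [ha1 l, ha2 l, h1.1, h1.2]
  · rw [Cube.volume_toSet, Cube.volume_toSet, ← mul_pow]
    refine pow_le_pow_left' ?_ _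
    rw [show (2 : ℝ≥0∞) = ENNReal.ofReal 2 by simp, ← ENNReal.ofReal_mul (by norm_num)]
    refine ENNReal.ofReal_le_ofReal ?_
    simp only [hi]
    exact hb2.le

theorem prod_cubeAverage_le_of_subset {r : Fin n → ℝ} (hr : ∀ j, 0 < r j)
    (u : Fin n → (Fin d → ℝ) → ℝ≥0∞) {Q Q' : Cube d} (h : Q.toSet ⊆ Q'.toSet) {c : ℝ≥0∞}
    (hc : volume Q'.toSet ≤ c * volume Q.toSet) :
    ∏ j, cubeAverage (r j) (u j) Q ≤
      (∏ j, c ^ (1 / r j)) * ∏ j, cubeAverage (r j) (u j) Q' := by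
  rw [← Finset.prod_mul_distrib]
  exact Finset.prod_le_prod' fun j _ => cubeAverage_le_of_subset (hr j) (u j) h hc

theorem prod_rpow_ne_top {r : Fin n → ℝ} (hr : ∀ j, 0 < r j) {c : ℝ≥0∞} (hc : c ≠ ∞) :
    ∏ j, c ^ (1 / r j) ≠ ∞ :=
  ENNReal.prod_ne_top fun j _ =>
    (ENNReal.rpow_lt_top_of_nonneg (by have := hr j; positivity) hc).ne

theorem measurable_maximalOperator_finset (𝒟 : Finset (Cube d)) (r : Fin n → ℝ)
    (u : Fin n → (Fin d → ℝ) → ℝ≥0∞) :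
    Measurable (maximalOperator (𝒟 : Set (Cube d)) r u) :=
  Measurable.biSup _ 𝒟.countable_toSet fun Q _ => measurable_const.indicator Q.measurableSet

variable {Ω : Type*} [MeasurableSpace Ω] {μ : Measure Ω} {ρ : Fin n → FunctionNorm Ω}
  {r : Fin n → ℝ}

/-- The dyadic estimates for the translated grids dominate finite collections of cubes, with a
constant that does not depend on the collection. -/
theorem exists_lintegral_finset_le [SigmaFinite μ] (h : IsMaximalTuple d μ ρ r) :
    ∃ A : ℝ≥0, ∀ w : Fin n → SimpleFunc (Fin d → ℝ) (Ω → ℝ≥0), IsAdmissible μ ρ w →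
      ∀ 𝒟 : Finset (Cube d),
        ∫⁻ x, ∫⁻ ω, maximalOperator (𝒟 : Set (Cube d)) r (fun j y => (w j y ω : ℝ≥0∞)) x ∂μ ≤
          A * ∫⁻ x, maximalOperator Set.univ r (fun j => normFun (ρ j) (w j)) x := by
  classical
  obtain ⟨A, hA⟩ := exists_setLIntegral_gridMax_le h
  set C : ℝ≥0∞ := ∏ j, ((6 : ℝ≥0∞) ^ d) ^ (1 / r j) with hC
  have hCt : C ≠ ∞ := prod_rpow_ne_top h.pos (by finiteness)
  refine ⟨C.toNNReal * ((Fintype.card (Fin d → Bool) : ℝ≥0) * A), fun w hw 𝒟 => ?_⟩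
  set M := ∫⁻ x, maximalOperator Set.univ r (fun j => normFun (ρ j) (w j)) x with hM
  -- finitely many cubes have bounded sides, so one coarsest scale serves them all
  obtain ⟨S, hS, hS𝒟⟩ : ∃ S : ℝ, 0 < S ∧ ∀ Q ∈ 𝒟, Q.side ≤ S / 3 := by
    obtain ⟨b, hb⟩ := (𝒟.image Cube.side).bddAbove
    refine ⟨3 * max b 1, by positivity, fun Q hQ => ?_⟩
    have h1 : Q.side ≤ b := hb (Finset.mem_coe.2 (Finset.mem_image_of_mem _ hQ))
    rw [mul_div_cancel_left₀ _ (by norm_num)]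
    exact h1.trans (le_max_left _ _)
  have hex : ∀ Q : Cube d, ∃ k, Q ∈ 𝒟 → ∃ α : Fin d → Bool, ∀ x ∈ Q.toSet,
      Q.toSet ⊆ ((shiftedGrid hS α).cubeAt k x).toSet ∧
      volume ((shiftedGrid hS α).cubeAt k x).toSet ≤ 6 ^ d * volume Q.toSet := by
    intro Q
    by_cases hQ : Q ∈ 𝒟
    · obtain ⟨k, hk⟩ := exists_subset_cubeAt hS Q (hS𝒟 Q hQ)
      exact ⟨k, fun _ => hk⟩
    · exact ⟨0, fun h => absurd h hQ⟩
  choose k hk using hex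
  set N := 𝒟.sup k with hN
  have hkN : ∀ Q ∈ 𝒟, k Q ≤ N := fun Q hQ => Finset.le_sup hQ
  have hpt : ∀ x ω, maximalOperator (𝒟 : Set (Cube d)) r (fun j y => (w j y ω : ℝ≥0∞)) x ≤
      C * ∑ α : Fin d → Bool, ⨆ i ∈ Finset.Icc 0 N,
        latticeProd r w ((shiftedGrid hS α).cubeAt i x) ω := by
    intro x ω
    refine iSup₂_le fun Q hQ => ?_
    by_cases hx : x ∈ Q.toSet
    · rw [Set.indicator_of_mem hx]
      obtain ⟨α, hα⟩ := hk Q hQ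
      obtain ⟨h1, h2⟩ := hα x hx
      refine (prod_cubeAverage_le_of_subset h.pos _ h1 h2).trans (mul_le_mul_right ?_ _)
      refine le_trans ?_ (Finset.single_le_sum (f := fun α : Fin d → Bool =>
        ⨆ i ∈ Finset.Icc 0 N, latticeProd r w ((shiftedGrid hS α).cubeAt i x) ω)
        (fun _ _ => zero_le) (Finset.mem_univ α))
      exact le_iSup₂_of_le (f := fun i (_ : i ∈ Finset.Icc 0 N) =>
        latticeProd r w ((shiftedGrid hS α).cubeAt i x) ω) (k Q)
        (Finset.mem_Icc.2 ⟨Nat.zero_le _, hkN Q hQ⟩) le_rfl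
    · rw [Set.indicator_of_notMem hx]
      exact zero_le
  have hmeas : ∀ (α : Fin d → Bool) x, AEMeasurable (fun ω => ⨆ i ∈ Finset.Icc 0 N,
      latticeProd r w ((shiftedGrid hS α).cubeAt i x) ω) μ := fun α x =>
    AEMeasurable.biSup _ (Finset.countable_toSet _) fun i _ =>
      Finset.aemeasurable_fun_prod _ fun j _ =>
        aemeasurable_latticeAverage (r j) (fun y => (hw j y).1) _
  calc ∫⁻ x, ∫⁻ ω, maximalOperator (𝒟 : Set (Cube d)) r (fun j y => (w j y ω : ℝ≥0∞)) x ∂μ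
      ≤ ∫⁻ x, C * ∑ α : Fin d → Bool, gridMax μ (shiftedGrid hS α) r w 0 N x := by
        refine lintegral_mono fun x => (lintegral_mono fun ω => hpt x ω).trans (le_of_eq ?_)
        rw [lintegral_const_mul' _ _ hCt, lintegral_finsetSum' _ fun α _ => hmeas α x]
        rfl
    _ = C * ∑ α : Fin d → Bool, ∫⁻ x, gridMax μ (shiftedGrid hS α) r w 0 N x := by
        rw [lintegral_const_mul' _ _ hCt, lintegral_finsetSum]
        exact fun α _ => (shiftedGrid hS α).measurable_of_index fun y z hyz =>
          gridMax_congr 0 hyz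
    _ ≤ C * ∑ _α : Fin d → Bool, A * M := by
        gcongr with α _
        have := hA (shiftedGrid hS α) w hw N 0 (Nat.zero_le _) Set.univ
          fun _ _ _ _ => Set.mem_univ _
        simpa only [Measure.restrict_univ] using this
    _ = _ := by
        rw [Finset.sum_const, Finset.card_univ, nsmul_eq_mul]
        push_cast
        rw [ENNReal.coe_toNNReal hCt]
        ring

/-- The `L¹` estimate for the lattice maximal operator over all cubes: it is dominated by the scalar
maximal operator applied to the norms. -/
theorem exists_lintegral_maximalOperator_le [SigmaFinite μ] (h : IsMaximalTuple d μ ρ r) :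
    ∃ A : ℝ≥0, ∀ w : Fin n → SimpleFunc (Fin d → ℝ) (Ω → ℝ≥0), IsAdmissible μ ρ w →
        ∫⁻ ω, (∫⁻ x, maximalOperator Set.univ r (fun j y => (w j y ω : ℝ≥0∞)) x) ∂μ ≤
          A * ∫⁻ x, maximalOperator Set.univ r (fun j => normFun (ρ j) (w j)) x := by
  classical
  obtain ⟨A, hA⟩ := exists_lintegral_finset_le h
  obtain ⟨R, hR⟩ := exists_countable_cubes d
  set C : ℝ≥0∞ := ∏ j, ((2 : ℝ≥0∞) ^ d) ^ (1 / r j) with hC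
  have hCt : C ≠ ∞ := prod_rpow_ne_top h.pos (by finiteness)
  refine ⟨C.toNNReal * A, fun w hw => ?_⟩
  set M := ∫⁻ x, maximalOperator Set.univ r (fun j => normFun (ρ j) (w j)) x with hM
  let 𝒟 : ℕ → Finset (Cube d) := fun N => (Finset.range N).image R
  have h𝒟 : Monotone 𝒟 := fun a b hab => Finset.image_subset_image (Finset.range_mono hab)
  let m : ℕ → (Fin d → ℝ) → Ω → ℝ≥0∞ := fun N x ω =>
    maximalOperator (𝒟 N : Set (Cube d)) r (fun j y => (w j y ω : ℝ≥0∞)) x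
  have hmono : ∀ x ω, Monotone fun N => m N x ω := fun x ω a b hab =>
    biSup_mono fun Q hQ => h𝒟 hab hQ
  have hjoint : ∀ N, AEMeasurable (fun z : (Fin d → ℝ) × Ω => m N z.1 z.2)
      ((volume : Measure (Fin d → ℝ)).prod μ) := fun N =>
    aemeasurable_maximalOperator (𝒟 N) r fun j y => (hw j y).1
  have hpt : ∀ x ω, maximalOperator Set.univ r (fun j y => (w j y ω : ℝ≥0∞)) x ≤
      C * ⨆ N, m N x ω := by
    intro x ω
    refine iSup₂_le fun Q _ => ?_
    by_cases hx : x ∈ Q.toSet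
    · rw [Set.indicator_of_mem hx]
      obtain ⟨i, h1, h2⟩ := hR Q
      refine (prod_cubeAverage_le_of_subset h.pos _ h1 h2).trans (mul_le_mul_right ?_ _)
      refine le_iSup_of_le (i + 1) ?_
      refine le_iSup₂_of_le (f := fun (Q : Cube d) (_ : Q ∈ (𝒟 (i + 1) : Set (Cube d))) =>
        Q.toSet.indicator (fun _ => ∏ j, cubeAverage (r j) (fun y => (w j y ω : ℝ≥0∞)) Q) x)
        (R i) ?_ ?_
      · exact Finset.mem_coe.2 (Finset.mem_image_of_mem _ (Finset.self_mem_range_succ i))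
      · rw [Set.indicator_of_mem (h1 hx)]
    · rw [Set.indicator_of_notMem hx]
      exact zero_le
  calc ∫⁻ ω, (∫⁻ x, maximalOperator Set.univ r (fun j y => (w j y ω : ℝ≥0∞)) x) ∂μ
      ≤ ∫⁻ ω, (∫⁻ x, C * ⨆ N, m N x ω) ∂μ :=
        lintegral_mono fun ω => lintegral_mono fun x => hpt x ω
    _ = C * ∫⁻ ω, (⨆ N, ∫⁻ x, m N x ω) ∂μ := by
        rw [← lintegral_const_mul' _ _ hCt]
        refine lintegral_congr fun ω => ?_
        rw [lintegral_const_mul' _ _ hCt, lintegral_iSup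
          (fun N => measurable_maximalOperator_finset (𝒟 N) r _) fun a b hab x => hmono x ω hab]
    _ = C * ⨆ N, ∫⁻ x, ∫⁻ ω, m N x ω ∂μ := by
        rw [lintegral_iSup' (fun N => ?_) (Eventually.of_forall fun ω a b hab =>
          lintegral_mono fun x => hmono x ω hab)]
        · congr 1
          refine iSup_congr fun N => ?_
          exact (lintegral_lintegral_swap (hjoint N)).symm
        · exact (hjoint N).prod_swap.lintegral_prod_right'
    _ ≤ C * (A * M) := by
        gcongr
        exact iSup_le fun N => hA w hw (𝒟 N)
    _ = _ := by
        push_cast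
        rw [ENNReal.coe_toNNReal hCt, mul_assoc]

end AllCubes

/-! ### Rescaling -/

section Rescaling

theorem cubeAverage_rpow {d : ℕ} {q : ℝ} (hq : 0 < q) (r : ℝ) (u : (Fin d → ℝ) → ℝ≥0∞)
    (Q : Cube d) : cubeAverage (r / q) (fun x => u x ^ q) Q = cubeAverage r u Q ^ q := by
  rw [cubeAverage_eq_mean, cubeAverage_eq_mean, ← ENNReal.rpow_mul]
  congr 1
  · simp only [← ENNReal.rpow_mul, mul_div_cancel₀ _ hq.ne']
  · rw [one_div_div]
    ring

theorem maximalOperator_rpow {d n : ℕ} {q : ℝ} (hq : 0 < q) (𝒟 : Set (Cube d)) (r : Fin n → ℝ)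
    (u : Fin n → (Fin d → ℝ) → ℝ≥0∞) (x : Fin d → ℝ) :
    maximalOperator 𝒟 (fun j => r j / q) (fun j y => u j y ^ q) x =
      maximalOperator 𝒟 r u x ^ q := by
  have h1 : ∀ a : ℝ≥0∞, a ^ q = ENNReal.orderIsoRpow q hq a := fun _ => rfl
  rw [maximalOperator, maximalOperator, h1, OrderIso.map_iSup]
  refine iSup_congr fun Q => ?_
  rw [OrderIso.map_iSup]
  refine iSup_congr fun _ => ?_
  rw [← h1]
  by_cases hx : x ∈ Q.toSet
  · rw [Set.indicator_of_mem hx, Set.indicator_of_mem hx, ← ENNReal.prod_rpow_of_nonneg hq.le]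
    exact Finset.prod_congr rfl fun j _ => cubeAverage_rpow hq _ _ _
  · rw [Set.indicator_of_notMem hx, Set.indicator_of_notMem hx, ENNReal.zero_rpow_of_pos hq]

theorem maximalOperator_mono_ae {d n : ℕ} {𝒟 : Set (Cube d)} {r : Fin n → ℝ} (hr : ∀ j, 0 < r j)
    {u v : Fin n → (Fin d → ℝ) → ℝ≥0∞} (h : ∀ j, ∀ᵐ y, u j y ≤ v j y) (x : Fin d → ℝ) :
    maximalOperator 𝒟 r u x ≤ maximalOperator 𝒟 r v x := by
  refine iSup₂_mono fun Q _ => ?_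
  refine Set.indicator_le_indicator (Finset.prod_le_prod' fun j _ => ?_)
  have hj := hr j
  refine ENNReal.rpow_le_rpow (mul_le_mul_right (lintegral_mono_ae ?_) _) (by positivity)
  filter_upwards [ae_restrict_of_ae (h j)] with y hy
  exact ENNReal.rpow_le_rpow hy hj.le

variable {q : ℝ} {s : ℝ≥0∞}

theorem inv_toReal_lt (hq : 0 < q) (hs : ENNReal.ofReal q < s) : (s⁻¹).toReal < 1 / q := by
  rcases eq_or_ne s ∞ with rfl | hst
  · simpa using hq
  · rw [ENNReal.toReal_inv, one_div]
    exact inv_strictAnti₀ hq ((ENNReal.ofReal_lt_iff_lt_toReal hq.le hst).1 hs)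

theorem conjExponent_div (hq : 0 < q) :
    conjExponent (s / ENNReal.ofReal q) = 1 / (1 / q - (s⁻¹).toReal) / q := by
  have hq' : ENNReal.ofReal q ≠ 0 := by simpa using hq
  have h1 : ((s / ENNReal.ofReal q)⁻¹).toReal = q * (s⁻¹).toReal := by
    rw [ENNReal.inv_div (Or.inl ENNReal.ofReal_ne_top) (Or.inl hq'), div_eq_mul_inv,
      ENNReal.toReal_mul, ENNReal.toReal_ofReal hq.le]
  rw [conjExponent, h1, div_div, one_div (_ * q), sub_mul, one_div_mul_cancel hq.ne', mul_comm q]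

theorem sparseBound_rpow {d m : ℕ} (hq : 0 < q) (r : Fin m → ℝ)
    (u : Fin m → (Fin d → ℝ) → ℝ≥0∞) (v : (Fin d → ℝ) → ℝ≥0∞) :
    sparseBound r q s u v ^ q = ∫⁻ x, maximalOperator Set.univ
      (Fin.snoc (α := fun _ => ℝ) (fun j => r j / q) (conjExponent (s / ENNReal.ofReal q)))
      (Fin.snoc (α := fun _ => (Fin d → ℝ) → ℝ≥0∞) (fun j y => u j y ^ q) (fun y => v y ^ q)) x := by
  have hq' : ENNReal.ofReal q ≠ 0 := by simpa using hq
  rw [sparseBound, eLpNorm_eq_lintegral_rpow_enorm_toReal hq' ENNReal.ofReal_ne_top,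
    ENNReal.toReal_ofReal hq.le, ← ENNReal.rpow_mul, one_div_mul_cancel hq.ne', ENNReal.rpow_one]
  refine lintegral_congr fun x => ?_
  rw [enorm_eq_self, ← maximalOperator_rpow hq]
  congr 1
  · funext j
    refine Fin.lastCases ?_ (fun j => ?_) j
    · simp only [Fin.snoc_last]
      rw [conjExponent_div hq]
    · simp only [Fin.snoc_castSucc]
  · funext j
    refine Fin.lastCases ?_ (fun j => ?_) j
    · simp only [Fin.snoc_last]
    · simp only [Fin.snoc_castSucc]

variable {Ω : Type*}

theorem concavification_rpow (hq : 0 < q) (ρ : FunctionNorm Ω) (u : Ω → ℝ≥0∞) :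
    concavification ρ q (fun ω => u ω ^ q) = ρ u ^ q := by
  simp only [concavification, ← ENNReal.rpow_mul, mul_one_div_cancel hq.ne', ENNReal.rpow_one]

variable [MeasurableSpace Ω] {μ : Measure Ω}

theorem productNorm_concavification_rpow {m : ℕ} (hq : 0 < q) (X : Fin m → FunctionNorm Ω)
    (u : Ω → ℝ≥0∞) :
    productNorm μ (fun j => concavification (X j) q) (fun ω => u ω ^ q) =
      productNorm μ X u ^ q := by
  refine le_antisymm ?_ ?_
  · have h1 : ∀ a : ℝ≥0∞, a ^ q = ENNReal.orderIsoRpow q hq a := fun _ => rfl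
    simp only [productNorm, h1, OrderIso.map_iInf]
    simp only [← h1]
    refine le_iInf fun v => le_iInf fun hv => le_iInf fun huv => ?_
    refine iInf_le_of_le (fun j ω => v j ω ^ q) (iInf₂_le_of_le (fun j => ⟨?_, ?_⟩) ?_ ?_)
    · exact (hv j).1.pow_const _
    · rw [concavification_rpow hq]
      exact ENNReal.rpow_lt_top_of_nonneg hq.le (hv j).2.ne
    · filter_upwards [huv] with ω hω
      rw [ENNReal.prod_rpow_of_nonneg hq.le]
      exact ENNReal.rpow_le_rpow hω hq.le
    · rw [← ENNReal.prod_rpow_of_nonneg hq.le]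
      exact le_of_eq (Finset.prod_congr rfl fun j _ => concavification_rpow hq _ _)
  · refine le_iInf fun v => le_iInf fun hv => le_iInf fun huv => ?_
    have h2 : ∀ j, X j (fun ω => v j ω ^ (1 / q)) ^ q = concavification (X j) q (v j) :=
      fun j => rfl
    have h3 : productNorm μ X u ≤ ∏ j, X j (fun ω => v j ω ^ (1 / q)) := by
      refine iInf_le_of_le (fun j ω => v j ω ^ (1 / q)) (iInf₂_le_of_le (fun j => ⟨?_, ?_⟩) ?_ le_rfl)
      · exact (hv j).1.pow_const _
      · have : concavification (X j) q (v j) < ∞ := (hv j).2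
        rw [← h2] at this
        exact (ENNReal.rpow_lt_top_iff_of_pos hq).1 this
      · filter_upwards [huv] with ω hω
        rw [ENNReal.prod_rpow_of_nonneg (by positivity), ← ENNReal.rpow_le_rpow_iff hq,
          ← ENNReal.rpow_mul, one_div_mul_cancel hq.ne', ENNReal.rpow_one]
        exact hω
    refine (ENNReal.rpow_le_rpow h3 hq.le).trans ?_
    rw [← ENNReal.prod_rpow_of_nonneg hq.le]
    exact le_rfl

theorem concavification_zero (hq : 0 < q) {ρ : FunctionNorm Ω}
    (hρ : IsQuasiBanachFunctionSpace μ ρ) : concavification ρ q (fun _ => 0) = 0 := by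
  have : concavification ρ q (fun _ => 0) = ρ (fun _ => 0) ^ q := by
    rw [← concavification_rpow hq]
    simp [ENNReal.zero_rpow_of_pos hq]
  rw [this, hρ.zero, ENNReal.zero_rpow_of_pos hq]

theorem concavification_smul (hq : 0 < q) {ρ : FunctionNorm Ω}
    (hρ : IsQuasiBanachFunctionSpace μ ρ) (c : ℝ≥0) (u : Ω → ℝ≥0∞) (hu : AEMeasurable u μ) :
    concavification ρ q (fun ω => (c : ℝ≥0∞) * u ω) = c * concavification ρ q u := by
  have h1 : (fun ω => ((c : ℝ≥0∞) * u ω) ^ (1 / q)) =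
      fun ω => ((c ^ (1 / q) : ℝ≥0) : ℝ≥0∞) * u ω ^ (1 / q) := by
    funext ω
    rw [ENNReal.mul_rpow_of_nonneg _ _ (by positivity), ENNReal.coe_rpow_of_nonneg _ (by positivity)]
  rw [concavification, h1, hρ.smul _ _ (hu.pow_const _), ENNReal.mul_rpow_of_nonneg _ _ hq.le,
    ← ENNReal.coe_rpow_of_nonneg _ hq.le, ← NNReal.rpow_mul, one_div_mul_cancel hq.ne',
    NNReal.rpow_one]
  rfl

/-! ### The tuple obtained by adding the dual space -/

theorem dualNorm_zero (N : FunctionNorm Ω) : dualNorm μ N (fun _ => 0) = 0 := by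
  simp [dualNorm]

theorem dualNorm_smul (N : FunctionNorm Ω) (c : ℝ≥0) (u : Ω → ℝ≥0∞) :
    dualNorm μ N (fun ω => (c : ℝ≥0∞) * u ω) = c * dualNorm μ N u := by
  simp only [dualNorm, ENNReal.mul_iSup, mul_assoc]
  exact iSup_congr fun v => iSup_congr fun _ => lintegral_const_mul' _ _ ENNReal.coe_ne_top

theorem lintegral_mul_le_of_dualNorm_le_one {N : FunctionNorm Ω}
    (hN : IsQuasiBanachFunctionSpace μ N) {a b : Ω → ℝ≥0∞} (ha : AEMeasurable a μ)
    (hb : dualNorm μ N b ≤ 1) : ∫⁻ ω, a ω * b ω ∂μ ≤ N a := by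
  rcases eq_or_ne (N a) ∞ with h | h
  · rw [h]
    exact le_top
  · exact (lintegral_mul_le_mul_dualNorm hN ha h.lt_top).trans (mul_le_of_le_one_right zero_le hb)

/-- The product of a tuple and the dual of its product embeds contractively into `L¹(Ω)`, by
Hölder's inequality. -/
theorem lintegral_le_productNorm_snoc {m : ℕ} {Y : Fin m → FunctionNorm Ω}
    (hY : IsQuasiBanachFunctionSpace μ (productNorm μ Y)) (u : Ω → ℝ≥0∞) :
    ∫⁻ ω, u ω ∂μ ≤ productNorm μ
      (Fin.snoc (α := fun _ => FunctionNorm Ω) Y (dualNorm μ (productNorm μ Y))) u := by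
  refine le_iInf fun v => le_iInf fun hv => le_iInf fun huv => ?_
  have hv1 : ∀ j : Fin m, AEMeasurable (v j.castSucc) μ ∧ Y j (v j.castSucc) < ∞ := by
    intro j
    simpa only [Fin.snoc_castSucc] using hv j.castSucc
  set a : Ω → ℝ≥0∞ := fun ω => ∏ j : Fin m, v j.castSucc ω with ha
  have ham : AEMeasurable a μ := Finset.aemeasurable_fun_prod _ fun j _ => (hv1 j).1
  have hpa : productNorm μ Y a ≤ ∏ j : Fin m, Y j (v j.castSucc) :=
    iInf_le_of_le (fun j => v j.castSucc) (iInf₂_le_of_le hv1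
      (Eventually.of_forall fun ω => le_rfl) le_rfl)
  have hat : productNorm μ Y a < ∞ :=
    hpa.trans_lt (ENNReal.prod_lt_top fun j _ => (hv1 j).2)
  rw [Fin.prod_univ_castSucc]
  simp only [Fin.snoc_castSucc, Fin.snoc_last]
  calc ∫⁻ ω, u ω ∂μ ≤ ∫⁻ ω, a ω * v (Fin.last m) ω ∂μ := by
        refine lintegral_mono_ae ?_
        filter_upwards [huv] with ω hω
        rwa [Fin.prod_univ_castSucc] at hω
    _ ≤ _ := (lintegral_mul_le_mul_dualNorm hY ham hat).trans (mul_le_mul_left hpa _)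

/-- The tuple `(X₁ ^ q, …, X_m ^ q, X*)`, where `X*` is the dual of the product of the
`X_j ^ q`. -/
theorem isMaximalTuple_of_umdProperty {d m : ℕ} {r : Fin m → ℝ} (hr : ∀ j, 0 < r j) (hq : 0 < q)
    (hs : ENNReal.ofReal q < s) {X : Fin m → FunctionNorm Ω} (hX : IsTuple μ X)
    (hUMD : UMDProperty d μ (fun j => concavification (X j) q) (fun j => r j / q)
      (s / ENNReal.ofReal q)) :
    IsMaximalTuple d μ
      (Fin.snoc (α := fun _ => FunctionNorm Ω) (fun j => concavification (X j) q)
        (dualNorm μ (productNorm μ fun j => concavification (X j) q)))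
      (Fin.snoc (α := fun _ => ℝ) (fun j => r j / q) (conjExponent (s / ENNReal.ofReal q))) where
  pos j := by
    refine Fin.lastCases ?_ (fun j => ?_) j
    · rw [Fin.snoc_last, conjExponent_div hq]
      have := inv_toReal_lt hq hs
      have h2 : 0 < 1 / q - (s⁻¹).toReal := by linarith
      positivity
    · rw [Fin.snoc_castSucc]
      have := hr j
      positivity
  zero j := by
    refine Fin.lastCases ?_ (fun j => ?_) j
    · rw [Fin.snoc_last]
      exact dualNorm_zero _
    · rw [Fin.snoc_castSucc]
      exact concavification_zero hq (hX.1 j)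
  smul j c u hu := by
    refine Fin.lastCases ?_ (fun j => ?_) j
    · rw [Fin.snoc_last]
      exact dualNorm_smul _ c u
    · rw [Fin.snoc_castSucc]
      exact concavification_smul hq (hX.1 j) c u hu
  lintegral_le u := lintegral_le_productNorm_snoc hUMD.2.1.1 u
  hardyLittlewood := hUMD.2.2.2

end Rescaling

/-! ### Linearization of the norm by simple functions -/

theorem add_rpow_le_two_rpow_mul {q : ℝ} (hq : 0 < q) (a b : ℝ≥0∞) :
    (a + b) ^ q ≤ 2 ^ q * (a ^ q + b ^ q) := by
  have h1 : a + b ≤ 2 * max a b := by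
    rw [two_mul]
    exact add_le_add (le_max_left _ _) (le_max_right _ _)
  refine (ENNReal.rpow_le_rpow h1 hq.le).trans ?_
  rw [ENNReal.mul_rpow_of_nonneg _ _ hq.le]
  refine mul_le_mul_right ?_ _
  rcases le_total a b with h | h
  · rw [max_eq_right h]
    exact le_add_self
  · rw [max_eq_left h]
    exact le_self_add

section Linearization

variable {Ω : Type*} [MeasurableSpace Ω] {μ : Measure Ω} {d m : ℕ}

/-- The norm of a strongly measurable function is computed, up to a constant, by pairing with simple
functions with values in the unit ball of the dual: those norming simple approximations. -/
theorem exists_norming_simpleFunc [SigmaFinite μ] {q : ℝ} (hq : 0 < q) {X : Fin m → FunctionNorm Ω}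
    (hN : IsBanachFunctionSpace μ (productNorm μ fun j => concavification (X j) q))
    (hO : IsOrderContinuous μ (productNorm μ fun j => concavification (X j) q))
    {F : (Fin d → ℝ) → Ω → ℂ} (hF : IsStronglyMeasurableInto μ (productNorm μ X) F) :
    ∃ h : ℕ → SimpleFunc (Fin d → ℝ) (Ω → ℝ≥0), (∀ k x, Measurable (h k x)) ∧
      (∀ k x, dualNorm μ (productNorm μ fun j => concavification (X j) q)
        (fun ω => (h k x ω : ℝ≥0∞)) ≤ 1) ∧
      ∀ᵐ x, productNorm μ X (fun ω => ‖F x ω‖ₑ) ^ q ≤ (2 ^ q) ^ 2 *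
        liminf (fun k => ∫⁻ ω, ‖F x ω‖ₑ ^ q * h k x ω ∂μ) atTop := by
  classical
  obtain ⟨hFm, s, hs, hlim⟩ := hF
  set N : FunctionNorm Ω := productNorm μ fun j => concavification (X j) q with hNdef
  set ρ : FunctionNorm Ω := productNorm μ X with hρ
  have hNρ : ∀ u : Ω → ℝ≥0∞, N (fun ω => u ω ^ q) = ρ u ^ q := fun u =>
    productNorm_concavification_rpow hq X u
  have hex : ∀ v : Ω → ℂ, ∃ ψ : Ω → ℝ≥0, Measurable ψ ∧ dualNorm μ N (fun ω => ψ ω) ≤ 1 ∧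
      (MemSpace μ ρ v → ρ (fun ω => ‖v ω‖ₑ) ^ q ≤ ∫⁻ ω, ‖v ω‖ₑ ^ q * ψ ω ∂μ) := by
    intro v
    by_cases hv : MemSpace μ ρ v
    · obtain ⟨ψ, h1, h2, h3⟩ := exists_norming hN hO (hv.1.enorm.pow_const q)
        ((hNρ _).trans_lt (ENNReal.rpow_lt_top_of_nonneg hq.le hv.2.ne))
      exact ⟨ψ, h1, h2, fun _ => (hNρ _).symm.le.trans h3⟩
    · exact ⟨0, measurable_const, by simp [dualNorm_zero], fun h => absurd h hv⟩
  choose ψ hψm hψ1 hψ using hex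
  refine ⟨fun k => (s k).map ψ, fun k x => hψm _, fun k x => hψ1 _, ?_⟩
  have hsec : ∀ᵐ x, AEMeasurable (F x) μ := by
    filter_upwards [Measure.ae_ae_of_ae_prod hFm.ae_eq_mk] with x hx
    exact ⟨fun ω => hFm.mk _ (x, ω), hFm.measurable_mk.comp measurable_prodMk_left, hx⟩
  filter_upwards [hlim, hsec] with x hx hFx
  set e : ℕ → ℝ≥0∞ := fun k => ρ (fun ω => ‖F x ω - s k x ω‖ₑ) with he
  set a : ℕ → ℝ≥0∞ := fun k => ∫⁻ ω, ‖F x ω‖ₑ ^ q * ψ (s k x) ω ∂μ with ha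
  set c : ℝ≥0∞ := 2 ^ q with hc
  have hct : c ≠ ∞ := (ENNReal.rpow_lt_top_of_nonneg hq.le (by norm_num)).ne
  have hcc : ((c.toNNReal : ℝ≥0) : ℝ≥0∞) = c := ENNReal.coe_toNNReal hct
  have hpow : ∀ u v : ℂ, ‖u‖ₑ ^ q ≤ c * (‖v‖ₑ ^ q + ‖u - v‖ₑ ^ q) := by
    intro u v
    refine (ENNReal.rpow_le_rpow ?_ hq.le).trans (add_rpow_le_two_rpow_mul hq _ _)
    calc ‖u‖ₑ = ‖v + (u - v)‖ₑ := by rw [add_sub_cancel]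
      _ ≤ _ := enorm_add_le _ _
  -- pass from `F x` to `s k x`, where the norming function is exact, and back
  have hbound : ∀ k, ρ (fun ω => ‖F x ω‖ₑ) ^ q ≤ c ^ 2 * a k + (c ^ 2 + c) * e k ^ q := by
    intro k
    have hsk := hs k x
    have hm1 : AEMeasurable (fun ω => ‖s k x ω‖ₑ ^ q) μ := hsk.1.enorm.pow_const q
    have hm2 : AEMeasurable (fun ω => ‖F x ω - s k x ω‖ₑ ^ q) μ :=
      (hFx.sub hsk.1).enorm.pow_const q
    have hm12 : AEMeasurable (fun ω => ‖s k x ω‖ₑ ^ q + ‖F x ω - s k x ω‖ₑ ^ q) μ := hm1.add hm2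
    have h1 : ρ (fun ω => ‖F x ω‖ₑ) ^ q ≤ c * (ρ (fun ω => ‖s k x ω‖ₑ) ^ q + e k ^ q) := by
      rw [← hNρ, ← hNρ, he, ← hNρ]
      refine (hN.1.mono _ (fun ω => ((c.toNNReal : ℝ≥0) : ℝ≥0∞) *
        (‖s k x ω‖ₑ ^ q + ‖F x ω - s k x ω‖ₑ ^ q)) (hFx.enorm.pow_const q)
        (hm12.const_mul _) (Eventually.of_forall fun ω => ?_)).trans ?_
      · rw [hcc]
        exact hpow _ _
      · rw [hN.1.smul _ _ hm12, hcc]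
        exact mul_le_mul_right (hN.2 _ _ hm1 hm2) _
    have h2 : ρ (fun ω => ‖s k x ω‖ₑ) ^ q ≤ c * (a k + e k ^ q) := by
      refine (hψ (s k x) hsk).trans ?_
      have hψk : AEMeasurable (fun ω => (ψ (s k x) ω : ℝ≥0∞)) μ :=
        (hψm _).coe_nnreal_ennreal.aemeasurable
      calc ∫⁻ ω, ‖s k x ω‖ₑ ^ q * ψ (s k x) ω ∂μ
          ≤ ∫⁻ ω, c * (‖F x ω‖ₑ ^ q * ψ (s k x) ω +
              ‖F x ω - s k x ω‖ₑ ^ q * ψ (s k x) ω) ∂μ := by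
            refine lintegral_mono fun ω => ?_
            have h3 := hpow (s k x ω) (F x ω)
            rw [enorm_sub_rev] at h3
            calc _ ≤ _ := mul_le_mul_left h3 _
              _ = _ := by ring
        _ = c * (a k + ∫⁻ ω, ‖F x ω - s k x ω‖ₑ ^ q * ψ (s k x) ω ∂μ) := by
            rw [lintegral_const_mul' _ _ hct,
              lintegral_add_left' (f := fun ω => ‖F x ω‖ₑ ^ q * ψ (s k x) ω)
                ((hFx.enorm.pow_const q).mul hψk)]
        _ ≤ c * (a k + e k ^ q) := by
            gcongr
            rw [he, ← hNρ]
            exact lintegral_mul_le_of_dualNorm_le_one hN.1 hm2 (hψ1 _)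
    calc ρ (fun ω => ‖F x ω‖ₑ) ^ q ≤ c * (c * (a k + e k ^ q) + e k ^ q) :=
          h1.trans (by gcongr)
      _ = _ := by ring
  have herr : Tendsto (fun k => (c ^ 2 + c) * e k ^ q) atTop (𝓝 0) := by
    have h1 : Tendsto (fun k => e k ^ q) atTop (𝓝 0) := by
      have := (ENNReal.continuous_rpow_const (y := q)).tendsto 0 |>.comp hx
      rwa [ENNReal.zero_rpow_of_pos hq] at this
    have h2 := ENNReal.Tendsto.const_mul (a := c ^ 2 + c) h1 (Or.inr (by finiteness))
    rwa [mul_zero] at h2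
  calc ρ (fun ω => ‖F x ω‖ₑ) ^ q
      ≤ liminf ((fun k => c ^ 2 * a k) + fun k => (c ^ 2 + c) * e k ^ q) atTop :=
        le_liminf_of_le (by isBoundedDefault) (Eventually.of_forall hbound)
    _ = liminf (fun k => c ^ 2 * a k) atTop := ENNReal.liminf_add_of_right_tendsto_zero herr _
    _ = c ^ 2 * liminf a atTop := ENNReal.liminf_const_mul_of_ne_top (by finiteness)

/-- Simple functions increasing to `|g| ^ q`, supported in the support of `g`. -/
theorem exists_simpleFunc_approx {q : ℝ} (hq : 0 < q) {g : (Fin d → ℝ) → ℂ}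
    (hg : AEStronglyMeasurable g volume) :
    ∃ φ : ℕ → SimpleFunc (Fin d → ℝ) ℝ≥0, (∀ k, ∀ x ∉ tsupport g, φ k x = 0) ∧
      (∀ k, ∀ᵐ x, (φ k x : ℝ≥0∞) ≤ ‖g x‖ₑ ^ q) ∧
      ∀ᵐ x, Tendsto (fun k => (φ k x : ℝ≥0∞)) atTop (𝓝 (‖g x‖ₑ ^ q)) := by
  let G : (Fin d → ℝ) → ℝ≥0∞ := (tsupport g).indicator fun x => ‖hg.mk g x‖ₑ ^ q
  have hG : Measurable G := Measurable.indicator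
    (hg.stronglyMeasurable_mk.measurable.enorm.pow_const q) (isClosed_tsupport g).measurableSet
  have hGg : ∀ᵐ x, G x = ‖g x‖ₑ ^ q := by
    filter_upwards [hg.ae_eq_mk] with x hx
    by_cases h : x ∈ tsupport g
    · simp [G, h, hx]
    · simp [G, h, image_eq_zero_of_notMem_tsupport h, ENNReal.zero_rpow_of_pos hq]
  have hcoe : ∀ k x, (((SimpleFunc.eapprox G k).map ENNReal.toNNReal x : ℝ≥0) : ℝ≥0∞) =
      SimpleFunc.eapprox G k x := fun k x =>
    ENNReal.coe_toNNReal (SimpleFunc.eapprox_lt_top _ _ _).ne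
  have hle : ∀ k x, SimpleFunc.eapprox G k x ≤ G x := fun k x => by
    rw [← SimpleFunc.iSup_eapprox_apply hG x]
    exact le_iSup (fun k => SimpleFunc.eapprox G k x) k
  refine ⟨fun k => (SimpleFunc.eapprox G k).map ENNReal.toNNReal, fun k x hx => ?_, fun k => ?_, ?_⟩
  · have h1 := hle k x
    have h2 : G x = 0 := Set.indicator_of_notMem hx _
    rw [h2, nonpos_iff_eq_zero] at h1
    simp [h1]
  · filter_upwards [hGg] with x hx
    rw [hcoe, ← hx]
    exact hle k x
  · filter_upwards [hGg] with x hx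
    simp only [hcoe]
    rw [← hx, ← SimpleFunc.iSup_eapprox_apply hG x]
    exact tendsto_atTop_iSup fun a b hab => SimpleFunc.monotone_eapprox G hab x

end Linearization

/-! ### Vector-valued sparse domination -/

section Main

variable {Ω : Type*} [MeasurableSpace Ω] {μ : Measure Ω} {d m : ℕ}

/-- The tuple `(|f₁|^q, …, |f_m|^q, k)`. -/
def dualizedTuple (q : ℝ) (f : Fin m → SimpleFunc (Fin d → ℝ) (Ω → ℂ))
    (k : SimpleFunc (Fin d → ℝ) (Ω → ℝ≥0)) : Fin (m + 1) → SimpleFunc (Fin d → ℝ) (Ω → ℝ≥0) :=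
  Fin.snoc (α := fun _ => SimpleFunc (Fin d → ℝ) (Ω → ℝ≥0))
    (fun j => (f j).map fun v ω => ‖v ω‖₊ ^ q) k

theorem coe_nnnorm_rpow {q : ℝ} (hq : 0 < q) (z : ℂ) : ((‖z‖₊ ^ q : ℝ≥0) : ℝ≥0∞) = ‖z‖ₑ ^ q :=
  ENNReal.coe_rpow_of_nonneg _ hq.le

/-- Scalar sparse domination for almost every `ω`, with `k(·, ω) ^ (1 / q)` in the place of `g`,
integrated over `Ω`. -/
theorem lintegral_test_le [SigmaFinite μ] {r : Fin m → ℝ} {q : ℝ} (hq : 0 < q) {s : ℝ≥0∞}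
    {T : (Fin m → (Fin d → ℝ) → ℂ) → (Fin d → ℝ) → ℂ} {C_T : ℝ≥0}
    (hT : ∀ (f : Fin m → (Fin d → ℝ) → ℂ) (g : (Fin d → ℝ) → ℂ),
      (∀ j, IsLInftyC (f j)) → IsLInftyC g →
        eLpNorm (fun x => T f x * g x) (ENNReal.ofReal q) volume ≤
          C_T * sparseBound r q s (fun j x => ‖f j x‖ₑ) (fun x => ‖g x‖ₑ))
    {f : Fin m → SimpleFunc (Fin d → ℝ) (Ω → ℂ)} (hf : ∀ j, HasCompactSupport (f j))
    {F : (Fin d → ℝ) → Ω → ℂ}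
    (hFm : AEMeasurable (Function.uncurry F) ((volume : Measure (Fin d → ℝ)).prod μ))
    (hF : ∀ᵐ ω ∂μ, (fun x => F x ω) =ᵐ[volume] T (fun j y => f j y ω))
    {k : SimpleFunc (Fin d → ℝ) (Ω → ℝ≥0)} (hkm : ∀ x, AEMeasurable (k x) μ)
    {S : Set (Fin d → ℝ)} (hS : IsCompact S) (hk : ∀ x ∉ S, ∀ ω, k x ω = 0) :
    ∫⁻ x, ∫⁻ ω, ‖F x ω‖ₑ ^ q * k x ω ∂μ ≤ (C_T : ℝ≥0∞) ^ q *
      ∫⁻ ω, (∫⁻ x, maximalOperator Set.univ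
        (Fin.snoc (α := fun _ => ℝ) (fun j => r j / q) (conjExponent (s / ENNReal.ofReal q)))
        (fun j y => (dualizedTuple q f k j y ω : ℝ≥0∞)) x) ∂μ := by
  have hq' : ENNReal.ofReal q ≠ 0 := by simpa using hq
  have hjoint : AEMeasurable (fun z : (Fin d → ℝ) × Ω => ‖F z.1 z.2‖ₑ ^ q * k z.1 z.2)
      ((volume : Measure (Fin d → ℝ)).prod μ) :=
    (hFm.enorm.pow_const q).mul
      (aemeasurable_uncurry_simpleFunc volume k hkm).coe_nnreal_ennreal
  rw [lintegral_lintegral_swap hjoint, ← lintegral_const_mul' _ _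
    (ENNReal.rpow_lt_top_of_nonneg hq.le ENNReal.coe_ne_top).ne]
  refine lintegral_mono_ae ?_
  filter_upwards [hF] with ω hω
  -- the `q`-th power of the scalar test function `gω` is `k(·, ω)`
  let fω : Fin m → (Fin d → ℝ) → ℂ := fun j y => f j y ω
  let gω : SimpleFunc (Fin d → ℝ) ℂ := k.map fun v => (((v ω ^ (1 / q) : ℝ≥0) : ℝ) : ℂ)
  have hfω : ∀ j, IsLInftyC (fω j) := fun j => by
    have h1 : MemLp (⇑((f j).map fun v : Ω → ℂ => v ω)) ∞ volume :=
      SimpleFunc.memLp_top _ _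
    exact ⟨h1, (hf j).comp_left (g := fun v : Ω → ℂ => v ω) rfl⟩
  have hgω : IsLInftyC gω := by
    refine ⟨gω.memLp_top volume, HasCompactSupport.intro hS fun x hx => ?_⟩
    simp [gω, hk x hx ω, hq.ne']
  have hgn : ∀ x, ‖gω x‖ₑ ^ q = k x ω := by
    intro x
    have h1 : ‖gω x‖ₑ = ((k x ω ^ (1 / q) : ℝ≥0) : ℝ≥0∞) :=
      enorm_toComplex (fun ω => k x ω ^ (1 / q)) ω
    rw [h1, ← ENNReal.coe_rpow_of_nonneg _ hq.le, ← NNReal.rpow_mul, one_div_mul_cancel hq.ne',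
      NNReal.rpow_one]
  have hmain := ENNReal.rpow_le_rpow (hT fω gω hfω hgω) hq.le
  rw [ENNReal.mul_rpow_of_nonneg _ _ hq.le, sparseBound_rpow hq,
    eLpNorm_eq_lintegral_rpow_enorm_toReal hq' ENNReal.ofReal_ne_top, ENNReal.toReal_ofReal hq.le,
    ← ENNReal.rpow_mul, one_div_mul_cancel hq.ne', ENNReal.rpow_one] at hmain
  refine le_of_eq_of_le (lintegral_congr_ae ?_) (hmain.trans (le_of_eq ?_))
  · filter_upwards [hω] with x hx
    rw [hx, enorm_mul, ENNReal.mul_rpow_of_nonneg _ _ hq.le, hgn]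
  · congr 2
    funext x
    congr 1
    funext j
    refine Fin.lastCases ?_ (fun j => ?_) j
    · simp only [Fin.snoc_last, dualizedTuple, hgn]
    · simp only [Fin.snoc_castSucc, dualizedTuple, SimpleFunc.map_apply, coe_nnnorm_rpow hq, fω]

theorem isAdmissible_dualizedTuple {q : ℝ} (hq : 0 < q) {X : Fin m → FunctionNorm Ω}
    {f : Fin m → SimpleFunc (Fin d → ℝ) (Ω → ℂ)} (hf : ∀ j, IsSimpleInto μ (X j) (f j))
    {N : FunctionNorm Ω} {k : SimpleFunc (Fin d → ℝ) (Ω → ℝ≥0)}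
    (hkm : ∀ x, AEMeasurable (k x) μ) (hk : ∀ x, normFun (dualNorm μ N) k x < ∞) :
    IsAdmissible μ (Fin.snoc (α := fun _ => FunctionNorm Ω) (fun j => concavification (X j) q)
      (dualNorm μ N)) (dualizedTuple q f k) := by
  intro j
  refine Fin.lastCases ?_ (fun j => ?_) j
  · simp only [Fin.snoc_last, dualizedTuple]
    exact fun y => ⟨hkm y, hk y⟩
  · simp only [Fin.snoc_castSucc, dualizedTuple]
    refine fun y => ⟨(hf j y).1.nnnorm.pow_const q, ?_⟩
    simp only [normFun, SimpleFunc.map_apply, coe_nnnorm_rpow hq]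
    rw [concavification_rpow hq]
    exact ENNReal.rpow_lt_top_of_nonneg hq.le (hf j y).2.ne

/-- The norms of the dualized tuple are `‖f_j‖ ^ q` and at most `|g| ^ q`, so the scalar maximal
operator of the norms is controlled by the right-hand side of sparse domination. -/
theorem lintegral_normFun_dualizedTuple_le {r : Fin m → ℝ} {q : ℝ} (hq : 0 < q) {s : ℝ≥0∞}
    {X : Fin m → FunctionNorm Ω} {N : FunctionNorm Ω}
    (hpos : ∀ j, 0 < (Fin.snoc (α := fun _ => ℝ) (fun j => r j / q)
      (conjExponent (s / ENNReal.ofReal q)) : Fin (m + 1) → ℝ) j)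
    (f : Fin m → SimpleFunc (Fin d → ℝ) (Ω → ℂ)) {k : SimpleFunc (Fin d → ℝ) (Ω → ℝ≥0)}
    {g : (Fin d → ℝ) → ℂ} (hk : ∀ᵐ x, normFun (dualNorm μ N) k x ≤ ‖g x‖ₑ ^ q) :
    ∫⁻ x, maximalOperator Set.univ
      (Fin.snoc (α := fun _ => ℝ) (fun j => r j / q) (conjExponent (s / ENNReal.ofReal q)))
      (fun j => normFun ((Fin.snoc (α := fun _ => FunctionNorm Ω)
        (fun j => concavification (X j) q) (dualNorm μ N) : Fin (m + 1) → FunctionNorm Ω) j)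
        (dualizedTuple q f k j)) x ≤
      sparseBound r q s (fun j => pointwiseNorm (X j) (f j)) (fun x => ‖g x‖ₑ) ^ q := by
  rw [sparseBound_rpow hq]
  refine lintegral_mono fun x => maximalOperator_mono_ae hpos (fun j => ?_) x
  refine Fin.lastCases ?_ (fun j => ?_) j
  · simpa only [Fin.snoc_last, dualizedTuple] using hk
  · simp only [Fin.snoc_castSucc, dualizedTuple]
    refine Eventually.of_forall fun y => le_of_eq ?_
    simp only [normFun, SimpleFunc.map_apply, coe_nnnorm_rpow hq]
    rw [concavification_rpow hq]
    rfl

end Main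

end SparseDomination

end

open SparseDomination

theorem mainTheorem1 {d m : ℕ} (hd : 0 < d) (hm : 0 < m)
    {Ω : Type*} [MeasurableSpace Ω] (μ : Measure Ω) [SigmaFinite μ]
    (r : Fin m → ℝ) (hr : ∀ j, 0 < r j) (q : ℝ) (hq : 0 < q)
    (s : ℝ≥0∞) (hs : ENNReal.ofReal q < s)
    (X : Fin m → FunctionNorm Ω) (hX : IsTuple μ X)
    (hUMD : UMDProperty d μ (fun j => concavification (X j) q) (fun j => r j / q)
      (s / ENNReal.ofReal q)) :
    ∃ K : ℝ≥0, ∀ (T : (Fin m → (Fin d → ℝ) → ℂ) → (Fin d → ℝ) → ℂ) (C_T : ℝ≥0),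
      (∀ (f : Fin m → (Fin d → ℝ) → ℂ) (g : (Fin d → ℝ) → ℂ),
        (∀ j, IsLInftyC (f j)) → IsLInftyC g →
          eLpNorm (fun x => T f x * g x) (ENNReal.ofReal q) volume ≤
            C_T * sparseBound r q s (fun j x => ‖f j x‖ₑ) (fun x => ‖g x‖ₑ)) →
      ∀ Text : (Fin m → SimpleFunc (Fin d → ℝ) (Ω → ℂ)) → (Fin d → ℝ) → Ω → ℂ,
        (∀ f, IsSimpleTuple μ X f → IsPointwiseExtension μ X T f (Text f)) →
        ∀ f, IsSimpleTuple μ X f → ∀ g : (Fin d → ℝ) → ℂ, IsLInftyC g →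
          eLpNorm (fun x => pointwiseNorm (productNorm μ X) (Text f) x * ‖g x‖ₑ)
              (ENNReal.ofReal q) volume ≤
            K * C_T * sparseBound r q s (fun j => pointwiseNorm (X j) (f j)) (fun x => ‖g x‖ₑ) := by
  have hmax := isMaximalTuple_of_umdProperty hr hq hs hX hUMD
  obtain ⟨A, hA⟩ := exists_lintegral_maximalOperator_le hmax
  -- the constant of `exists_norming_simpleFunc`
  set c : ℝ≥0∞ := (2 ^ q) ^ 2 with hc
  have hct : c ≠ ∞ := ENNReal.pow_ne_top (ENNReal.rpow_lt_top_of_nonneg hq.le (by norm_num)).ne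
  have hq' : ENNReal.ofReal q ≠ 0 := by simpa using hq
  refine ⟨(c.toNNReal * A) ^ (1 / q), fun T C_T hT Text hText f hf g hg => ?_⟩
  obtain ⟨hTF, hFs⟩ := hText f hf
  set F := Text f with hFdef
  obtain ⟨h, hhm, hh1, hhF⟩ := exists_norming_simpleFunc hq hUMD.2.1 hUMD.2.2.1 hFs
  obtain ⟨φ, hφ0, hφle, hφlim⟩ := exists_simpleFunc_approx hq hg.1.1
  set N : FunctionNorm Ω := productNorm μ fun j => concavification (X j) q with hN
  set B : ℝ≥0∞ := sparseBound r q s (fun j => pointwiseNorm (X j) (f j)) (fun x => ‖g x‖ₑ) with hB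
  -- simple functions with dual norms at most `|g| ^ q` that norm `|F| ^ q |g| ^ q` in the limit
  let k : ℕ → SimpleFunc (Fin d → ℝ) (Ω → ℝ≥0) := fun i =>
    ((φ i).pair (h i)).map fun p ω => p.1 * p.2 ω
  have hkap : ∀ i x ω, k i x ω = φ i x * h i x ω := fun i x ω => rfl
  have hkm : ∀ i x, AEMeasurable (k i x) μ := fun i x => ((hhm i x).const_mul _).aemeasurable
  have hkn : ∀ i x, normFun (dualNorm μ N) (k i) x ≤ φ i x := by
    intro i x
    simp only [normFun, hkap, ENNReal.coe_mul]
    rw [dualNorm_smul]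
    exact mul_le_of_le_one_right zero_le (hh1 i x)
  have htest : ∀ i, ∫⁻ x, ∫⁻ ω, ‖F x ω‖ₑ ^ q * k i x ω ∂μ ≤ (C_T : ℝ≥0∞) ^ q * (A * B ^ q) := by
    intro i
    refine (lintegral_test_le hq hT (fun j => (hf j).2) hFs.1 hTF (hkm i) hg.2
      (fun x hx ω => by rw [hkap, hφ0 i x hx, zero_mul])).trans ?_
    gcongr
    refine (hA _ (isAdmissible_dualizedTuple hq (fun j => (hf j).1) (hkm i) fun x =>
      (hkn i x).trans_lt ENNReal.coe_lt_top)).trans ?_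
    gcongr
    refine lintegral_normFun_dualizedTuple_le hq hmax.pos f ?_
    filter_upwards [hφle i] with x hx
    exact (hkn i x).trans hx
  have hLHS : ∫⁻ x, (pointwiseNorm (productNorm μ X) F x * ‖g x‖ₑ) ^ q ≤
      c * ((C_T : ℝ≥0∞) ^ q * (A * B ^ q)) := by
    calc ∫⁻ x, (pointwiseNorm (productNorm μ X) F x * ‖g x‖ₑ) ^ q
        ≤ ∫⁻ x, c * liminf (fun i => ∫⁻ ω, ‖F x ω‖ₑ ^ q * k i x ω ∂μ) atTop := by
          refine lintegral_mono_ae ?_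
          filter_upwards [hhF, hφlim] with x hx hφx
          rw [ENNReal.mul_rpow_of_nonneg _ _ hq.le, ← hφx.liminf_eq]
          refine (mul_le_mul_left hx _).trans ?_
          rw [mul_assoc]
          refine mul_le_mul_right (ENNReal.le_liminf_mul.trans (le_of_eq ?_)) _
          congr 1
          funext i
          rw [Pi.mul_apply, ← lintegral_mul_const' _ _ ENNReal.coe_ne_top]
          refine lintegral_congr fun ω => ?_
          rw [hkap, ENNReal.coe_mul]
          ring
      _ = c * ∫⁻ x, liminf (fun i => ∫⁻ ω, ‖F x ω‖ₑ ^ q * k i x ω ∂μ) atTop :=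
          lintegral_const_mul' _ _ hct
      _ ≤ c * liminf (fun i => ∫⁻ x, ∫⁻ ω, ‖F x ω‖ₑ ^ q * k i x ω ∂μ) atTop := by
          refine mul_le_mul_right (lintegral_liminf_le' fun i => ?_) _
          have hj : AEMeasurable (fun z : (Fin d → ℝ) × Ω => ‖F z.1 z.2‖ₑ ^ q * k i z.1 z.2)
              ((volume : Measure (Fin d → ℝ)).prod μ) :=
            (hFs.1.enorm.pow_const q).mul
              (aemeasurable_uncurry_simpleFunc volume (k i) (hkm i)).coe_nnreal_ennreal
          exact hj.lintegral_prod_right'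
      _ ≤ c * ((C_T : ℝ≥0∞) ^ q * (A * B ^ q)) := by
          gcongr
          exact liminf_le_of_le (by isBoundedDefault) fun b hb => by
            obtain ⟨i, hi⟩ := hb.exists
            exact hi.trans (htest i)
  rw [eLpNorm_eq_lintegral_rpow_enorm_toReal hq' ENNReal.ofReal_ne_top, ENNReal.toReal_ofReal hq.le]
  simp only [enorm_eq_self]
  calc (∫⁻ x, (pointwiseNorm (productNorm μ X) F x * ‖g x‖ₑ) ^ q) ^ (1 / q)
      ≤ (c * ((C_T : ℝ≥0∞) ^ q * (A * B ^ q))) ^ (1 / q) :=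
        ENNReal.rpow_le_rpow hLHS (by positivity)
    _ = ((c * A) * ((C_T * B) ^ q)) ^ (1 / q) := by
        rw [ENNReal.mul_rpow_of_nonneg _ _ hq.le]
        ring_nf
    _ = (((c.toNNReal * A) ^ (1 / q) : ℝ≥0) : ℝ≥0∞) * C_T * B := by
        rw [ENNReal.mul_rpow_of_nonneg _ _ (by positivity), ← ENNReal.rpow_mul,
          mul_one_div_cancel hq.ne', ENNReal.rpow_one, ENNReal.coe_rpow_of_nonneg _ (by positivity),
          ENNReal.coe_mul, ENNReal.coe_toNNReal hct, mul_assoc]
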